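/- Let $G(\xi)=\frac1{4\pi}e^{-|\xi|^2/4}$, $\xi\in\mathbb R^2$, and let $X=L^2(\mathbb R^2,G^{-1}d\xi;\mathbb C)$ with scalar product $\langle w_1,w_2\rangle=\int_{\mathbb R^2}G^{-1}\,\overline{w_1}\,w_2\,d\xi$. Write $\xi^\perp=(-\xi_2,\xi_1)$, let $K(\xi)=\frac1{2\pi}\frac{\xi^\perp}{|\xi|^2}$ be the Biot-Savart kernel, and let $v^G(\xi)=\frac1{2\pi}\frac{\xi^\perp}{|\xi|^2}\bigl(1-e^{-|\xi|^2/4}\bigr)$ (with $v^G(0)=0$). Consider in $X$ the operators $$\mathcal L w=\Delta w+\tfrac12\,\xi\cdot\nabla w+w,\qquad D(\mathcal L)=\{w\in X\mid \Delta w\in X,\ \xi\cdot\nabla w\in X\},$$ $$\Lambda w=v^G\cdot\nabla w+(K*w)\cdot\nabla G,\qquad D(\Lambda)=\{w\in X\mid v^G\cdot\nabla w\in X,\ (K*w)\cdot\nabla G\in X\},$$ where derivatives of $w$ are taken in the sense of distributions, and let $\mathcal L-\alpha\Lambda$ have domain $D(\mathcal L)\cap D(\Lambda)$. Let $$X_0=\Bigl\{w\in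 X\Bigm|\int_{\mathbb R^2}w\,d\xi=0\Bigr\},\qquad X_1=\Bigl\{w\in X_0\Bigm|\int_{\mathbb R^2}\xi_i w\,d\xi=0,\ i=1,2\Bigr\}.$$ Proposition. For every $\alpha\in\mathbb R$, the spectrum of $\mathcal L-\alpha\Lambda$ in $X$ satisfies $$\sigma(\mathcal L-\alpha\Lambda)\subset\{z\in\mathbb C\mid \operatorname{Re}z\le 0\}.$$ Moreover, the subspaces $X_0$ and $X_1$ are invariant under $\mathcal L-\alpha\Lambda$ (that is, $(\mathcal L-\alpha\Lambda)w\in X_j$ for every $w\in X_j$ in the domain), and the spectra of the restrictions of $\mathcal L-\alpha\Lambda$ to $X_0$ and to $X_1$ satisfy $$\sigma\bigl((\mathcal L-\alpha\Lambda)|_{X_0}\bigr)\subset\{z\in\mathbb C\mid\operatorname{Re}z\le-\tfrac12\},\qquad \sigma\bigl((\mathcal L-\alpha\Lambda)|_{X_1}\bigr)\subset\{z\in\mathbb C\mid\operatorname{Re}z\le-1\}.$$ Here the spectrum of an operator $A$ in $E$ is the complement of the set of $z\in\mathbb C$ for which $z-A:D(A)\to E$ is bijective with bounded inverse. -/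

import Mathlib

open MeasureTheory Set
open scoped ContDiff Topology

noncomputable section

namespace Oseen

/-- The plane `ℝ²` with its Euclidean norm. -/
abbrev Plane := EuclideanSpace ℝ (Fin 2)

/-- The Gaussian vorticity profile `G(ξ) = (4π)⁻¹ exp(-|ξ|²/4)`. -/
def gaussian (ξ : Plane) : ℝ := (4 * Real.pi)⁻¹ * Real.exp (-‖ξ‖ ^ 2 / 4)

/-- `x^⊥ = (-x₂, x₁)`. -/
def perp (x : Plane) : Plane := !₂[-x 1, x 0]

/-- The Biot-Savart kernel `K(x) = (2π)⁻¹ x^⊥ / |x|²`. -/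
def biotSavartKernel (x : Plane) : Plane := ((2 * Real.pi)⁻¹ * (‖x‖ ^ 2)⁻¹) • perp x

/-- The velocity profile `v^G(ξ) = (2π)⁻¹ (ξ^⊥ / |ξ|²) (1 - exp(-|ξ|²/4))`, with `v^G(0) = 0`. -/
def vortexVelocity (ξ : Plane) : Plane :=
  ((2 * Real.pi)⁻¹ * (‖ξ‖ ^ 2)⁻¹ * (1 - Real.exp (-‖ξ‖ ^ 2 / 4))) • perp ξ

/-- The measure `G⁻¹ dξ`. -/
def weightedMeasure : Measure Plane :=
  (volume : Measure Plane).withDensity fun ξ => ENNReal.ofReal (gaussian ξ)⁻¹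

/-- The (complexified) Hilbert space `X = L²(ℝ², G⁻¹ dξ)`. -/
abbrev X := Lp ℂ 2 weightedMeasure

/-- The divergence of a vector field on the plane. -/
def divergence (F : Plane → Plane) (ξ : Plane) : ℝ :=
  ∑ i, (fderiv ℝ F ξ (EuclideanSpace.single i 1)) i

/-! ### Integrability of elements of `X` -/

theorem gaussian_pos (ξ : Plane) : 0 < gaussian ξ := by
  unfold gaussian; positivity

theorem continuous_gaussian : Continuous gaussian := by
  unfold gaussian; fun_prop

theorem volume_ac : (volume : Measure Plane) ≪ weightedMeasure := by
  refine withDensity_absolutelyContinuous' ?_ ?_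
  · exact (ENNReal.measurable_ofReal.comp continuous_gaussian.measurable.inv).aemeasurable
  · exact Filter.Eventually.of_forall fun ξ => by
      simpa using gaussian_pos ξ

theorem ac_volume : weightedMeasure ≪ (volume : Measure Plane) :=
  withDensity_absolutelyContinuous _ _

theorem integrable_weighted_iff {E : Type*} [NormedAddCommGroup E] [NormedSpace ℝ E]
    {f : Plane → E} :
    Integrable f weightedMeasure ↔ Integrable (fun ξ => (gaussian ξ)⁻¹ • f ξ) volume := by
  unfold weightedMeasure
  rw [integrable_withDensity_iff_integrable_smul']
  · refine integrable_congr (Filter.Eventually.of_forall fun ξ => ?_)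
    simp only
    rw [ENNReal.toReal_ofReal (inv_nonneg.2 (gaussian_pos ξ).le)]
  · exact ENNReal.measurable_ofReal.comp continuous_gaussian.measurable.inv
  · simp

theorem integrable_mul_of_sq (w : X) {g : Plane → ℝ} (hg : Continuous g)
    (h : Integrable (fun ξ => g ξ ^ 2 * gaussian ξ) volume) :
    Integrable (fun ξ => (g ξ : ℂ) * w ξ) volume := by
  have h1 : MemLp (fun ξ => ((g ξ * gaussian ξ : ℝ) : ℂ)) 2 weightedMeasure := by
    rw [memLp_two_iff_integrable_sq_norm (by
      have := continuous_gaussian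
      exact Continuous.aestronglyMeasurable (by fun_prop))]
    rw [integrable_weighted_iff]
    refine h.congr (Filter.Eventually.of_forall fun ξ => ?_)
    have := (gaussian_pos ξ).ne'
    simp only [Complex.norm_real, Real.norm_eq_abs, sq_abs, smul_eq_mul]
    field_simp
  have h2 := h1.integrable_mul (Lp.memLp w)
  rw [integrable_weighted_iff] at h2
  refine h2.congr (Filter.Eventually.of_forall fun ξ => ?_)
  have : (gaussian ξ : ℂ) ≠ 0 := by exact_mod_cast (gaussian_pos ξ).ne'
  simp only [Pi.mul_apply, Complex.real_smul]
  push_cast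
  field_simp

theorem integrable_exp_sq {b : ℝ} (hb : 0 < b) :
    Integrable (fun ξ : Plane => Real.exp (-b * ‖ξ‖ ^ 2)) volume := by
  have h := (GaussianFourier.integrable_cexp_neg_mul_sq_norm_add (V := Plane) (b := (b : ℂ))
    (by simpa using hb) 0 0).norm
  refine h.congr (Filter.Eventually.of_forall fun ξ => ?_)
  simp only [zero_mul, add_zero]
  rw [Complex.norm_exp]
  norm_cast

theorem integrable_gaussian : Integrable gaussian volume := by
  unfold gaussian
  refine ((integrable_exp_sq (b := 1 / 4) (by norm_num)).const_mul (4 * Real.pi)⁻¹).congr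
    (Filter.Eventually.of_forall fun ξ => ?_)
  simp only
  ring_nf

theorem integrable_X (w : X) : Integrable w volume := by
  have := integrable_mul_of_sq w (g := fun _ => 1) continuous_const
    (by simpa using integrable_gaussian)
  simpa using this

theorem integrable_coord_mul_X (i : Fin 2) (w : X) :
    Integrable (fun ξ : Plane => ((ξ i : ℝ) : ℂ) * w ξ) volume := by
  refine integrable_mul_of_sq w (g := fun ξ => ξ i) (by fun_prop) ?_
  refine ((integrable_exp_sq (b := 1 / 8) (by norm_num)).const_mul (8 * (4 * Real.pi)⁻¹)).mono'
    (Continuous.aestronglyMeasurable (by have := continuous_gaussian; fun_prop))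
    (Filter.Eventually.of_forall fun ξ => ?_)
  have h0 : (ξ i) ^ 2 ≤ ‖ξ‖ ^ 2 := by
    rw [← sq_abs]
    exact pow_le_pow_left₀ (abs_nonneg _) (by simpa using PiLp.norm_apply_le ξ i) 2
  have h1 : ‖ξ‖ ^ 2 ≤ 8 * Real.exp (‖ξ‖ ^ 2 / 8) := by
    have := Real.add_one_le_exp (‖ξ‖ ^ 2 / 8)
    linarith
  have h2 : Real.exp (-‖ξ‖ ^ 2 / 4) * Real.exp (‖ξ‖ ^ 2 / 8) = Real.exp (-(1 / 8) * ‖ξ‖ ^ 2) := by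
    rw [← Real.exp_add]; ring_nf
  have h3 := gaussian_pos ξ
  rw [Real.norm_of_nonneg (by positivity), ← h2]
  calc (ξ i) ^ 2 * gaussian ξ ≤ (8 * Real.exp (‖ξ‖ ^ 2 / 8)) * gaussian ξ := by gcongr; linarith
    _ = _ := by unfold gaussian; ring

theorem integrable_X_mul (w : X) {g : Plane → ℝ} (hg : Continuous g) (hc : HasCompactSupport g) :
    Integrable (fun ξ => w ξ * (g ξ : ℂ)) volume := by
  obtain ⟨C, hC⟩ := hc.exists_bound_of_continuous hg
  refine (integrable_X w).mul_bdd (c := C)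
    (Continuous.aestronglyMeasurable (by fun_prop)) (Filter.Eventually.of_forall fun ξ => ?_)
  simpa using hC ξ

theorem coeFn_add_ae (u v : X) : ∀ᵐ ξ, (u + v : X) ξ = u ξ + v ξ := by
  filter_upwards [volume_ac.ae_le (Lp.coeFn_add u v)] with ξ h using h

theorem coeFn_smul_ae (c : ℂ) (u : X) : ∀ᵐ ξ, (c • u : X) ξ = c * u ξ := by
  filter_upwards [volume_ac.ae_le (Lp.coeFn_smul c u)] with ξ h using h

theorem coeFn_zero_ae : ∀ᵐ ξ, (0 : X) ξ = 0 := by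
  filter_upwards [volume_ac.ae_le (Lp.coeFn_zero ℂ 2 weightedMeasure)] with ξ h using h

theorem integral_add_mul (u v : X) {g : Plane → ℂ} (hu : Integrable (fun ξ => u ξ * g ξ))
    (hv : Integrable (fun ξ => v ξ * g ξ)) :
    ∫ ξ, (u + v : X) ξ * g ξ = (∫ ξ, u ξ * g ξ) + ∫ ξ, v ξ * g ξ := by
  rw [← integral_add hu hv]
  refine integral_congr_ae ?_
  filter_upwards [coeFn_add_ae u v] with ξ h
  rw [h, add_mul]

theorem integral_smul_mul (c : ℂ) (u : X) (g : Plane → ℂ) :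
    ∫ ξ, (c • u : X) ξ * g ξ = c * ∫ ξ, u ξ * g ξ := by
  rw [← integral_const_mul]
  refine integral_congr_ae ?_
  filter_upwards [coeFn_smul_ae c u] with ξ h
  rw [h, mul_assoc]

theorem integral_zero_mul (g : Plane → ℂ) : ∫ ξ, (0 : X) ξ * g ξ = 0 := by
  refine integral_eq_zero_of_ae ?_
  filter_upwards [coeFn_zero_ae] with ξ h
  rw [h, zero_mul, Pi.zero_apply]

/-! ### Distributional differential operators in `X` -/

/-- The graph of the maximal realization in `X` of the linear differential operator whose formal
transpose is `T`: all pairs `(w, f)` of elements of `X` such that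
`∫ f φ dξ = ∫ w (T φ) dξ` for all test functions `φ`. -/
def weakGraph (T : (Plane → ℝ) → Plane → ℝ)
    (hT : ∀ φ, ContDiff ℝ ∞ φ → HasCompactSupport φ →
      Continuous (T φ) ∧ HasCompactSupport (T φ)) : Submodule ℂ (X × X) where
  carrier := {p | ∀ φ : Plane → ℝ, ContDiff ℝ ∞ φ → HasCompactSupport φ →
    ∫ ξ, p.2 ξ * (φ ξ : ℂ) = ∫ ξ, p.1 ξ * (T φ ξ : ℂ)}
  add_mem' := by
    intro p q hp hq φ h1 h2
    obtain ⟨h3, h4⟩ := hT φ h1 h2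
    rw [Prod.snd_add, Prod.fst_add,
      integral_add_mul _ _ (integrable_X_mul _ h1.continuous h2)
        (integrable_X_mul _ h1.continuous h2),
      integral_add_mul _ _ (integrable_X_mul _ h3 h4) (integrable_X_mul _ h3 h4),
      hp φ h1 h2, hq φ h1 h2]
  zero_mem' := by
    intro φ _ _
    rw [Prod.snd_zero, Prod.fst_zero, integral_zero_mul, integral_zero_mul]
  smul_mem' := by
    intro c p hp φ h1 h2
    rw [Prod.smul_snd, Prod.smul_fst, integral_smul_mul, integral_smul_mul, hp φ h1 h2]

theorem X_ext {u v : X} (h : ∀ᵐ ξ : Plane, u ξ = v ξ) : u = v :=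
  Lp.ext (ac_volume.ae_le h)

/-- The graph above is single-valued. -/
theorem weakGraph_single_valued (T : (Plane → ℝ) → Plane → ℝ)
    (hT : ∀ φ, ContDiff ℝ ∞ φ → HasCompactSupport φ →
      Continuous (T φ) ∧ HasCompactSupport (T φ)) :
    ∀ p ∈ weakGraph T hT, p.1 = 0 → p.2 = 0 := by
  rintro ⟨w, f⟩ hp (rfl : w = 0)
  refine X_ext ?_
  have := ae_eq_zero_of_integral_contDiff_smul_eq_zero (μ := (volume : Measure Plane))
    (integrable_X f).locallyIntegrable (fun φ h1 h2 => by
      have h := hp φ h1 h2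
      rw [integral_zero_mul] at h
      rw [← h]
      refine integral_congr_ae (Filter.Eventually.of_forall fun ξ => ?_)
      simp [mul_comm])
  filter_upwards [this, coeFn_zero_ae] with ξ h1 h2
  rw [h1, h2]

theorem laplacian_test (φ : Plane → ℝ) (h1 : ContDiff ℝ ∞ φ) (h2 : HasCompactSupport φ) :
    Continuous (Laplacian.laplacian φ) ∧ HasCompactSupport (Laplacian.laplacian φ) := by
  have e := InnerProductSpace.laplacian_eq_iteratedFDeriv_stdOrthonormalBasis φ
  constructor
  · rw [e]
    refine continuous_finsetSum _ fun i _ => ?_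
    have := (contDiff_infty.1 h1 2).continuous_iteratedFDeriv (m := 2) (by norm_num)
    exact (continuous_eval_const _).comp this
  · refine (h2.iteratedFDeriv (𝕜 := ℝ) 2).mono ?_
    intro x hx hx'
    apply hx
    rw [e]
    simp [hx']

/-- The maximal distributional Laplacian in `X`: `D = {w ∈ X | Δw ∈ X}`, `w ↦ Δw`. -/
def laplacianOp : X →ₗ.[ℂ] X :=
  (weakGraph Laplacian.laplacian laplacian_test).toLinearPMap

theorem divergence_test {b : Plane → Plane} (hb : ContDiff ℝ ∞ b) (φ : Plane → ℝ)
    (h1 : ContDiff ℝ ∞ φ) (h2 : HasCompactSupport φ) :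
    Continuous (fun ξ => -divergence (fun η => φ η • b η) ξ) ∧
      HasCompactSupport (fun ξ => -divergence (fun η => φ η • b η) ξ) := by
  have h3 : ContDiff ℝ ∞ (fun η => φ η • b η) := h1.smul hb
  have h4 : HasCompactSupport (fun η => φ η • b η) := h2.smul_right
  constructor
  · unfold divergence
    have := h3.continuous_fderiv (by simp)
    fun_prop
  · refine (h4.fderiv (𝕜 := ℝ)).mono ?_
    intro x hx hx'
    apply hx
    simp [divergence, hx']

/-- The maximal distributional advection operator in `X` along a smooth vector field `b`:
`D = {w ∈ X | b · ∇w ∈ X}`, `w ↦ b · ∇w`, where `⟨b · ∇w, φ⟩ = -∫ w div(φ b) dξ`. -/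
def advectionOp (b : Plane → Plane) (hb : ContDiff ℝ ∞ b) : X →ₗ.[ℂ] X :=
  (weakGraph (fun φ ξ => -divergence (fun η => φ η • b η) ξ) (divergence_test hb)).toLinearPMap

theorem graph_laplacianOp :
    laplacianOp.graph = weakGraph Laplacian.laplacian laplacian_test :=
  Submodule.toLinearPMap_graph_eq _ (fun p hp => weakGraph_single_valued _ _ p hp)

theorem graph_advectionOp (b : Plane → Plane) (hb : ContDiff ℝ ∞ b) :
    (advectionOp b hb).graph =
      weakGraph (fun φ ξ => -divergence (fun η => φ η • b η) ξ) (divergence_test hb) :=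
  Submodule.toLinearPMap_graph_eq _ (fun p hp => weakGraph_single_valued _ _ p hp)

/-- `𝓛 = Δ + ½ ξ · ∇ + 1` in `X`, with `D(𝓛) = {w ∈ X | Δw ∈ X, ξ · ∇w ∈ X}`. -/
def diffusionOp : X →ₗ.[ℂ] X :=
  laplacianOp + (1 / 2 : ℂ) • advectionOp (fun ξ => ξ) contDiff_id +
    (LinearMap.id : X →ₗ[ℂ] X).toPMap ⊤

/-! ### The operator `Λ` -/

theorem contDiff_entire : ContDiff ℝ ∞ (dslope (fun s : ℝ => 1 - Real.exp (-s)) 0) := by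
  refine contDiff_iff_contDiffAt.2 fun x => ?_
  have ha : ∀ y : ℝ, AnalyticAt ℝ (fun s : ℝ => 1 - Real.exp (-s)) y := fun y => by fun_prop
  rcases eq_or_ne x 0 with rfl | hx
  · obtain ⟨p, hp⟩ := ha 0
    exact AnalyticAt.contDiffAt ⟨_, hp.has_fpower_series_dslope_fslope⟩
  · have h1 : ContDiffAt ℝ ∞ (fun s : ℝ => s⁻¹ * (1 - Real.exp (-s))) x :=
      (contDiffAt_inv ℝ hx).mul (ha x).contDiffAt
    refine h1.congr_of_eventuallyEq ?_
    filter_upwards [dslope_eventuallyEq_slope_of_ne (fun s : ℝ => 1 - Real.exp (-s)) hx] with s hs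
    rw [hs, slope_def_field]
    simp
    ring

/-- The field `v^G` is smooth on the whole plane. -/
theorem contDiff_vortexVelocity : ContDiff ℝ ∞ vortexVelocity := by
  have e : vortexVelocity = fun ξ => ((8 * Real.pi)⁻¹ *
      dslope (fun s : ℝ => 1 - Real.exp (-s)) 0 (‖ξ‖ ^ 2 / 4)) • perp ξ := by
    funext ξ
    unfold vortexVelocity
    rcases eq_or_ne ξ 0 with rfl | hξ
    · have : perp 0 = 0 := by ext i; fin_cases i <;> simp [perp]
      simp [this]
    · have h : ‖ξ‖ ≠ 0 := norm_ne_zero_iff.2 hξ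
      rw [dslope_of_ne _ (by positivity), slope_def_field]
      congr 1
      have := Real.pi_ne_zero
      simp only [neg_zero, Real.exp_zero, sub_self, sub_zero]
      rw [neg_div]
      field_simp
      ring
  have hp : ContDiff ℝ ∞ perp := by
    rw [contDiff_euclidean]
    intro i
    fin_cases i
    · simp only [perp]
      simpa using (by fun_prop : ContDiff ℝ ∞ fun x : Plane => -x 1)
    · simp only [perp]
      simpa using (by fun_prop : ContDiff ℝ ∞ fun x : Plane => x 0)
  rw [e]
  have hn : ContDiff ℝ ∞ (fun ξ : Plane => ‖ξ‖ ^ 2 / 4) := (contDiff_norm_sq ℝ).div_const _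
  exact (contDiff_const.mul (contDiff_entire.comp hn)).smul hp

/-- The components of the velocity field `v = K * w` given by the Biot-Savart law. -/
def velocity (w : X) (i : Fin 2) (ξ : Plane) : ℂ :=
  ∫ η, (biotSavartKernel (ξ - η) i : ℂ) * w η

/-- The function `(K * w) · ∇G`. -/
def nonlocalTerm (w : X) (ξ : Plane) : ℂ :=
  ∑ i, velocity w i ξ * ((gradient gaussian ξ i : ℝ) : ℂ)

theorem norm_biotSavartKernel_le (x : Plane) (i : Fin 2) :
    ‖biotSavartKernel x i‖ ≤ ‖x‖⁻¹ := by
  have h1 : |perp x i| ≤ ‖x‖ := by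
    fin_cases i
    · simpa [perp] using PiLp.norm_apply_le x 1
    · simpa [perp] using PiLp.norm_apply_le x 0
  have h2 : (2 * Real.pi)⁻¹ ≤ 1 := inv_le_one_of_one_le₀ (by linarith [Real.pi_gt_three])
  have h3 : 0 < (2 * Real.pi)⁻¹ := by positivity
  simp only [biotSavartKernel, PiLp.smul_apply, smul_eq_mul, Real.norm_eq_abs]
  rw [abs_mul, abs_of_nonneg (by positivity : 0 ≤ (2 * Real.pi)⁻¹ * (‖x‖ ^ 2)⁻¹)]
  rcases eq_or_ne (‖x‖) 0 with h | h
  · simp [h]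
  · calc _ ≤ 1 * (‖x‖ ^ 2)⁻¹ * ‖x‖ := by gcongr
      _ = ‖x‖⁻¹ := by field_simp

theorem measurable_biotSavartKernel (i : Fin 2) :
    Measurable (fun x : Plane => biotSavartKernel x i) := by
  have h : ∀ i, Measurable (fun x : Plane => perp x i) := by
    intro i
    fin_cases i
    · simp only [perp]; simpa using (by fun_prop : Measurable fun x : Plane => -x 1)
    · simp only [perp]; simpa using (by fun_prop : Measurable fun x : Plane => x 0)
  have := h i
  simp only [biotSavartKernel, PiLp.smul_apply, smul_eq_mul]
  fun_prop

theorem integrable_near :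
    Integrable (fun x : Plane => (Iio (1 : ℝ)).indicator (fun r => r⁻¹) ‖x‖) volume := by
  rw [integrable_fun_norm_addHaar (volume : Measure Plane)
    (f := (Iio (1 : ℝ)).indicator (fun r => r⁻¹))]
  have h : IntegrableOn (fun _ : ℝ => (1 : ℝ)) (Ioo 0 1) volume := by
    simp
  have h' : Integrable ((Ioo (0 : ℝ) 1).indicator fun _ => (1 : ℝ)) volume :=
    h.integrable_indicator measurableSet_Ioo
  refine h'.integrableOn.congr_fun (fun y hy => ?_) measurableSet_Ioi
  have hy' : (0 : ℝ) < y := hy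
  by_cases h1 : y < 1
  · simp [indicator, h1, hy', hy'.ne']
  · simp [indicator, h1]

/-- For `w ∈ X`, the Biot-Savart integral converges absolutely at almost every point. -/
theorem ae_integrable_biotSavart (w : X) (i : Fin 2) :
    ∀ᵐ ξ : Plane, Integrable (fun η => (biotSavartKernel (ξ - η) i : ℂ) * w η) volume := by
  have hm : Measurable (fun x : Plane => (biotSavartKernel x i : ℂ)) :=
    Complex.measurable_ofReal.comp (measurable_biotSavartKernel i)
  have hs : MeasurableSet {x : Plane | ‖x‖ < 1} := measurableSet_lt measurable_norm measurable_const
  set k1 : Plane → ℂ := {x : Plane | ‖x‖ < 1}.indicator fun x => (biotSavartKernel x i : ℂ) with hk1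
  set k2 : Plane → ℂ := {x : Plane | ‖x‖ < 1}ᶜ.indicator
    fun x => (biotSavartKernel x i : ℂ) with hk2
  have i1 : Integrable k1 volume := by
    refine integrable_near.mono' (hm.indicator hs).aestronglyMeasurable
      (Filter.Eventually.of_forall fun x => ?_)
    by_cases hx : ‖x‖ < 1
    · simpa [hk1, indicator, hx] using norm_biotSavartKernel_le x i
    · simp [hk1, indicator, hx]
  have b2 : ∀ x, ‖k2 x‖ ≤ 1 := by
    intro x
    by_cases hx : ‖x‖ < 1
    · simp [hk2, hx]
    · have : ‖x‖⁻¹ ≤ 1 := inv_le_one_of_one_le₀ (not_lt.1 hx)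
      simpa [hk2, hx] using (norm_biotSavartKernel_le x i).trans this
  have a1 := (integrable_X w).ae_convolution_exists (ContinuousLinearMap.mul ℂ ℂ) i1
  filter_upwards [a1] with ξ h1
  have h1' : Integrable (fun η => k1 (ξ - η) * w η) volume := by
    simpa [mul_comm] using h1.integrable
  have h2' : Integrable (fun η => k2 (ξ - η) * w η) volume :=
    (integrable_X w).bdd_mul (c := 1)
      ((hm.indicator hs.compl).comp (measurable_const.sub measurable_id)).aestronglyMeasurable
      (Filter.Eventually.of_forall fun η => b2 _)
  refine (h1'.add h2').congr (Filter.Eventually.of_forall fun η => ?_)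
  simp only [Pi.add_apply]
  rw [← add_mul]
  congr 1
  exact congrFun (indicator_self_add_compl {x : Plane | ‖x‖ < 1}
    fun x => (biotSavartKernel x i : ℂ)) (ξ - η)

theorem velocity_add (u v : X) (i : Fin 2) :
    ∀ᵐ ξ, velocity (u + v) i ξ = velocity u i ξ + velocity v i ξ := by
  filter_upwards [ae_integrable_biotSavart u i, ae_integrable_biotSavart v i] with ξ h1 h2
  unfold velocity
  rw [← integral_add h1 h2]
  refine integral_congr_ae ?_
  filter_upwards [coeFn_add_ae u v] with η h
  rw [h, mul_add]

theorem velocity_smul (c : ℂ) (u : X) (i : Fin 2) (ξ : Plane) :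
    velocity (c • u) i ξ = c * velocity u i ξ := by
  unfold velocity
  rw [← integral_const_mul]
  refine integral_congr_ae ?_
  filter_upwards [coeFn_smul_ae c u] with η h
  rw [h]; ring

theorem nonlocalTerm_add (u v : X) :
    ∀ᵐ ξ, nonlocalTerm (u + v) ξ = nonlocalTerm u ξ + nonlocalTerm v ξ := by
  filter_upwards [velocity_add u v 0, velocity_add u v 1] with ξ h1 h2
  simp only [nonlocalTerm, Fin.sum_univ_two, h1, h2]
  ring

theorem nonlocalTerm_smul (c : ℂ) (u : X) (ξ : Plane) :
    nonlocalTerm (c • u) ξ = c * nonlocalTerm u ξ := by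
  simp only [nonlocalTerm, Fin.sum_univ_two, velocity_smul]
  ring

theorem nonlocalTerm_zero (ξ : Plane) : nonlocalTerm 0 ξ = 0 := by
  simpa using nonlocalTerm_smul 0 0 ξ

/-- The graph of `w ↦ (K * w) · ∇G` in `X`. -/
def nonlocalGraph : Submodule ℂ (X × X) where
  carrier := {p | ∀ᵐ ξ : Plane, p.2 ξ = nonlocalTerm p.1 ξ}
  add_mem' := by
    intro p q hp hq
    filter_upwards [hp, hq, coeFn_add_ae p.2 q.2, nonlocalTerm_add p.1 q.1] with ξ h1 h2 h3 h4
    rw [Prod.snd_add, Prod.fst_add, h3, h4, h1, h2]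
  zero_mem' := by
    filter_upwards [coeFn_zero_ae] with ξ h1
    rw [Prod.snd_zero, Prod.fst_zero, h1, nonlocalTerm_zero]
  smul_mem' := by
    intro c p hp
    filter_upwards [hp, coeFn_smul_ae c p.2] with ξ h1 h2
    rw [Prod.smul_snd, Prod.smul_fst, h2, nonlocalTerm_smul, h1]

/-- The operator `w ↦ (K * w) · ∇G` in `X`. -/
def nonlocalOp : X →ₗ.[ℂ] X := nonlocalGraph.toLinearPMap

theorem graph_nonlocalOp : nonlocalOp.graph = nonlocalGraph := by
  refine Submodule.toLinearPMap_graph_eq _ ?_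
  rintro ⟨w, f⟩ hp (rfl : w = 0)
  refine X_ext ?_
  filter_upwards [hp, coeFn_zero_ae] with ξ h1 h2
  rw [h2]
  exact h1.trans (nonlocalTerm_zero ξ)

/-- `Λ w = v^G · ∇w + (K * w) · ∇G` in `X`, with maximal domain. -/
def advectionLambda : X →ₗ.[ℂ] X :=
  advectionOp vortexVelocity contDiff_vortexVelocity + nonlocalOp

/-- The linearized operator `𝓛 - α Λ` in `X`. -/
def linearizedOp (α : ℝ) : X →ₗ.[ℂ] X := diffusionOp - (α : ℂ) • advectionLambda

/-! ### The invariant subspaces -/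

theorem coord_swap (i : Fin 2) (w : X) :
    Integrable (fun ξ : Plane => w ξ * ((ξ i : ℝ) : ℂ)) volume := by
  simpa [mul_comm] using integrable_coord_mul_X i w

/-- `X₀ = {w ∈ X | ∫ w dξ = 0}`. -/
def X₀ : Submodule ℂ X where
  carrier := {w | ∫ ξ, w ξ = 0}
  add_mem' := by
    intro u v (hu : ∫ ξ, u ξ = 0) (hv : ∫ ξ, v ξ = 0)
    have := integral_add_mul u v (g := fun _ => 1) (by simpa using integrable_X u)
      (by simpa using integrable_X v)
    simpa [hu, hv] using this
  zero_mem' := by simpa using integral_zero_mul (fun _ => 1)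
  smul_mem' := by
    intro c u (hu : ∫ ξ, u ξ = 0)
    simpa [hu] using integral_smul_mul c u (fun _ => 1)

/-- `X₁ = {w ∈ X₀ | ∫ ξ₁ w dξ = ∫ ξ₂ w dξ = 0}`. -/
def X₁ : Submodule ℂ X where
  carrier := {w | w ∈ X₀ ∧ ∀ i : Fin 2, ∫ ξ : Plane, w ξ * ((ξ i : ℝ) : ℂ) = 0}
  add_mem' := by
    rintro u v ⟨hu, hu'⟩ ⟨hv, hv'⟩
    refine ⟨X₀.add_mem hu hv, fun i => ?_⟩
    rw [integral_add_mul u v (coord_swap i u) (coord_swap i v), hu' i, hv' i, add_zero]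
  zero_mem' := ⟨X₀.zero_mem, fun i => integral_zero_mul _⟩
  smul_mem' := by
    rintro c u ⟨hu, hu'⟩
    refine ⟨X₀.smul_mem c hu, fun i => ?_⟩
    rw [integral_smul_mul, hu' i, mul_zero]

/-! ### Spectra of unbounded operators -/

section Spectrum

variable {E : Type*} [NormedAddCommGroup E] [NormedSpace ℂ E]

/-- The resolvent set of an unbounded operator `A` in `E`: all `z` for which
`z - A : D(A) → E` is bijective with bounded inverse `R`. -/
def resolventSet (A : E →ₗ.[ℂ] E) : Set ℂ :=
  {z | ∃ R : E →L[ℂ] E,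
    (∀ f : E, ∃ h : R f ∈ A.domain, z • R f - A ⟨R f, h⟩ = f) ∧
    ∀ w : A.domain, R (z • (w : E) - A w) = w}

/-- The spectrum of an unbounded operator, the complement of its resolvent set. -/
def spectrum (A : E →ₗ.[ℂ] E) : Set ℂ := (resolventSet A)ᶜ

/-- The operator induced by `A` in a subspace `S`, with domain
`{w ∈ D(A) ∩ S | A w ∈ S}` (which is `D(A) ∩ S` when `S` is invariant under `A`). -/
def induced (A : E →ₗ.[ℂ] E) (S : Submodule ℂ E) : S →ₗ.[ℂ] S :=
  (A.graph.comap (S.subtype.prodMap S.subtype)).toLinearPMap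

theorem graph_induced (A : E →ₗ.[ℂ] E) (S : Submodule ℂ E) :
    (induced A S).graph = A.graph.comap (S.subtype.prodMap S.subtype) := by
  refine Submodule.toLinearPMap_graph_eq _ ?_
  rintro ⟨u, f⟩ hp (rfl : u = 0)
  exact Subtype.ext (A.graph_fst_eq_zero_snd hp rfl)

end Spectrum

end Oseen

end

/-! The operator `𝓛` is diagonal in the orthonormal basis of `X` formed by the normalized Hermite
functions `H_k G`, with eigenvalue `-|k|/2`, while `Λ` is skew-symmetric. Hence `Re ⟨w, (𝓛 - αΛ) w⟩
= Re ⟨w, 𝓛 w⟩ ≤ -m ‖w‖²` as soon as `w` is orthogonal to all modes with `|k|/2 < m`. This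
dissipativity estimate (`re_inner_linearizedOp_le`) does not depend on `α`.

Skew-symmetry has two sources. The field `v^G` is divergence free and tangent to circles, so it
preserves the weight `G⁻¹` (`inner_transport_skew`). Since `∇G = -ξ G / 2`, the nonlocal term has
the kernel `-½ G(ξ) ξ · K(ξ - η)`; the prefactor `G` cancels the weight, and `ξ · K(ξ - η)` is
antisymmetric in `(ξ, η)` (`inner_nonlocal_skew`).

The subspaces `X₀` and `X₁` are the orthogonal complements of the modes of degree `0` and of degree
at most `1`. On these modes `Λ` vanishes (`transport_add_nonlocal_eq_zero`): the transport term is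
computed by differentiation, and the Biot-Savart integral is evaluated explicitly. By skew-symmetry,
pairing with such a mode sees only `𝓛`, so its orthogonal complement is invariant
(`inner_hermiteFun_linearizedOp`).

A dissipative estimate bounds the spectrum only if `l - (𝓛 - αΛ)` is onto for some suitable `l`. For
large real `l` the resolvent `R = (l - 𝓛)⁻¹` and the operators `∂ᵢ R` have norm at most `l^(-1/2)`.
The nonlocal part of `Λ` is bounded by Schur's test and `v^G` is bounded, so `Λ R` is small and `1 +
α Λ R` is invertible by a Neumann series (`exists_linearizedOp_eq`). A second Neumann series moves
from `l` to any `z` in the half-plane (`spectrum_subset_of_dissipative`).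

The domains are maximal and distributional, so no regularity of `w` is available at the start. The
weak identities are first extended by cutoff from test functions to polynomials
(`integral_laplacian_mul`, `integral_advection_mul`). Comparison of Hermite coefficients then shows
that the domain of `𝓛` is the range of `R`, where computations reduce by density to Hermite
functions. -/

noncomputable section

namespace Oseen

open scoped InnerProductSpace ComplexConjugate

/-! ### Functions of temperate growth against the Gaussian -/

/-- The partial derivative `∂ᵢ f`. -/
def pderiv (i : Fin 2) (f : Plane → ℝ) (ξ : Plane) : ℝ :=
  fderiv ℝ f ξ (EuclideanSpace.single i 1)

theorem hasTemperateGrowth_coord (i : Fin 2) :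
    Function.HasTemperateGrowth (fun ξ : Plane => ξ i) :=
  (EuclideanSpace.proj (𝕜 := ℝ) i : Plane →L[ℝ] ℝ).hasTemperateGrowth

theorem _root_.Function.HasTemperateGrowth.pderiv {f : Plane → ℝ} (hf : f.HasTemperateGrowth)
    (i : Fin 2) : Function.HasTemperateGrowth (pderiv i f) := by
  have h : Function.HasTemperateGrowth (fderiv ℝ f) := by
    refine ⟨hf.1.fderiv_right (m := ∞) (by simp), fun n => ?_⟩
    obtain ⟨k, C, h⟩ := hf.2 (n + 1)
    refine ⟨k, C, fun x => ?_⟩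
    rw [norm_iteratedFDeriv_fderiv]
    exact h x
  exact (ContinuousLinearMap.apply ℝ ℝ (EuclideanSpace.single i 1 : Plane)).hasTemperateGrowth.comp h

theorem _root_.Function.HasTemperateGrowth.exists_le_exp {f : Plane → ℝ}
    (hf : f.HasTemperateGrowth) : ∃ C c : ℝ, 0 ≤ C ∧ ∀ ξ, |f ξ| ≤ C * Real.exp (c * ‖ξ‖) := by
  obtain ⟨k, C, hC, h⟩ := hf.norm_iteratedFDeriv_le_uniform 0
  refine ⟨C, k, hC, fun ξ => ?_⟩
  have h1 := h 0 le_rfl ξ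
  rw [norm_iteratedFDeriv_zero, Real.norm_eq_abs] at h1
  refine h1.trans ?_
  rw [Real.exp_nat_mul]
  gcongr
  linarith [Real.add_one_le_exp ‖ξ‖]

theorem integrable_exp_mul_gaussian (c : ℝ) :
    Integrable (fun ξ => Real.exp (c * ‖ξ‖) * gaussian ξ) volume := by
  refine ((integrable_exp_sq (b := 1 / 8) (by norm_num)).const_mul
    (Real.exp (2 * c ^ 2) * (4 * Real.pi)⁻¹)).mono'
    (Continuous.aestronglyMeasurable (by have := continuous_gaussian; fun_prop))
    (Filter.Eventually.of_forall fun ξ => ?_)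
  have h3 := gaussian_pos ξ
  rw [Real.norm_of_nonneg (by positivity)]
  unfold gaussian
  have : Real.exp (c * ‖ξ‖) * Real.exp (-‖ξ‖ ^ 2 / 4) ≤
      Real.exp (2 * c ^ 2) * Real.exp (-(1 / 8) * ‖ξ‖ ^ 2) := by
    rw [← Real.exp_add, ← Real.exp_add]
    -- Completing the square: `2c² + r²/8 - c r = (r - 4c)² / 8`, which leaves half of the Gaussian
    -- decay.
    exact Real.exp_le_exp.2 (by nlinarith [sq_nonneg (‖ξ‖ - 4 * c)])
  have h4 : 0 ≤ (4 * Real.pi)⁻¹ := by positivity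
  nlinarith

/-- Cauchy-Schwarz against `G`. Exponential moments are what allow elements of `X` to be tested on
polynomials and to be expanded termwise against `exp (i t · ξ)`. -/
theorem integrable_exp_mul_X (w : X) (c : ℝ) :
    Integrable (fun ξ => ((Real.exp (c * ‖ξ‖) : ℝ) : ℂ) * w ξ) volume := by
  refine integrable_mul_of_sq w (by fun_prop) ?_
  refine (integrable_exp_mul_gaussian (2 * c)).congr (Filter.Eventually.of_forall fun ξ => ?_)
  simp only
  rw [sq, ← Real.exp_add]
  ring_nf

theorem _root_.Function.HasTemperateGrowth.integrable_mul_gaussian {f : Plane → ℝ}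
    (hf : f.HasTemperateGrowth) : Integrable (fun ξ => f ξ * gaussian ξ) volume := by
  obtain ⟨C, c, hC, h⟩ := hf.exists_le_exp
  refine ((integrable_exp_mul_gaussian c).const_mul C).mono'
    (Continuous.aestronglyMeasurable (by have := continuous_gaussian; have := hf.1.continuous; fun_prop))
    (Filter.Eventually.of_forall fun ξ => ?_)
  have h3 := gaussian_pos ξ
  rw [norm_mul, Real.norm_eq_abs, Real.norm_eq_abs, abs_of_pos h3, ← mul_assoc]
  gcongr
  exact h ξ

theorem _root_.Function.HasTemperateGrowth.integrable_X_mul {f : Plane → ℝ}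
    (hf : f.HasTemperateGrowth) (w : X) : Integrable (fun ξ => w ξ * (f ξ : ℂ)) volume := by
  have := integrable_mul_of_sq w hf.1.continuous (by
    have := (hf.mul hf).integrable_mul_gaussian
    simpa [sq] using this)
  simpa [mul_comm] using this

theorem hasFDerivAt_gaussian (ξ : Plane) :
    HasFDerivAt gaussian ((-(gaussian ξ / 2)) • innerSL ℝ ξ) ξ := by
  unfold gaussian
  have h1 : HasFDerivAt (fun ξ : Plane => ‖ξ‖ ^ 2) (2 • innerSL ℝ ξ) ξ :=
    (hasStrictFDerivAt_norm_sq ξ).hasFDerivAt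
  have h2 := ((h1.const_mul (-1 / 4 : ℝ)).exp.const_mul (4 * Real.pi)⁻¹)
  have e : (fun y : Plane => (4 * Real.pi)⁻¹ * Real.exp (-‖y‖ ^ 2 / 4)) =
      fun y => (4 * Real.pi)⁻¹ * Real.exp (-1 / 4 * ‖y‖ ^ 2) := by
    funext y; ring_nf
  rw [e]
  refine h2.congr_fderiv ?_
  ext v
  simp only [two_nsmul, FunLike.coe_smul, FunLike.coe_add, Pi.smul_apply, Pi.add_apply,
    innerSL_apply_apply, smul_eq_mul]
  ring_nf

theorem pderiv_gaussian (i : Fin 2) (ξ : Plane) :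
    pderiv i gaussian ξ = -(ξ i / 2) * gaussian ξ := by
  simp [pderiv, (hasFDerivAt_gaussian ξ).fderiv, EuclideanSpace.inner_single_right]
  ring

theorem gradient_gaussian (ξ : Plane) : gradient gaussian ξ = (-(gaussian ξ / 2)) • ξ := by
  refine HasGradientAt.gradient ?_
  rw [hasGradientAt_iff_hasFDerivAt]
  have e : InnerProductSpace.toDual ℝ Plane ((-(gaussian ξ / 2)) • ξ) =
      (-(gaussian ξ / 2)) • innerSL ℝ ξ := by
    ext v
    simp
  rw [e]
  exact hasFDerivAt_gaussian ξ

theorem contDiff_gaussian : ContDiff ℝ ∞ gaussian := by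
  unfold gaussian
  have : ContDiff ℝ ∞ (fun ξ : Plane => ‖ξ‖ ^ 2) := contDiff_norm_sq ℝ
  fun_prop

theorem pderiv_mul {f g : Plane → ℝ} (hf : Differentiable ℝ f) (hg : Differentiable ℝ g)
    (i : Fin 2) (ξ : Plane) :
    pderiv i (fun η => f η * g η) ξ = pderiv i f ξ * g ξ + f ξ * pderiv i g ξ := by
  simp [pderiv, fderiv_fun_mul (hf ξ) (hg ξ)]
  ring

theorem _root_.Function.HasTemperateGrowth.differentiable {f : Plane → ℝ}
    (hf : f.HasTemperateGrowth) : Differentiable ℝ f := hf.1.differentiable (by simp)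

/-- The raising operator `f ↦ ½ ξᵢ f - ∂ᵢ f`, adjoint to `∂ᵢ` with respect to `G dξ`. -/
def raising (i : Fin 2) (f : Plane → ℝ) (ξ : Plane) : ℝ := ξ i / 2 * f ξ - pderiv i f ξ

theorem _root_.Function.HasTemperateGrowth.raising {f : Plane → ℝ} (hf : f.HasTemperateGrowth)
    (i : Fin 2) : Function.HasTemperateGrowth (Oseen.raising i f) := by
  have h := hasTemperateGrowth_coord i
  have h' := hf.pderiv i
  have : Oseen.raising i f = fun ξ => ((1 / 2 : ℝ) * ξ i) * f ξ - Oseen.pderiv i f ξ := by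
    funext ξ; simp only [Oseen.raising]; ring
  rw [this]
  fun_prop

theorem pderiv_mul_gaussian {f : Plane → ℝ} (hf : Differentiable ℝ f) (i : Fin 2) (ξ : Plane) :
    pderiv i (fun η => f η * gaussian η) ξ = -(raising i f ξ * gaussian ξ) := by
  rw [pderiv_mul hf (contDiff_gaussian.differentiable (by simp)), pderiv_gaussian, raising]
  ring

/-- Integration by parts on the whole plane; the integrability of all the products comes from
temperate growth against the Gaussian. -/
theorem integral_pderiv_mul_gaussian {p q : Plane → ℝ} (hp : p.HasTemperateGrowth)
    (hq : q.HasTemperateGrowth) (i : Fin 2) :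
    ∫ ξ, pderiv i p ξ * (q ξ * gaussian ξ) = ∫ ξ, p ξ * (raising i q ξ * gaussian ξ) := by
  have h := integral_mul_fderiv_eq_neg_fderiv_mul_of_integrable (μ := (volume : Measure Plane))
    (f := p) (g := fun ξ => q ξ * gaussian ξ) (v := EuclideanSpace.single i 1) ?_ ?_ ?_ ?_ ?_
  · have e : ∀ ξ, fderiv ℝ (fun ξ => q ξ * gaussian ξ) ξ (EuclideanSpace.single i 1) =
        -(raising i q ξ * gaussian ξ) := pderiv_mul_gaussian hq.differentiable i
    simp only [e, mul_neg, integral_neg, neg_inj] at h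
    exact h.symm
  · have := ((hp.pderiv i).mul hq).integrable_mul_gaussian
    refine this.congr (Filter.Eventually.of_forall fun ξ => ?_)
    simp [pderiv, mul_assoc]
  · have := (hp.mul (hq.raising i)).integrable_mul_gaussian.neg
    refine this.congr (Filter.Eventually.of_forall fun ξ => ?_)
    have := pderiv_mul_gaussian hq.differentiable i ξ
    rw [pderiv] at this
    simp [this, mul_assoc]
  · have := (hp.mul hq).integrable_mul_gaussian
    simpa [mul_assoc] using this
  · exact fun x _ => hp.differentiable x
  · exact fun x _ => (hq.differentiable.mul (contDiff_gaussian.differentiable (by simp))) x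

/-! ### Elements of `X` of the form `p G` -/

theorem integral_weighted (f : Plane → ℂ) :
    ∫ ξ, f ξ ∂weightedMeasure = ∫ ξ, (gaussian ξ : ℂ)⁻¹ * f ξ := by
  unfold weightedMeasure
  rw [integral_withDensity_eq_integral_toReal_smul]
  · refine integral_congr_ae (Filter.Eventually.of_forall fun ξ => ?_)
    simp only
    rw [ENNReal.toReal_ofReal (inv_nonneg.2 (gaussian_pos ξ).le), Complex.real_smul]
    push_cast
    rfl
  · exact ENNReal.measurable_ofReal.comp continuous_gaussian.measurable.inv
  · simp

theorem inner_X (u w : X) : ⟪u, w⟫_ℂ = ∫ ξ, (gaussian ξ : ℂ)⁻¹ * (w ξ * conj (u ξ)) := by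
  rw [L2.inner_def, integral_weighted]
  rfl

theorem memLp_mul_gaussian_of_integrable {p : Plane → ℝ} (hp : Continuous p)
    (h : Integrable (fun ξ => p ξ * p ξ * gaussian ξ) volume) :
    MemLp (fun ξ => ((p ξ * gaussian ξ : ℝ) : ℂ)) 2 weightedMeasure := by
  rw [memLp_two_iff_integrable_sq_norm (by
    have := continuous_gaussian
    exact Continuous.aestronglyMeasurable (by fun_prop))]
  rw [integrable_weighted_iff]
  refine h.congr (Filter.Eventually.of_forall fun ξ => ?_)
  have := (gaussian_pos ξ).ne'
  simp only [Complex.norm_real, Real.norm_eq_abs, sq_abs, smul_eq_mul]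
  field_simp

/-- The factor `G` cancels the weight `G⁻¹`, so unweighted moments and distributional pairings are
inner products in `X`, hence continuous in `w`. -/
theorem inner_toLp_mul_gaussian {p : Plane → ℝ}
    (hp : MemLp (fun ξ => ((p ξ * gaussian ξ : ℝ) : ℂ)) 2 weightedMeasure) (w : X) :
    ⟪hp.toLp _, w⟫_ℂ = ∫ ξ, w ξ * (p ξ : ℂ) := by
  rw [inner_X]
  refine integral_congr_ae ?_
  filter_upwards [volume_ac.ae_le hp.coeFn_toLp] with ξ h
  have : (gaussian ξ : ℂ) ≠ 0 := by exact_mod_cast (gaussian_pos ξ).ne'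
  rw [h, Complex.conj_ofReal]
  push_cast
  field_simp

theorem memLp_mul_gaussian {p : Plane → ℝ} (hp : p.HasTemperateGrowth) :
    MemLp (fun ξ => ((p ξ * gaussian ξ : ℝ) : ℂ)) 2 weightedMeasure :=
  memLp_mul_gaussian_of_integrable hp.1.continuous (hp.mul hp).integrable_mul_gaussian

/-- The element `p G` of `X`, for `p` of temperate growth. -/
def mulGaussian (p : Plane → ℝ) (hp : p.HasTemperateGrowth) : X := (memLp_mul_gaussian hp).toLp _

theorem coeFn_mulGaussian {p : Plane → ℝ} (hp : p.HasTemperateGrowth) :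
    ∀ᵐ ξ, mulGaussian p hp ξ = ((p ξ * gaussian ξ : ℝ) : ℂ) :=
  volume_ac.ae_le (memLp_mul_gaussian hp).coeFn_toLp

theorem inner_mulGaussian {p : Plane → ℝ} (hp : p.HasTemperateGrowth) (w : X) :
    ⟪mulGaussian p hp, w⟫_ℂ = ∫ ξ, w ξ * (p ξ : ℂ) :=
  inner_toLp_mul_gaussian _ w

/-- Integration against a continuous function with compact support is continuous on `X`. -/
theorem continuous_integral_X_mul {g : Plane → ℝ} (hg : Continuous g) (hc : HasCompactSupport g) :
    Continuous fun w : X => ∫ ξ, w ξ * (g ξ : ℂ) := by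
  have h : MemLp (fun ξ => ((g ξ * gaussian ξ : ℝ) : ℂ)) 2 weightedMeasure :=
    memLp_mul_gaussian_of_integrable hg
      (Continuous.integrable_of_hasCompactSupport (by have := continuous_gaussian; fun_prop)
        (hc.mul_right.mul_right))
  simp only [← inner_toLp_mul_gaussian h]
  fun_prop

theorem inner_mulGaussian_mulGaussian {p q : Plane → ℝ} (hp : p.HasTemperateGrowth)
    (hq : q.HasTemperateGrowth) :
    ⟪mulGaussian p hp, mulGaussian q hq⟫_ℂ = ((∫ ξ, p ξ * (q ξ * gaussian ξ) : ℝ) : ℂ) := by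
  rw [inner_mulGaussian, ← integral_complex_ofReal]
  refine integral_congr_ae ?_
  filter_upwards [coeFn_mulGaussian hq] with ξ h
  rw [h]
  push_cast
  ring

end Oseen

namespace Oseen

open scoped InnerProductSpace ComplexConjugate Nat

/-! ### Hermite polynomials for the weight `G` -/

/-- Hermite polynomials in one variable, orthogonal for the weight `exp (-x² / 4)`. -/
def hermitePoly : ℕ → Polynomial ℝ
  | 0 => 1
  | n + 1 => Polynomial.C (1 / 2) * Polynomial.X * hermitePoly n -
      Polynomial.derivative (hermitePoly n)

/-- Differentiate the recursion: the commutator of `d/dx` with the raising operator `x/2 - d/dx` is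
`1/2`, and each step of the induction adds this amount. -/
theorem derivative_hermitePoly_succ (n : ℕ) :
    Polynomial.derivative (hermitePoly (n + 1)) =
      Polynomial.C (((n : ℝ) + 1) / 2) * hermitePoly n := by
  induction n with
  | zero => simp [hermitePoly]
  | succ n ih =>
    have e : hermitePoly (n + 2) = Polynomial.C (1 / 2) * Polynomial.X * hermitePoly (n + 1) -
      Polynomial.derivative (hermitePoly (n + 1)) := rfl
    have e' : hermitePoly (n + 1) = Polynomial.C (1 / 2) * Polynomial.X * hermitePoly n -
      Polynomial.derivative (hermitePoly n) := rfl
    rw [e, ih]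
    simp only [Polynomial.derivative_sub, Polynomial.derivative_mul, Polynomial.derivative_C,
      Polynomial.derivative_X, ih]
    have h : (Polynomial.C (((n : ℕ) + 1 : ℕ) : ℝ) : Polynomial ℝ) = Polynomial.C (n : ℝ) + 1 := by
      push_cast; simp
    have h2 : Polynomial.C ((((n + 1 : ℕ) : ℝ) + 1) / 2) =
        Polynomial.C (((n : ℝ) + 1) / 2) + Polynomial.C (1 / 2) := by
      rw [← Polynomial.C_add]; congr 1; push_cast; ring
    rw [h2, add_mul, e']
    ring

/-- The Hermite polynomials on the plane. -/
def hermite (k : Fin 2 → ℕ) (ξ : Plane) : ℝ := ∏ i, (hermitePoly (k i)).eval (ξ i)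

theorem hasTemperateGrowth_eval (P : Polynomial ℝ) (i : Fin 2) :
    Function.HasTemperateGrowth fun ξ : Plane => P.eval (ξ i) := by
  have := hasTemperateGrowth_coord i
  simp only [Polynomial.eval_eq_sum_range]
  exact Function.HasTemperateGrowth.sum fun n _ => (Function.HasTemperateGrowth.const _).mul (this.pow n)

theorem hasTemperateGrowth_hermite (k : Fin 2 → ℕ) : (hermite k).HasTemperateGrowth := by
  have : hermite k = fun ξ => (hermitePoly (k 0)).eval (ξ 0) * (hermitePoly (k 1)).eval (ξ 1) := by
    funext ξ; simp [hermite, Fin.prod_univ_two]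
  rw [this]
  exact (hasTemperateGrowth_eval _ 0).mul (hasTemperateGrowth_eval _ 1)

theorem pderiv_eval (P : Polynomial ℝ) (i j : Fin 2) (ξ : Plane) :
    pderiv i (fun ξ => P.eval (ξ j)) ξ = if j = i then P.derivative.eval (ξ j) else 0 := by
  have h1 : HasFDerivAt (fun ξ : Plane => ξ j) (EuclideanSpace.proj (𝕜 := ℝ) j : Plane →L[ℝ] ℝ) ξ :=
    (EuclideanSpace.proj (𝕜 := ℝ) j : Plane →L[ℝ] ℝ).hasFDerivAt
  have h2 := (P.hasDerivAt (ξ j)).comp_hasFDerivAt ξ h1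
  have h3 : pderiv i (fun ξ => P.eval (ξ j)) ξ = _ :=
    congrArg (fun L : Plane →L[ℝ] ℝ => L (EuclideanSpace.single i 1)) h2.fderiv
  rw [h3]
  simp [eq_comm]

theorem pderiv_hermite (k : Fin 2 → ℕ) (i : Fin 2) (ξ : Plane) :
    pderiv i (hermite k) ξ = ∏ j, if j = i then (hermitePoly (k j)).derivative.eval (ξ j)
      else (hermitePoly (k j)).eval (ξ j) := by
  have : hermite k = fun ξ => (hermitePoly (k 0)).eval (ξ 0) * (hermitePoly (k 1)).eval (ξ 1) := by
    funext ξ; simp [hermite, Fin.prod_univ_two]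
  rw [this, pderiv_mul (hasTemperateGrowth_eval _ 0).differentiable
    (hasTemperateGrowth_eval _ 1).differentiable, pderiv_eval, pderiv_eval, Fin.prod_univ_two]
  fin_cases i <;> simp

theorem pderiv_hermite_succ (k : Fin 2 → ℕ) (i : Fin 2) :
    pderiv i (hermite (k + Pi.single i 1)) = fun ξ => ((k i : ℝ) + 1) / 2 * hermite k ξ := by
  funext ξ
  rw [pderiv_hermite, Fin.prod_univ_two, hermite, Fin.prod_univ_two]
  fin_cases i <;> simp [derivative_hermitePoly_succ] <;> ring

theorem pderiv_hermite_of_eq_zero {k : Fin 2 → ℕ} {i : Fin 2} (h : k i = 0) :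
    pderiv i (hermite k) = fun _ => 0 := by
  funext ξ
  rw [pderiv_hermite, Finset.prod_eq_zero (Finset.mem_univ i)]
  simp [h, hermitePoly]

theorem raising_hermite (k : Fin 2 → ℕ) (i : Fin 2) :
    raising i (hermite k) = hermite (k + Pi.single i 1) := by
  funext ξ
  rw [raising, pderiv_hermite, Fin.prod_univ_two, hermite, hermite, Fin.prod_univ_two,
    Fin.prod_univ_two]
  fin_cases i <;> simp [hermitePoly] <;> ring

theorem hermite_zero : hermite 0 = fun _ => 1 := by
  funext ξ; simp [hermite, hermitePoly]

theorem hermite_single (i : Fin 2) : hermite (Pi.single i 1) = fun ξ => ξ i / 2 := by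
  funext ξ; fin_cases i <;> simp [hermite, hermitePoly, Fin.prod_univ_two] <;> ring

theorem index_cases (k : Fin 2 → ℕ) : k = 0 ∨ ∃ (k' : Fin 2 → ℕ) (i : Fin 2),
    k = k' + Pi.single i 1 := by
  by_cases h : k = 0
  · exact Or.inl h
  · obtain ⟨i, hi⟩ := Function.ne_iff.1 h
    refine Or.inr ⟨k - Pi.single i 1, i, ?_⟩
    refine (tsub_add_cancel_of_le ?_).symm
    intro j
    by_cases hj : j = i
    · subst hj; simpa using Nat.one_le_iff_ne_zero.2 hi
    · simp [Pi.single_eq_of_ne hj]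

theorem index_pred (k : Fin 2 → ℕ) (i : Fin 2) (h : k i ≠ 0) :
    ∃ k' : Fin 2 → ℕ, k = k' + Pi.single i 1 := by
  refine ⟨k - Pi.single i 1, (tsub_add_cancel_of_le ?_).symm⟩
  intro j
  by_cases hj : j = i
  · subst hj; simpa using Nat.one_le_iff_ne_zero.2 h
  · simp [Pi.single_eq_of_ne hj]

/-- The square of the norm of the Hermite polynomials. -/
def hermiteNormSq (k : Fin 2 → ℕ) : ℝ := ∏ i, ((k i)! : ℝ) / 2 ^ k i

theorem hermiteNormSq_pos (k : Fin 2 → ℕ) : 0 < hermiteNormSq k :=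
  Finset.prod_pos fun i _ => by positivity

theorem hermiteNormSq_succ (k : Fin 2 → ℕ) (i : Fin 2) :
    hermiteNormSq (k + Pi.single i 1) = ((k i : ℝ) + 1) / 2 * hermiteNormSq k := by
  rw [hermiteNormSq, hermiteNormSq, Fin.prod_univ_two, Fin.prod_univ_two]
  fin_cases i <;> simp [Nat.factorial_succ, pow_succ] <;> field_simp

theorem integral_gaussian : ∫ ξ, gaussian ξ = 1 := by
  unfold gaussian
  rw [integral_const_mul]
  have := GaussianFourier.integral_rexp_neg_mul_sq_norm (V := Plane) (b := 1 / 4) (by norm_num)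
  have e : ∀ ξ : Plane, Real.exp (-‖ξ‖ ^ 2 / 4) = Real.exp (-(1 / 4) * ‖ξ‖ ^ 2) := fun ξ => by
    ring_nf
  simp only [e, this]
  have := Real.pi_ne_zero
  simp
  field_simp

theorem integral_hermite_succ_mul (k l : Fin 2 → ℕ) (i : Fin 2) :
    ∫ ξ, hermite (k + Pi.single i 1) ξ * (hermite l ξ * gaussian ξ) =
      ∫ ξ, hermite k ξ * (pderiv i (hermite l) ξ * gaussian ξ) := by
  have h := integral_pderiv_mul_gaussian (hasTemperateGrowth_hermite l)
    (hasTemperateGrowth_hermite k) i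
  rw [raising_hermite] at h
  have e1 : ∀ ξ, hermite (k + Pi.single i 1) ξ * (hermite l ξ * gaussian ξ) =
      hermite l ξ * (hermite (k + Pi.single i 1) ξ * gaussian ξ) := fun ξ => by ring
  have e2 : ∀ ξ, hermite k ξ * (pderiv i (hermite l) ξ * gaussian ξ) =
      pderiv i (hermite l) ξ * (hermite k ξ * gaussian ξ) := fun ξ => by ring
  simp only [e1, e2, h]

/-- Induction on the degree of `k`: a raising operator on `H_k` moves over to a derivative of `H_l`,
which lowers both indices, or gives zero when `l i = 0`. -/
theorem integral_hermite_mul (k l : Fin 2 → ℕ) :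
    ∫ ξ, hermite k ξ * (hermite l ξ * gaussian ξ) = if k = l then hermiteNormSq k else 0 := by
  induction h : ∑ i, k i generalizing k l with
  | zero =>
    have hk : k = 0 := by
      funext i
      exact (Finset.sum_eq_zero_iff.1 h) i (Finset.mem_univ i)
    subst hk
    rcases index_cases l with rfl | ⟨l', i, rfl⟩
    · simp [hermite_zero, integral_gaussian, hermiteNormSq]
    -- With `k = 0` and `l ≠ 0` the roles are exchanged: the derivative falls on the constant `H_0`.
    · have := integral_hermite_succ_mul l' 0 i
      rw [pderiv_hermite_of_eq_zero (by simp)] at this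
      have e : ∀ ξ, hermite 0 ξ * (hermite (l' + Pi.single i 1) ξ * gaussian ξ) =
        hermite (l' + Pi.single i 1) ξ * (hermite 0 ξ * gaussian ξ) := fun ξ => by ring
      simp only [e, this]
      rw [if_neg]
      · simp
      · intro h0
        have := congrFun h0 i
        simp at this
  | succ n ih =>
    rcases index_cases k with rfl | ⟨k', i, rfl⟩
    · simp at h
    have h' : ∑ j, k' j = n := by
      rw [Fin.sum_univ_two] at h ⊢
      fin_cases i <;> simp at h <;> omega
    rw [integral_hermite_succ_mul]
    by_cases hl : l i = 0
    · rw [pderiv_hermite_of_eq_zero hl, if_neg]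
      · simp
      · rintro rfl
        simp at hl
    · obtain ⟨l', rfl⟩ := index_pred l i hl
      rw [pderiv_hermite_succ]
      have e : ∀ ξ, hermite k' ξ * (((l' i : ℝ) + 1) / 2 * hermite l' ξ * gaussian ξ) =
        ((l' i : ℝ) + 1) / 2 * (hermite k' ξ * (hermite l' ξ * gaussian ξ)) := fun ξ => by ring
      simp only [e]
      rw [integral_const_mul, ih k' l' h']
      by_cases hkl : k' = l'
      · subst hkl; simp [hermiteNormSq_succ]
      · rw [if_neg hkl, if_neg (fun h => hkl (add_right_cancel h))]
        simp

/-- The normalized Hermite functions in `X`. -/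
def hermiteVec (k : Fin 2 → ℕ) : X :=
  ((Real.sqrt (hermiteNormSq k))⁻¹ : ℂ) • mulGaussian (hermite k) (hasTemperateGrowth_hermite k)

theorem orthonormal_hermiteVec : Orthonormal ℂ hermiteVec := by
  rw [orthonormal_iff_ite]
  intro k l
  rw [hermiteVec, hermiteVec, inner_smul_left, inner_smul_right, inner_mulGaussian_mulGaussian,
    integral_hermite_mul]
  by_cases h : k = l
  · subst h
    have h0 := hermiteNormSq_pos k
    have h1 : (Real.sqrt (hermiteNormSq k)) ≠ 0 := (Real.sqrt_pos.2 h0).ne'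
    rw [if_pos rfl, if_pos rfl, ← Complex.ofReal_inv, Complex.conj_ofReal, ← Complex.ofReal_mul,
      ← Complex.ofReal_mul, ← Complex.ofReal_one]
    congr 1
    nth_rw 3 [← Real.mul_self_sqrt h0.le]
    field_simp
  · simp [h]

/-! ### Completeness of the Hermite functions -/

/-- Orthogonality to all Hermite polynomials passes to all powers of linear forms, by the recurrence
`ξᵢ H_k = 2 H_(k+eᵢ) + 2 ∂ᵢ H_k`, in which `∂ᵢ H_k` is again a multiple of a Hermite polynomial. -/
theorem integral_linear_pow_mul_hermite {w : X}
    (hw : ∀ k, ∫ ξ, w ξ * (hermite k ξ : ℂ) = 0) (t : Plane) (n : ℕ) (k : Fin 2 → ℕ) :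
    ∫ ξ, w ξ * ((⟪t, ξ⟫_ℝ ^ n * hermite k ξ : ℝ) : ℂ) = 0 := by
  induction n generalizing k with
  | zero => simpa using hw k
  | succ n ih =>
    have htg : ∀ l, Function.HasTemperateGrowth fun ξ => ⟪t, ξ⟫_ℝ ^ n * hermite l ξ := fun l => by
      have := hasTemperateGrowth_hermite l
      exact ((Function.hasTemperateGrowth_inner_right t).pow n).mul this
    have hp : ∀ i : Fin 2, ∃ (c : ℝ) (l : Fin 2 → ℕ), pderiv i (hermite k) = fun ξ => c * hermite l ξ := by
      intro i
      by_cases h : k i = 0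
      -- Here the derivative is zero, and the index paired with the coefficient `0` is arbitrary.
      · exact ⟨0, 0, by rw [pderiv_hermite_of_eq_zero h]; simp⟩
      · obtain ⟨l, rfl⟩ := index_pred k i h
        exact ⟨_, l, pderiv_hermite_succ l i⟩
    choose c l hl using hp
    have e : ∀ ξ : Plane, w ξ * ((⟪t, ξ⟫_ℝ ^ (n + 1) * hermite k ξ : ℝ) : ℂ) =
        ∑ i, ((2 * t i : ℝ) * (w ξ * ((⟪t, ξ⟫_ℝ ^ n * hermite (k + Pi.single i 1) ξ : ℝ) : ℂ)) +
          (2 * t i * c i : ℝ) * (w ξ * ((⟪t, ξ⟫_ℝ ^ n * hermite (l i) ξ : ℝ) : ℂ))) := by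
      intro ξ
      have h1 : ⟪t, ξ⟫_ℝ = t 0 * ξ 0 + t 1 * ξ 1 := by
        simp [PiLp.inner_apply, Fin.sum_univ_two]; ring
      have h2 : ∀ i, ξ i * hermite k ξ = 2 * hermite (k + Pi.single i 1) ξ + 2 * c i * hermite (l i) ξ := by
        intro i
        have := congrFun (raising_hermite k i) ξ
        rw [raising, hl i] at this
        linarith
      have h3 : ⟪t, ξ⟫_ℝ ^ (n + 1) * hermite k ξ = ∑ i, ((2 * t i) * (⟪t, ξ⟫_ℝ ^ n * hermite (k + Pi.single i 1) ξ) +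
          (2 * t i * c i) * (⟪t, ξ⟫_ℝ ^ n * hermite (l i) ξ)) := by
        rw [pow_succ, Fin.sum_univ_two]
        nth_rw 2 [h1]
        linear_combination ⟪t, ξ⟫_ℝ ^ n * t 0 * h2 0 + ⟪t, ξ⟫_ℝ ^ n * t 1 * h2 1
      rw [h3]
      push_cast
      rw [Finset.mul_sum]
      refine Finset.sum_congr rfl fun i _ => ?_
      ring
    simp only [e]
    have hi := fun l => (htg l).integrable_X_mul w
    have hadd : ∀ i : Fin 2, Integrable (fun ξ : Plane =>
        (2 * t i : ℝ) * (w ξ * ((⟪t, ξ⟫_ℝ ^ n * hermite (k + Pi.single i 1) ξ : ℝ) : ℂ)) +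
          (2 * t i * c i : ℝ) * (w ξ * ((⟪t, ξ⟫_ℝ ^ n * hermite (l i) ξ : ℝ) : ℂ))) :=
      fun i => ((hi _).const_mul _).add ((hi _).const_mul _)
    rw [integral_finsetSum _ (fun i _ => hadd i)]
    refine Finset.sum_eq_zero fun i _ => ?_
    rw [integral_add ((hi _).const_mul _) ((hi _).const_mul _), integral_const_mul,
      integral_const_mul, ih, ih]
    simp

/-- The exponential series is integrated term by term under the majorant `‖w‖ exp (‖t‖ ‖ξ‖)`; each
term is a moment that vanishes. -/
theorem integral_mul_cexp_inner {w : X} (hw : ∀ k, ∫ ξ, w ξ * (hermite k ξ : ℂ) = 0) (t : Plane) :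
    ∫ ξ, w ξ * Complex.exp ((⟪t, ξ⟫_ℝ : ℂ) * Complex.I) = 0 := by
  have h := hasSum_integral_of_dominated_convergence (μ := (volume : Measure Plane))
    (F := fun (n : ℕ) ξ => w ξ * (((⟪t, ξ⟫_ℝ : ℂ) * Complex.I) ^ n / (n ! : ℂ)))
    (f := fun ξ => w ξ * Complex.exp ((⟪t, ξ⟫_ℝ : ℂ) * Complex.I))
    (fun n ξ => ‖w ξ‖ * ((‖t‖ * ‖ξ‖) ^ n / n !)) ?_ ?_ ?_ ?_ ?_
  · have h0 : ∀ n : ℕ, ∫ ξ, w ξ * (((⟪t, ξ⟫_ℝ : ℂ) * Complex.I) ^ n / (n ! : ℂ)) = 0 := by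
      intro n
      have := integral_linear_pow_mul_hermite hw t n 0
      simp only [hermite_zero, mul_one] at this
      have e : ∀ ξ : Plane, w ξ * (((⟪t, ξ⟫_ℝ : ℂ) * Complex.I) ^ n / (n ! : ℂ)) =
          (Complex.I ^ n / (n ! : ℂ)) * (w ξ * ((⟪t, ξ⟫_ℝ ^ n : ℝ) : ℂ)) := fun ξ => by
        push_cast; rw [mul_pow]; ring
      simp only [e]
      rw [integral_const_mul, this, mul_zero]
    simp only [h0] at h
    exact h.unique hasSum_zero
  · intro n
    have h1 := (integrable_X w).aestronglyMeasurable
    exact h1.mul (Continuous.aestronglyMeasurable (by fun_prop))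
  · intro n
    refine Filter.Eventually.of_forall fun ξ => ?_
    rw [norm_mul, norm_div, norm_pow, norm_mul, Complex.norm_I, mul_one, Complex.norm_natCast,
      Complex.norm_real]
    gcongr
    exact norm_inner_le_norm t ξ
  · refine Filter.Eventually.of_forall fun ξ => ?_
    exact (Real.summable_pow_div_factorial _).mul_left _
  · have h1 := (integrable_exp_mul_X w ‖t‖).norm
    refine h1.congr (Filter.Eventually.of_forall fun ξ => ?_)
    simp only [norm_mul, Complex.norm_real, Real.norm_eq_abs, Real.abs_exp]
    rw [tsum_mul_left, mul_comm, Real.exp_eq_exp_ℝ, NormedSpace.exp_eq_tsum_div]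
  · refine Filter.Eventually.of_forall fun ξ => ?_
    refine HasSum.mul_left _ ?_
    rw [Complex.exp_eq_exp_ℂ]
    exact NormedSpace.expSeries_div_hasSum_exp _

open FourierTransform in
-- Completeness of the Hermite functions: the Fourier transform of `w` vanishes identically, and the
-- Fourier transform is injective on integrable functions.
theorem eq_zero_of_integral_hermite {w : X} (hw : ∀ k, ∫ ξ, w ξ * (hermite k ξ : ℂ) = 0) :
    w = 0 := by
  have hF : ∀ t : Plane, 𝓕 (fun ξ => w ξ) t = 0 := by
    intro t
    rw [Real.fourier_eq']
    rw [← integral_mul_cexp_inner hw ((-2 * Real.pi) • t)]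
    refine integral_congr_ae (Filter.Eventually.of_forall fun ξ => ?_)
    simp only [smul_eq_mul]
    rw [mul_comm, real_inner_comm, inner_smul_left]
    simp
  refine X_ext ?_
  have := ae_eq_zero_of_integral_contDiff_smul_eq_zero (μ := (volume : Measure Plane))
    (integrable_X w).locallyIntegrable (fun g h1 h2 => by
      have h1' : ContDiff ℝ ∞ (fun ξ => (g ξ : ℂ)) := Complex.ofRealCLM.contDiff.comp h1
      have h2' : HasCompactSupport (fun ξ => (g ξ : ℂ)) := h2.comp_left (g := Complex.ofReal) rfl
      set Φ : SchwartzMap Plane ℂ := h2'.toSchwartzMap h1'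
      -- Injectivity by duality: the test function `g` is the Fourier transform of the Schwartz
      -- function `𝓕⁻ Φ`, so the integral of `w g` equals that of `𝓕 w` times `𝓕⁻ Φ`, which is zero.
      have h3 := VectorFourier.integral_fourierIntegral_smul_eq_flip (L := innerₗ Plane)
        (μ := volume) (ν := volume)
        Real.continuous_fourierChar continuous_inner (integrable_X w) (𝓕⁻ Φ : SchwartzMap Plane ℂ).integrable
      have h4 : ∀ ξ, VectorFourier.fourierIntegral Real.fourierChar volume (innerₗ Plane) (fun ξ => w ξ) ξ = 0 := hF
      have h5 : ∀ ξ, VectorFourier.fourierIntegral Real.fourierChar volume (innerₗ Plane).flip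
          (𝓕⁻ Φ : SchwartzMap Plane ℂ) ξ = g ξ := by
        intro ξ
        have h6 : 𝓕 (𝓕⁻ Φ) = Φ := FourierTransform.fourier_fourierInv_eq Φ
        have h7 := DFunLike.congr_fun h6 ξ
        rw [SchwartzMap.fourier_coe] at h7
        rw [flip_innerₗ]
        exact h7
      simp only [h4, h5, zero_smul, integral_zero] at h3
      rw [h3]
      refine integral_congr_ae (Filter.Eventually.of_forall fun ξ => ?_)
      simp [mul_comm])
  filter_upwards [this, coeFn_zero_ae] with ξ h1 h2
  rw [h1, h2]

theorem eq_zero_of_inner_hermiteVec {w : X} (hw : ∀ k, ⟪hermiteVec k, w⟫_ℂ = 0) : w = 0 := by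
  refine eq_zero_of_integral_hermite fun k => ?_
  have h := hw k
  rw [hermiteVec, inner_smul_left, inner_mulGaussian] at h
  have h1 : (Real.sqrt (hermiteNormSq k)) ≠ 0 := (Real.sqrt_pos.2 (hermiteNormSq_pos k)).ne'
  simpa [h1] using h

/-- The Hermite functions as a Hilbert basis of `X`. -/
def hermiteBasis : HilbertBasis (Fin 2 → ℕ) ℂ X :=
  HilbertBasis.mkOfOrthogonalEqBot orthonormal_hermiteVec (by
    rw [Submodule.eq_bot_iff]
    intro w hw
    refine eq_zero_of_inner_hermiteVec fun k => ?_
    exact (Submodule.mem_orthogonal _ _).1 hw _ (Submodule.subset_span ⟨k, rfl⟩))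

theorem hermiteBasis_apply (k : Fin 2 → ℕ) : hermiteBasis k = hermiteVec k := by
  rw [hermiteBasis, HilbertBasis.coe_mkOfOrthogonalEqBot]

end Oseen

namespace Oseen

open scoped InnerProductSpace ComplexConjugate

/-! ### Weighted shifts in a Hilbert basis -/

/-- Multiplication of the coefficients by a bounded sequence, followed by the isometry of `ℓ²` into
`E` given by the orthonormal family `b ∘ σ`. Injectivity of `σ` keeps this family orthonormal. -/
theorem exists_weightedShift {ι E : Type*} [NormedAddCommGroup E] [InnerProductSpace ℂ E]
    [CompleteSpace E] (b : HilbertBasis ι ℂ E) {σ : ι → ι} (hσ : Function.Injective σ)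
    (a : ι → ℂ) {C : ℝ} (hC : 0 ≤ C) (ha : ∀ k, ‖a k‖ ≤ C) :
    ∃ S : E →L[ℂ] E, ‖S‖ ≤ C ∧ ∀ k, S (b k) = a k • b (σ k) := by
  classical
  have hv : Orthonormal ℂ (b ∘ σ) := b.orthonormal.comp σ hσ
  have hb : ∀ (f : E) k, ‖a k * b.repr f k‖ ≤ ‖((C : ℂ) • b.repr f) k‖ := by
    intro f k
    rw [norm_mul, lp.coeFn_smul, Pi.smul_apply, norm_smul, Complex.norm_real,
      Real.norm_of_nonneg hC]
    gcongr
    exact ha k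
  have hm : ∀ f : E, Memℓp (fun k => a k * b.repr f k) 2 := fun f =>
    (lp.memℓp ((C : ℂ) • b.repr f)).mono' (hb f)
  let m : E →ₗ[ℂ] lp (fun _ : ι => ℂ) 2 :=
    { toFun := fun f => ⟨fun k => a k * b.repr f k, hm f⟩
      map_add' := fun f g => by
        ext k
        simp only [map_add, lp.coeFn_add, Pi.add_apply, mul_add]
      map_smul' := fun c f => by
        ext k
        simp [mul_left_comm] }
  let J := hv.orthogonalFamily.linearIsometry
  refine ⟨(J.toLinearMap ∘ₗ m).mkContinuous C fun f => ?_, LinearMap.mkContinuous_norm_le _ hC _,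
    fun k => ?_⟩
  · rw [LinearMap.comp_apply, LinearIsometry.coe_toLinearMap, J.norm_map]
    calc ‖m f‖ ≤ ‖(C : ℂ) • b.repr f‖ := lp.norm_mono (by norm_num) (hb f)
      _ = C * ‖f‖ := by
        rw [norm_smul, Complex.norm_real, Real.norm_of_nonneg hC, LinearIsometryEquiv.norm_map]
  · rw [LinearMap.mkContinuous_apply, LinearMap.comp_apply, LinearIsometry.coe_toLinearMap]
    have : m (b k) = lp.single 2 k (a k) := by
      ext j
      simp only [m, LinearMap.coe_mk, AddHom.coe_mk, b.repr_self, lp.single_apply]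
      by_cases h : j = k
      · subst h; simp
      · simp [h]
    rw [this, OrthogonalFamily.linearIsometry_apply_single]
    simp

theorem eq_top_of_hilbertBasis_mem {ι E : Type*} [NormedAddCommGroup E] [InnerProductSpace ℂ E]
    (b : HilbertBasis ι ℂ E) {V : Submodule ℂ E} (hV : IsClosed (V : Set E))
    (h : ∀ k, b k ∈ V) : V = ⊤ := by
  rw [eq_top_iff, ← b.dense_span]
  refine Submodule.topologicalClosure_minimal _ ?_ hV
  rw [Submodule.span_le]
  rintro _ ⟨k, rfl⟩
  exact h k

/-- The Hermite functions `H_k G` in `X`, without normalization. -/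
def hermiteFun (k : Fin 2 → ℕ) : X := mulGaussian (hermite k) (hasTemperateGrowth_hermite k)

theorem sqrt_hermiteNormSq_ne_zero (k : Fin 2 → ℕ) : ((Real.sqrt (hermiteNormSq k) : ℝ) : ℂ) ≠ 0 :=
  by exact_mod_cast (Real.sqrt_pos.2 (hermiteNormSq_pos k)).ne'

theorem hermiteFun_eq (k : Fin 2 → ℕ) :
    hermiteFun k = ((Real.sqrt (hermiteNormSq k) : ℝ) : ℂ) • hermiteBasis k := by
  rw [hermiteBasis_apply, hermiteVec, smul_inv_smul₀ (sqrt_hermiteNormSq_ne_zero k)]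
  rfl

theorem hermiteBasis_eq (k : Fin 2 → ℕ) :
    hermiteBasis k = ((Real.sqrt (hermiteNormSq k) : ℝ) : ℂ)⁻¹ • hermiteFun k := by
  rw [hermiteFun_eq, inv_smul_smul₀ (sqrt_hermiteNormSq_ne_zero k)]

theorem eq_top_of_hermiteFun_mem {V : Submodule ℂ X} (hV : IsClosed (V : Set X))
    (h : ∀ k, hermiteFun k ∈ V) : V = ⊤ :=
  eq_top_of_hilbertBasis_mem hermiteBasis hV fun k => by
    rw [hermiteBasis_eq]
    exact V.smul_mem _ (h k)

/-- For the unnormalized functions the boundedness condition is `|c k| ‖H_(k+m)‖ ≤ C ‖H_k‖`, stated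
in squared form to avoid square roots. -/
theorem exists_hermite_shift (m : Fin 2 → ℕ) (c : (Fin 2 → ℕ) → ℝ) {C : ℝ} (hC : 0 ≤ C)
    (hc : ∀ k, c k ^ 2 * hermiteNormSq (k + m) ≤ C ^ 2 * hermiteNormSq k) :
    ∃ S : X →L[ℂ] X, ‖S‖ ≤ C ∧ ∀ k, S (hermiteFun k) = (c k : ℂ) • hermiteFun (k + m) := by
  obtain ⟨S, hS, hS'⟩ := exists_weightedShift hermiteBasis (σ := fun k => k + m)
    (add_left_injective m)
    (fun k => ((c k * (Real.sqrt (hermiteNormSq (k + m)) / Real.sqrt (hermiteNormSq k)) : ℝ) : ℂ))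
    hC (fun k => by
      have h1 := Real.sqrt_pos.2 (hermiteNormSq_pos k)
      have h2 := Real.sqrt_pos.2 (hermiteNormSq_pos (k + m))
      rw [Complex.norm_real, Real.norm_eq_abs, ← mul_div_assoc, abs_div, abs_of_pos h1,
        div_le_iff₀ h1]
      refine abs_le_of_sq_le_sq ?_ (by positivity)
      rw [mul_pow, mul_pow, Real.sq_sqrt (hermiteNormSq_pos _).le,
        Real.sq_sqrt (hermiteNormSq_pos _).le]
      exact hc k)
  refine ⟨S, hS, fun k => ?_⟩
  rw [hermiteFun_eq, map_smul, hS', hermiteFun_eq, smul_smul, smul_smul]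
  congr 1
  have h1 := sqrt_hermiteNormSq_ne_zero k
  push_cast
  field_simp

/-! ### Closedness of weak graphs -/

/-- Each test function imposes one closed condition, since integration against a continuous
compactly supported function is continuous on `X`. -/
theorem isClosed_weakGraph (T : (Plane → ℝ) → Plane → ℝ)
    (hT : ∀ φ, ContDiff ℝ ∞ φ → HasCompactSupport φ →
      Continuous (T φ) ∧ HasCompactSupport (T φ)) :
    IsClosed (weakGraph T hT : Set (X × X)) := by
  have : (weakGraph T hT : Set (X × X)) = ⋂ (φ : Plane → ℝ) (_ : ContDiff ℝ ∞ φ)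
      (_ : HasCompactSupport φ),
      {p : X × X | ∫ ξ, p.2 ξ * (φ ξ : ℂ) = ∫ ξ, p.1 ξ * (T φ ξ : ℂ)} := by
    ext p
    simp only [mem_iInter]
    rfl
  rw [this]
  refine isClosed_iInter fun φ => isClosed_iInter fun h1 => isClosed_iInter fun h2 => ?_
  exact isClosed_eq ((continuous_integral_X_mul h1.continuous h2).comp continuous_snd)
    ((continuous_integral_X_mul (hT φ h1 h2).1 (hT φ h1 h2).2).comp continuous_fst)

/-- Density argument used throughout: for bounded `S` and `T`, the values `(S f, T f)` lie in a
closed graph for every `f` once they do for the Hermite functions. -/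
theorem mem_of_hermiteFun_mem {V : Submodule ℂ (X × X)} (hV : IsClosed (V : Set (X × X)))
    (S T : X →L[ℂ] X) (h : ∀ k, (S (hermiteFun k), T (hermiteFun k)) ∈ V) (f : X) :
    (S f, T f) ∈ V := by
  have : V.comap (S.prod T : X →L[ℂ] X × X).toLinearMap = ⊤ := by
    refine eq_top_of_hermiteFun_mem ?_ h
    exact hV.preimage (S.prod T).continuous
  have h' : f ∈ V.comap (S.prod T : X →L[ℂ] X × X).toLinearMap := by rw [this]; trivial
  exact h'

/-! ### Partial derivatives of test functions -/

theorem _root_.ContDiff.pderiv {f : Plane → ℝ} (hf : ContDiff ℝ ∞ f) (i : Fin 2) :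
    ContDiff ℝ ∞ (Oseen.pderiv i f) := by
  have h : ContDiff ℝ ∞ (fderiv ℝ f) := hf.fderiv_right (by simp)
  exact h.clm_apply contDiff_const

theorem _root_.HasCompactSupport.pderiv {f : Plane → ℝ} (hf : HasCompactSupport f) (i : Fin 2) :
    HasCompactSupport (Oseen.pderiv i f) :=
  hf.fderiv_apply (𝕜 := ℝ) _

theorem laplacian_eq_sum_pderiv {f : Plane → ℝ} (hf : ContDiff ℝ ∞ f) (ξ : Plane) :
    Laplacian.laplacian f ξ = ∑ i, pderiv i (pderiv i f) ξ := by
  rw [InnerProductSpace.laplacian_eq_iteratedFDeriv_orthonormalBasis f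
    (EuclideanSpace.basisFun (Fin 2) ℝ)]
  refine Finset.sum_congr rfl fun i _ => ?_
  rw [iteratedFDeriv_two_apply]
  have h : ContDiff ℝ ∞ (fderiv ℝ f) := hf.fderiv_right (by simp)
  have h1 : pderiv i (pderiv i f) ξ =
      fderiv ℝ (fun η => fderiv ℝ f η (EuclideanSpace.single i 1)) ξ (EuclideanSpace.single i 1) :=
    rfl
  rw [h1, fderiv_clm_apply (h.differentiable (by simp) ξ) (differentiableAt_const _)]
  simp

theorem divergence_smul {f : Plane → ℝ} (hf : Differentiable ℝ f) {b : Plane → Plane}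
    (hb : Differentiable ℝ b) (ξ : Plane) :
    divergence (fun η => f η • b η) ξ = ∑ i, pderiv i (fun η => b η i * f η) ξ := by
  unfold divergence pderiv
  refine Finset.sum_congr rfl fun i _ => ?_
  have h : HasFDerivAt (fun η => f η • b η) _ ξ := ((hf ξ).smul (hb ξ)).hasFDerivAt
  have h2 := ((EuclideanSpace.proj (𝕜 := ℝ) i : Plane →L[ℝ] ℝ).hasFDerivAt.comp ξ h).fderiv
  have e : (fun η => b η i * f η) =
      (EuclideanSpace.proj (𝕜 := ℝ) i : Plane →L[ℝ] ℝ) ∘ (fun η => f η • b η) := by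
    funext η; simp [mul_comm]
  rw [e, h2]
  rfl

theorem contDiff_apply_coord {b : Plane → Plane} (hb : ContDiff ℝ ∞ b) (i : Fin 2) :
    ContDiff ℝ ∞ fun ξ => b ξ i :=
  (contDiff_euclidean.1 hb) i

/-! ### Derivatives of the Hermite functions -/

theorem pderiv_test (i : Fin 2) (φ : Plane → ℝ) (h1 : ContDiff ℝ ∞ φ) (h2 : HasCompactSupport φ) :
    Continuous (fun ξ => -pderiv i φ ξ) ∧ HasCompactSupport (fun ξ => -pderiv i φ ξ) :=
  ⟨(h1.pderiv i).continuous.neg, (h2.pderiv i).neg⟩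

/-- The graph of the distributional derivative `∂ᵢ` in `X`. -/
def pderivGraph (i : Fin 2) : Submodule ℂ (X × X) :=
  weakGraph (fun φ ξ => -pderiv i φ ξ) (pderiv_test i)

/-- This is `∂ᵢ (f G) = -(½ ξᵢ f - ∂ᵢ f) G` in weak form: differentiation of a Hermite function is,
up to sign, a shift of the index. -/
theorem hermiteFun_mem_pderivGraph (k : Fin 2 → ℕ) (i : Fin 2) :
    (hermiteFun k, -hermiteFun (k + Pi.single i 1)) ∈ pderivGraph i := by
  intro φ h1 h2
  have hφ := h2.hasTemperateGrowth h1
  have h := integral_pderiv_mul_gaussian hφ (hasTemperateGrowth_hermite k) i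
  rw [raising_hermite] at h
  have e1 := inner_mulGaussian_mulGaussian hφ (hasTemperateGrowth_hermite (k + Pi.single i 1))
  have e2 := inner_mulGaussian_mulGaussian (hφ.pderiv i) (hasTemperateGrowth_hermite k)
  rw [← h, ← e2, inner_mulGaussian, inner_mulGaussian] at e1
  have e3 : ∀ u : X, ∫ ξ, (-u : X) ξ * (φ ξ : ℂ) = -∫ ξ, u ξ * (φ ξ : ℂ) := fun u => by
    have := integral_smul_mul (-1) u (fun ξ => (φ ξ : ℂ))
    simpa using this
  simp only [e3, Complex.ofReal_neg, mul_neg, integral_neg]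
  exact congrArg Neg.neg e1

theorem mem_weakGraph_laplacian {w : X} {f g : Fin 2 → X} (hf : ∀ i, (w, f i) ∈ pderivGraph i)
    (hg : ∀ i, (f i, g i) ∈ pderivGraph i) :
    (w, ∑ i, g i) ∈ weakGraph Laplacian.laplacian laplacian_test := by
  intro φ h1 h2
  have h3 : ∀ i, ∫ ξ, g i ξ * (φ ξ : ℂ) = ∫ ξ, w ξ * (pderiv i (pderiv i φ) ξ : ℂ) := by
    intro i
    have a1 := hg i φ h1 h2
    have a2 := hf i (pderiv i φ) (h1.pderiv i) (h2.pderiv i)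
    simp only [Complex.ofReal_neg, mul_neg, integral_neg] at a1 a2
    rw [a1, a2, neg_neg]
  simp only [laplacian_eq_sum_pderiv h1, Fin.sum_univ_two] at h3 ⊢
  have i1 : ∀ i, Integrable (fun ξ => w ξ * (pderiv i (pderiv i φ) ξ : ℂ)) := fun i =>
    integrable_X_mul w ((h1.pderiv i).pderiv i).continuous ((h2.pderiv i).pderiv i)
  rw [integral_add_mul _ _ (integrable_X_mul _ h1.continuous h2)
    (integrable_X_mul _ h1.continuous h2), h3, h3, ← integral_add (i1 0) (i1 1)]
  refine integral_congr_ae (Filter.Eventually.of_forall fun ξ => ?_)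
  push_cast
  ring

theorem coord_mul_hermite (k : Fin 2 → ℕ) (i : Fin 2) (ξ : Plane) :
    ξ i * hermite (k + Pi.single i 1) ξ = 2 * hermite (k + Pi.single i 1 + Pi.single i 1) ξ +
      ((k i : ℝ) + 1) * hermite k ξ := by
  have h1 := congrFun (raising_hermite (k + Pi.single i 1) i) ξ
  rw [raising, pderiv_hermite_succ] at h1
  linarith

theorem inner_hermiteFun_of_test {φ : Plane → ℝ} (h1 : φ.HasTemperateGrowth) (k : Fin 2 → ℕ) :
    ∫ ξ, hermiteFun k ξ * (φ ξ : ℂ) = ((∫ ξ, φ ξ * (hermite k ξ * gaussian ξ) : ℝ) : ℂ) := by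
  rw [← inner_mulGaussian_mulGaussian h1 (hasTemperateGrowth_hermite k), inner_mulGaussian]
  rfl

/-- From `∂ᵢ (H_k G) = -H_(k+eᵢ) G` and the recurrence for `ξᵢ H_(k+eᵢ)`. The recurrence contributes
`kᵢ + 1` in each of the two coordinates, whence the constant `2`. -/
theorem hermiteFun_mem_weakGraph_radial (k : Fin 2 → ℕ) :
    (hermiteFun k, -((2 : ℂ) • ∑ i, hermiteFun (k + Pi.single i 1 + Pi.single i 1) +
      ((∑ i, (k i : ℂ)) + 2) • hermiteFun k)) ∈
      weakGraph (fun φ ξ => -divergence (fun η => φ η • η) ξ) (divergence_test contDiff_id) := by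
  intro φ h1 h2
  have hφ := h2.hasTemperateGrowth h1
  have hc := hasTemperateGrowth_coord
  have hcφ : ∀ i, Function.HasTemperateGrowth fun ξ : Plane => ξ i * φ ξ := fun i => (hc i).mul hφ
  have hH := hasTemperateGrowth_hermite
  have hL : ∀ u : X, ∫ ξ, u ξ * (φ ξ : ℂ) = ⟪mulGaussian φ hφ, u⟫_ℂ := fun u =>
    (inner_mulGaussian hφ u).symm
  have hR : ∀ i, ∫ ξ, hermiteFun k ξ * (pderiv i (fun η => η i * φ η) ξ : ℂ) =
      2 * ⟪mulGaussian φ hφ, hermiteFun (k + Pi.single i 1 + Pi.single i 1)⟫_ℂ +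
        ((k i : ℂ) + 1) * ⟪mulGaussian φ hφ, hermiteFun k⟫_ℂ := by
    intro i
    rw [inner_hermiteFun_of_test ((hcφ i).pderiv i),
      integral_pderiv_mul_gaussian (hcφ i) (hH k) i, raising_hermite, hermiteFun, hermiteFun,
      inner_mulGaussian_mulGaussian, inner_mulGaussian_mulGaussian]
    have i1 : ∀ l, Integrable fun ξ => φ ξ * (hermite l ξ * gaussian ξ) := fun l => by
      have := (hφ.mul (hH l)).integrable_mul_gaussian
      simpa [mul_assoc] using this
    have e : ∀ ξ : Plane, ξ i * φ ξ * (hermite (k + Pi.single i 1) ξ * gaussian ξ) =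
        2 * (φ ξ * (hermite (k + Pi.single i 1 + Pi.single i 1) ξ * gaussian ξ)) +
          ((k i : ℝ) + 1) * (φ ξ * (hermite k ξ * gaussian ξ)) := fun ξ => by
      linear_combination φ ξ * gaussian ξ * coord_mul_hermite k i ξ
    simp only [e]
    rw [integral_add ((i1 _).const_mul _) ((i1 _).const_mul _), integral_const_mul,
      integral_const_mul]
    push_cast
    rfl
  have hd := fun ξ => divergence_smul (h1.differentiable (by simp)) (b := fun η => η)
    differentiable_id ξ
  have i2 : ∀ i, Integrable fun ξ => hermiteFun k ξ * (pderiv i (fun η => η i * φ η) ξ : ℂ) :=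
    fun i => ((hcφ i).pderiv i).integrable_X_mul _
  simp only [hd, Fin.sum_univ_two, Complex.ofReal_neg, Complex.ofReal_add, mul_neg, mul_add,
    integral_neg]
  rw [integral_add (i2 0) (i2 1), hR, hR, hL]
  simp only [inner_neg_right, inner_add_right, inner_smul_right]
  ring

/-! ### Cutoff functions -/

theorem pderiv_comp_smul {f : Plane → ℝ} (hf : Differentiable ℝ f) (c : ℝ) (i : Fin 2)
    (ξ : Plane) : pderiv i (fun η => f (c • η)) ξ = c * pderiv i f (c • ξ) := by
  have h1 : HasFDerivAt (fun η : Plane => c • η) (c • ContinuousLinearMap.id ℝ Plane) ξ :=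
    (hasFDerivAt_id ξ).const_smul c
  have h2 := ((hf (c • ξ)).hasFDerivAt.comp ξ h1).fderiv
  have h3 : pderiv i (fun η => f (c • η)) ξ = _ :=
    congrArg (fun L : Plane →L[ℝ] ℝ => L (EuclideanSpace.single i 1)) h2
  rw [h3]
  simp [pderiv]

theorem pderiv_add {f g : Plane → ℝ} (hf : Differentiable ℝ f) (hg : Differentiable ℝ g)
    (i : Fin 2) (ξ : Plane) :
    pderiv i (fun η => f η + g η) ξ = pderiv i f ξ + pderiv i g ξ := by
  simp [pderiv, fderiv_fun_add (hf ξ) (hg ξ)]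

theorem pderiv_congr {f g : Plane → ℝ} {ξ : Plane} (h : f =ᶠ[𝓝 ξ] g) (i : Fin 2) :
    pderiv i f =ᶠ[𝓝 ξ] pderiv i g := by
  filter_upwards [h.eventuallyEq_nhds] with η hη
  rw [pderiv, hη.fderiv_eq, pderiv]

/-- Dilations of one bump function. The gradient of `χ n` has size `1/(n+1)` and is supported where
`‖ξ‖ ≤ 2(n+1)`, so it stays bounded even after multiplication by a factor of linear growth. Local
equality with `1` makes the derivatives stabilize as well. -/
theorem exists_cutoff : ∃ (χ : ℕ → Plane → ℝ) (C : ℝ), 0 ≤ C ∧ (∀ n, ContDiff ℝ ∞ (χ n)) ∧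
    (∀ n, HasCompactSupport (χ n)) ∧ (∀ n ξ, |χ n ξ| ≤ 1) ∧
    (∀ n i ξ, |pderiv i (χ n) ξ| * (1 + ‖ξ‖) ≤ C) ∧
    (∀ n i ξ, |pderiv i (pderiv i (χ n)) ξ| ≤ C) ∧
    ∀ ξ, ∀ᶠ n in Filter.atTop, χ n =ᶠ[𝓝 ξ] fun _ => 1 := by
  let b : ContDiffBump (0 : Plane) := ⟨1, 2, by norm_num, by norm_num⟩
  have hb : ContDiff ℝ ∞ (b : Plane → ℝ) := b.contDiff
  have hbc : HasCompactSupport (b : Plane → ℝ) := b.hasCompactSupport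
  have bd : ∀ g : Plane → ℝ, ContDiff ℝ ∞ g → HasCompactSupport g → ∃ C, ∀ ξ, |g ξ| ≤ C :=
    fun g h1 h2 => h2.exists_bound_of_continuous h1.continuous
  choose C1 hC1 using fun i => bd (pderiv i b) (hb.pderiv i) (hbc.pderiv i)
  choose C2 hC2 using fun i => bd (pderiv i (pderiv i b)) ((hb.pderiv i).pderiv i)
    ((hbc.pderiv i).pderiv i)
  have n1 : ∀ i, 0 ≤ C1 i := fun i => (abs_nonneg _).trans (hC1 i 0)
  have n2 : ∀ i, 0 ≤ C2 i := fun i => (abs_nonneg _).trans (hC2 i 0)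
  let c : ℕ → ℝ := fun n => ((n : ℝ) + 1)⁻¹
  have hc : ∀ n, 0 < c n := fun n => by positivity
  have hc1 : ∀ n, c n ≤ 1 := fun n => inv_le_one_of_one_le₀ (by linarith [n.cast_nonneg (α := ℝ)])
  have e1 : ∀ n i, pderiv i (fun ξ => b (c n • ξ)) = fun ξ => c n * pderiv i b (c n • ξ) :=
    fun n i => funext fun ξ => pderiv_comp_smul (hb.differentiable (by simp)) _ _ _
  have hsupp : ∀ i x, 2 < ‖x‖ → pderiv i b x = 0 := by
    intro i x hx
    have : x ∉ tsupport (b : Plane → ℝ) := by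
      rw [b.tsupport_eq]
      simpa using hx
    rw [pderiv, image_eq_zero_of_notMem_tsupport (fun h => this (tsupport_fderiv_subset ℝ h))]
    rfl
  refine ⟨fun n ξ => b (c n • ξ), 3 * (C1 0 + C1 1) + (C2 0 + C2 1), ?_, fun n => ?_, fun n => ?_,
    fun n ξ => ?_, fun n i ξ => ?_, fun n i ξ => ?_, fun ξ => ?_⟩
  · have := n1 0; have := n1 1; have := n2 0; have := n2 1
    positivity
  · exact hb.comp (contDiff_const_smul _)
  · exact hbc.comp_smul (hc n).ne'
  · rw [abs_of_nonneg b.nonneg]; exact b.le_one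
  · have hi : C1 i ≤ C1 0 + C1 1 := by
      have := n1 0; have := n1 1
      fin_cases i <;> simp <;> linarith
    have h2 : 0 ≤ C2 0 + C2 1 := add_nonneg (n2 0) (n2 1)
    rw [e1]
    by_cases hx : 2 < ‖c n • ξ‖
    · simp only [hsupp i _ hx, mul_zero, abs_zero, zero_mul]
      have := n1 i
      linarith
    · rw [norm_smul, Real.norm_of_nonneg (hc n).le, not_lt] at hx
      rw [abs_mul, abs_of_pos (hc n)]
      have h3 := hC1 i (c n • ξ)
      -- On the support of the gradient `c n ‖ξ‖ ≤ 2`, and `c n ≤ 1`.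
      have h4 : c n * (1 + ‖ξ‖) ≤ 3 := by linarith [hc1 n]
      calc c n * |pderiv i b (c n • ξ)| * (1 + ‖ξ‖)
          = (c n * (1 + ‖ξ‖)) * |pderiv i b (c n • ξ)| := by ring
        _ ≤ 3 * C1 i := by gcongr
        _ ≤ _ := by linarith
  · have hi : C2 i ≤ C2 0 + C2 1 := by
      have := n2 0; have := n2 1
      fin_cases i <;> simp <;> linarith
    have h2 : 0 ≤ C1 0 + C1 1 := add_nonneg (n1 0) (n1 1)
    have h5 : pderiv i (fun ξ => c n * pderiv i b (c n • ξ)) ξ =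
        c n * (c n * pderiv i (pderiv i b) (c n • ξ)) := by
      have hd : Differentiable ℝ fun ξ => pderiv i b (c n • ξ) :=
        ((hb.pderiv i).comp (contDiff_const_smul (c n))).differentiable (by simp)
      rw [pderiv_mul (differentiable_const _) hd,
        pderiv_comp_smul ((hb.pderiv i).differentiable (by simp))]
      simp [pderiv]
    rw [e1, h5, abs_mul, abs_mul, abs_of_pos (hc n)]
    have h3 := hC2 i (c n • ξ)
    calc c n * (c n * |pderiv i (pderiv i b) (c n • ξ)|) ≤ 1 * (1 * C2 i) := by
          have := hc1 n
          have := (hc n).le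
          gcongr
      _ ≤ _ := by linarith
  · obtain ⟨N, hN⟩ := exists_nat_gt ‖ξ‖
    filter_upwards [Filter.eventually_ge_atTop N] with n hn
    have : ‖ξ‖ < (n : ℝ) + 1 := by
      have : (N : ℝ) ≤ n := by exact_mod_cast hn
      linarith
    filter_upwards [(continuous_norm.continuousAt (x := ξ)).eventually_lt_const this] with η hη
    refine b.one_of_mem_closedBall ?_
    rw [mem_closedBall_zero_iff, norm_smul, Real.norm_of_nonneg (hc n).le]
    exact (inv_mul_le_one₀ (by positivity)).2 hη.le

/-! ### Weak identities against functions of temperate growth -/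

theorem integrable_norm_X_mul (w : X) {B : Plane → ℝ} (hB : Continuous B) {C c : ℝ}
    (h : ∀ ξ, |B ξ| ≤ C * Real.exp (c * ‖ξ‖)) : Integrable (fun ξ => ‖w ξ‖ * B ξ) := by
  refine ((integrable_exp_mul_X w c).norm.const_mul C).mono'
    ((integrable_X w).norm.aestronglyMeasurable.mul hB.aestronglyMeasurable)
    (Filter.Eventually.of_forall fun ξ => ?_)
  simp only [norm_mul, Complex.norm_real, Real.norm_eq_abs, Real.abs_exp, abs_norm]
  calc ‖w ξ‖ * |B ξ| ≤ ‖w ξ‖ * (C * Real.exp (c * ‖ξ‖)) := by gcongr; exact h ξ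
    _ = _ := by ring

theorem _root_.Function.HasTemperateGrowth.integrable_norm_X_mul_abs {f : Plane → ℝ}
    (hf : f.HasTemperateGrowth) (w : X) : Integrable (fun ξ => ‖w ξ‖ * |f ξ|) := by
  obtain ⟨C, c, hC, h⟩ := hf.exists_le_exp
  exact integrable_norm_X_mul w hf.1.continuous.abs (C := C) (c := c) (by simpa using h)

/-- Dominated convergence on both sides; pointwise convergence is trivial because the cutoff
sequences are eventually constant at each point. -/
theorem integral_eq_of_cutoff {w f : X} {q q' : Plane → ℝ} {φ ψ : ℕ → Plane → ℝ}
    {B B' : Plane → ℝ} (hφ : ∀ n, Continuous (φ n)) (hψ : ∀ n, Continuous (ψ n))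
    (hB : Integrable fun ξ => ‖f ξ‖ * B ξ) (hB' : Integrable fun ξ => ‖w ξ‖ * B' ξ)
    (h1 : ∀ n ξ, |φ n ξ| ≤ B ξ) (h2 : ∀ n ξ, |ψ n ξ| ≤ B' ξ)
    (h3 : ∀ ξ, ∀ᶠ n in Filter.atTop, φ n ξ = q ξ) (h4 : ∀ ξ, ∀ᶠ n in Filter.atTop, ψ n ξ = q' ξ)
    (h : ∀ n, ∫ ξ, f ξ * (φ n ξ : ℂ) = ∫ ξ, w ξ * (ψ n ξ : ℂ)) :
    ∫ ξ, f ξ * (q ξ : ℂ) = ∫ ξ, w ξ * (q' ξ : ℂ) := by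
  have key : ∀ {u : X} {p : Plane → ℝ} {ρ : ℕ → Plane → ℝ} {D : Plane → ℝ},
      (∀ n, Continuous (ρ n)) → (Integrable fun ξ => ‖u ξ‖ * D ξ) → (∀ n ξ, |ρ n ξ| ≤ D ξ) →
      (∀ ξ, ∀ᶠ n in Filter.atTop, ρ n ξ = p ξ) →
      Filter.Tendsto (fun n => ∫ ξ, u ξ * (ρ n ξ : ℂ)) Filter.atTop
        (𝓝 (∫ ξ, u ξ * (p ξ : ℂ))) := by
    intro u p ρ D a1 a2 a3 a4
    refine tendsto_integral_of_dominated_convergence _ (fun n => ?_) a2 (fun n => ?_) ?_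
    · exact (integrable_X u).aestronglyMeasurable.mul
        (Continuous.aestronglyMeasurable (by have := a1 n; fun_prop))
    · refine Filter.Eventually.of_forall fun ξ => ?_
      rw [norm_mul, Complex.norm_real, Real.norm_eq_abs]
      gcongr
      exact a3 n ξ
    · refine Filter.Eventually.of_forall fun ξ => ?_
      refine Filter.Tendsto.congr' ?_ tendsto_const_nhds
      filter_upwards [a4 ξ] with n hn
      rw [hn]
  refine tendsto_nhds_unique (key hφ hB h1 h3) ?_
  simp only [h]
  exact key hψ hB' h2 h4

/-- The weak Laplacian is defined through compactly supported test functions, but elements of `X`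
decay fast enough to test it on polynomials. In the Leibniz rule the terms that differentiate the
cutoff are dominated and eventually vanish at each point. -/
theorem integral_laplacian_mul {w f : X}
    (h : (w, f) ∈ weakGraph Laplacian.laplacian laplacian_test) {q : Plane → ℝ}
    (hq : q.HasTemperateGrowth) :
    ∫ ξ, f ξ * (q ξ : ℂ) = ∫ ξ, w ξ * ((∑ i, pderiv i (pderiv i q) ξ : ℝ) : ℂ) := by
  obtain ⟨χ, C, hC, c1, c2, c3, c4, c5, c6⟩ := exists_cutoff
  have hs : ∀ n, ContDiff ℝ ∞ fun ξ => χ n ξ * q ξ := fun n => (c1 n).mul hq.1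
  have hc : ∀ n, HasCompactSupport fun ξ => χ n ξ * q ξ := fun n => (c2 n).mul_right
  have dχ : ∀ n, Differentiable ℝ (χ n) := fun n => (c1 n).differentiable (by simp)
  have e : ∀ n i ξ, pderiv i (pderiv i fun η => χ n η * q η) ξ =
      pderiv i (pderiv i (χ n)) ξ * q ξ + 2 * (pderiv i (χ n) ξ * pderiv i q ξ) +
        χ n ξ * pderiv i (pderiv i q) ξ := by
    intro n i ξ
    have e1 : pderiv i (fun η => χ n η * q η) =
        fun η => pderiv i (χ n) η * q η + χ n η * pderiv i q η :=
      funext fun η => pderiv_mul (dχ n) hq.differentiable i η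
    have d1 : Differentiable ℝ fun η => pderiv i (χ n) η * q η :=
      (((c1 n).pderiv i).mul hq.1).differentiable (by simp)
    have d2 : Differentiable ℝ fun η => χ n η * pderiv i q η :=
      ((c1 n).mul (hq.1.pderiv i)).differentiable (by simp)
    rw [e1, pderiv_add d1 d2, pderiv_mul (((c1 n).pderiv i).differentiable (by simp)) hq.differentiable,
      pderiv_mul (dχ n) (hq.pderiv i).differentiable]
    ring
  have b4 : ∀ n i ξ, |pderiv i (χ n) ξ| ≤ C := fun n i ξ => by
    refine le_trans ?_ (c4 n i ξ)
    nlinarith [abs_nonneg (pderiv i (χ n) ξ), norm_nonneg ξ]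
  refine integral_eq_of_cutoff (φ := fun n ξ => χ n ξ * q ξ)
    (ψ := fun n => Laplacian.laplacian fun ξ => χ n ξ * q ξ) (B := fun ξ => |q ξ|)
    (B' := fun ξ => ∑ i, (C * |q ξ| + 2 * C * |pderiv i q ξ| + |pderiv i (pderiv i q) ξ|))
    (fun n => (hs n).continuous) (fun n => (laplacian_test _ (hs n) (hc n)).1)
    (hq.integrable_norm_X_mul_abs f) ?_ (fun n ξ => ?_) (fun n ξ => ?_) (fun ξ => ?_) (fun ξ => ?_)
    (fun n => h _ (hs n) (hc n))
  · simp only [Finset.mul_sum]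
    refine integrable_finsetSum _ fun i _ => ?_
    have i1 := (hq.integrable_norm_X_mul_abs w).const_mul C
    have i2 := ((hq.pderiv i).integrable_norm_X_mul_abs w).const_mul (2 * C)
    have i3 := ((hq.pderiv i).pderiv i).integrable_norm_X_mul_abs w
    refine ((i1.add i2).add i3).congr (Filter.Eventually.of_forall fun ξ => ?_)
    simp only [Pi.add_apply]
    ring
  · rw [abs_mul]
    exact mul_le_of_le_one_left (abs_nonneg _) (c3 n ξ)
  · rw [laplacian_eq_sum_pderiv (hs n)]
    refine (Finset.abs_sum_le_sum_abs _ _).trans (Finset.sum_le_sum fun i _ => ?_)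
    rw [e]
    refine (abs_add_le _ _).trans (add_le_add ((abs_add_le _ _).trans (add_le_add ?_ ?_)) ?_)
    · rw [abs_mul]; gcongr; exact c5 n i ξ
    · rw [abs_mul, abs_mul, abs_two, ← mul_assoc]; gcongr; exact b4 n i ξ
    · rw [abs_mul]; exact mul_le_of_le_one_left (abs_nonneg _) (c3 n ξ)
  · filter_upwards [c6 ξ] with n hn
    rw [hn.eq_of_nhds, one_mul]
  · filter_upwards [c6 ξ] with n hn
    rw [laplacian_eq_sum_pderiv (hs n)]
    have : (fun η => χ n η * q η) =ᶠ[𝓝 ξ] q := by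
      filter_upwards [hn] with η hη
      rw [hη, one_mul]
    exact Finset.sum_congr rfl fun i _ => (pderiv_congr (pderiv_congr this i) i).eq_of_nhds

/-- The analogous extension for a field of linear growth and constant divergence `d`. It is needed
for `b ξ = ξ` with `d = 2`, and for `v^G` with `d = 0`. -/
theorem integral_advection_mul {b : Plane → Plane} {hb : ContDiff ℝ ∞ b} {w f : X}
    (h : (w, f) ∈ weakGraph (fun φ ξ => -divergence (fun η => φ η • b η) ξ) (divergence_test hb))
    {K d : ℝ} (hK : ∀ i ξ, |b ξ i| ≤ K * (1 + ‖ξ‖))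
    (hd : ∀ ξ, ∑ i, pderiv i (fun η => b η i) ξ = d)
    {q : Plane → ℝ} (hq : q.HasTemperateGrowth) :
    ∫ ξ, f ξ * (q ξ : ℂ) = ∫ ξ, w ξ * ((-(∑ i, b ξ i * pderiv i q ξ + d * q ξ) : ℝ) : ℂ) := by
  obtain ⟨χ, C, hC, c1, c2, c3, c4, c5, c6⟩ := exists_cutoff
  have hK0 : 0 ≤ K := by simpa using (abs_nonneg _).trans (hK 0 0)
  have hs : ∀ n, ContDiff ℝ ∞ fun ξ => χ n ξ * q ξ := fun n => (c1 n).mul hq.1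
  have hc : ∀ n, HasCompactSupport fun ξ => χ n ξ * q ξ := fun n => (c2 n).mul_right
  have dχ : ∀ n, Differentiable ℝ (χ n) := fun n => (c1 n).differentiable (by simp)
  have hbi := fun i => (contDiff_apply_coord hb i)
  have e : ∀ φ : Plane → ℝ, Differentiable ℝ φ → ∀ ξ, -divergence (fun η => φ η • b η) ξ =
      -(∑ i, b ξ i * pderiv i φ ξ + d * φ ξ) := by
    intro φ h1 ξ
    rw [divergence_smul h1 (hb.differentiable (by simp)), ← hd ξ, Finset.sum_mul,
      ← Finset.sum_add_distrib]
    congr 1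
    refine Finset.sum_congr rfl fun i _ => ?_
    rw [pderiv_mul ((hbi i).differentiable (by simp)) h1]
    ring
  have hT := fun n => (divergence_test hb _ (hs n) (hc n)).1
  refine integral_eq_of_cutoff (φ := fun n ξ => χ n ξ * q ξ)
    (ψ := fun n ξ => -divergence (fun η => (χ n η * q η) • b η) ξ) (B := fun ξ => |q ξ|)
    (B' := fun ξ => ∑ i, (K * C * |q ξ| + K * (|(1 + ‖ξ‖) * pderiv i q ξ|)) + |d| * |q ξ|)
    (fun n => (hs n).continuous) (fun n => hT n)
    (hq.integrable_norm_X_mul_abs f) ?_ (fun n ξ => ?_) (fun n ξ => ?_) (fun ξ => ?_) (fun ξ => ?_)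
    (fun n => h _ (hs n) (hc n))
  · have i1 := (hq.integrable_norm_X_mul_abs w)
    have i2 : ∀ i, Integrable fun ξ => ‖w ξ‖ * |(1 + ‖ξ‖) * pderiv i q ξ| := by
      intro i
      obtain ⟨A, a, hA, ha⟩ := (hq.pderiv i).exists_le_exp
      refine integrable_norm_X_mul w (C := A) (c := 1 + a)
        (by have := (hq.pderiv i).1.continuous; fun_prop) fun ξ => ?_
      have e2 : Real.exp ((1 + a) * ‖ξ‖) = Real.exp ‖ξ‖ * Real.exp (a * ‖ξ‖) := by
        rw [← Real.exp_add]; ring_nf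
      rw [abs_abs, abs_mul, abs_of_pos (by positivity : 0 < 1 + ‖ξ‖), e2]
      have := Real.add_one_le_exp ‖ξ‖
      calc (1 + ‖ξ‖) * |pderiv i q ξ| ≤ Real.exp ‖ξ‖ * (A * Real.exp (a * ‖ξ‖)) := by
            gcongr
            · linarith
            · exact ha ξ
        _ = _ := by ring
    simp only [mul_add, Fin.sum_univ_two]
    refine (((i1.const_mul (K * C)).add ((i2 0).const_mul K)).add
      ((i1.const_mul (K * C)).add ((i2 1).const_mul K))).add (i1.const_mul |d|) |>.congr
      (Filter.Eventually.of_forall fun ξ => ?_)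
    simp only [Pi.add_apply]
    ring
  · rw [abs_mul]
    exact mul_le_of_le_one_left (abs_nonneg _) (c3 n ξ)
  · rw [e _ ((hs n).differentiable (by simp)), abs_neg]
    refine (abs_add_le _ _).trans (add_le_add ?_ ?_)
    · refine (Finset.abs_sum_le_sum_abs _ _).trans (Finset.sum_le_sum fun i _ => ?_)
      rw [pderiv_mul (dχ n) hq.differentiable, abs_mul]
      have a1 : |pderiv i (χ n) ξ * q ξ + χ n ξ * pderiv i q ξ| ≤
          |pderiv i (χ n) ξ| * |q ξ| + |pderiv i q ξ| := by
        refine (abs_add_le _ _).trans (add_le_add (abs_mul _ _).le ?_)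
        rw [abs_mul]; exact mul_le_of_le_one_left (abs_nonneg _) (c3 n ξ)
      calc _ ≤ (K * (1 + ‖ξ‖)) * (|pderiv i (χ n) ξ| * |q ξ| + |pderiv i q ξ|) := by
            gcongr; exact hK i ξ
        _ = K * (|pderiv i (χ n) ξ| * (1 + ‖ξ‖)) * |q ξ| + K * ((1 + ‖ξ‖) * |pderiv i q ξ|) := by
            ring
        _ ≤ K * C * |q ξ| + K * |(1 + ‖ξ‖) * pderiv i q ξ| := by
            rw [abs_mul, abs_of_pos (by positivity : 0 < 1 + ‖ξ‖)]
            gcongr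
            exact c4 n i ξ
    · rw [abs_mul, abs_mul]
      gcongr
      exact mul_le_of_le_one_left (abs_nonneg _) (c3 n ξ)
  · filter_upwards [c6 ξ] with n hn
    rw [hn.eq_of_nhds, one_mul]
  · filter_upwards [c6 ξ] with n hn
    have : (fun η => χ n η * q η) =ᶠ[𝓝 ξ] q := by
      filter_upwards [hn] with η hη
      rw [hη, one_mul]
    rw [e _ ((hs n).differentiable (by simp)), this.eq_of_nhds]
    congr 2
    exact Finset.sum_congr rfl fun i _ => by rw [(pderiv_congr this i).eq_of_nhds]

/-! ### The vortex velocity -/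

/-- With `s = ‖ξ‖²/4`, the quotient `(1 - exp (-s)) / s` extends smoothly across `s = 0`. This
exhibits `v^G` as a smooth radial function times `ξ^⊥`. -/
theorem exists_vortexVelocity_profile : ∃ g : ℝ → ℝ, ContDiff ℝ ∞ g ∧
    ∀ ξ, vortexVelocity ξ = g (‖ξ‖ ^ 2) • perp ξ := by
  refine ⟨fun s => (8 * Real.pi)⁻¹ * dslope (fun s : ℝ => 1 - Real.exp (-s)) 0 (s / 4),
    contDiff_const.mul (contDiff_entire.comp (contDiff_id.div_const _)), fun ξ => ?_⟩
  unfold vortexVelocity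
  rcases eq_or_ne ξ 0 with rfl | hξ
  · have : perp 0 = 0 := by ext i; fin_cases i <;> simp [perp]
    simp [this]
  · have h : ‖ξ‖ ≠ 0 := norm_ne_zero_iff.2 hξ
    beta_reduce
    rw [dslope_of_ne _ (by positivity), slope_def_field]
    congr 1
    have := Real.pi_ne_zero
    simp only [neg_zero, Real.exp_zero, sub_self, sub_zero]
    rw [neg_div]
    field_simp
    ring

theorem pderiv_coord (i j : Fin 2) (ξ : Plane) :
    pderiv i (fun η => η j) ξ = if j = i then 1 else 0 := by
  simpa using pderiv_eval Polynomial.X i j ξ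

theorem pderiv_normSq_comp {g : ℝ → ℝ} (hg : Differentiable ℝ g) (i : Fin 2) (ξ : Plane) :
    pderiv i (fun η => g (‖η‖ ^ 2)) ξ = 2 * ξ i * deriv g (‖ξ‖ ^ 2) := by
  have h1 : HasFDerivAt (fun ξ : Plane => ‖ξ‖ ^ 2) (2 • innerSL ℝ ξ) ξ :=
    (hasStrictFDerivAt_norm_sq ξ).hasFDerivAt
  have h2 := ((hg _).hasDerivAt.comp_hasFDerivAt ξ h1).fderiv
  have h3 : pderiv i (fun η => g (‖η‖ ^ 2)) ξ = _ :=
    congrArg (fun L : Plane →L[ℝ] ℝ => L (EuclideanSpace.single i 1)) h2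
  rw [h3]
  simp only [two_nsmul, FunLike.coe_smul, FunLike.coe_add, Pi.smul_apply, Pi.add_apply,
    innerSL_apply_apply, smul_eq_mul, EuclideanSpace.inner_single_right]
  simp
  ring

/-- The gradient of a radial function is orthogonal to `ξ^⊥`, and `ξ^⊥` is itself divergence free.
-/
theorem sum_pderiv_vortexVelocity (ξ : Plane) :
    ∑ i, pderiv i (fun η => vortexVelocity η i) ξ = 0 := by
  obtain ⟨g, hg, h⟩ := exists_vortexVelocity_profile
  have hd : Differentiable ℝ fun η : Plane => g (‖η‖ ^ 2) :=
    (hg.comp (contDiff_norm_sq ℝ)).differentiable (by simp)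
  have hc : ∀ i, Differentiable ℝ fun η : Plane => η i := fun i =>
    (hasTemperateGrowth_coord i).differentiable
  have e0 : (fun η => vortexVelocity η 0) = fun η : Plane => (-g (‖η‖ ^ 2)) * η 1 := by
    funext η; simp [h, perp]
  have e1 : (fun η => vortexVelocity η 1) = fun η : Plane => g (‖η‖ ^ 2) * η 0 := by
    funext η; simp [h, perp]
  have hn : pderiv 0 (fun η : Plane => -g (‖η‖ ^ 2)) ξ = -(2 * ξ 0 * deriv g (‖ξ‖ ^ 2)) := by
    rw [← pderiv_normSq_comp (hg.differentiable (by simp)), pderiv, pderiv, fderiv_fun_neg]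
    rfl
  have hd' : Differentiable ℝ fun η : Plane => -g (‖η‖ ^ 2) := hd.neg
  rw [Fin.sum_univ_two, e0, e1, pderiv_mul hd' (hc 1), pderiv_mul hd (hc 0), pderiv_coord,
    pderiv_coord, hn, pderiv_normSq_comp (hg.differentiable (by simp))]
  simp
  ring

theorem sum_coord_mul_vortexVelocity (ξ : Plane) : ∑ i, ξ i * vortexVelocity ξ i = 0 := by
  simp [vortexVelocity, perp, Fin.sum_univ_two]
  ring

theorem abs_vortexVelocity_le (i : Fin 2) (ξ : Plane) : |vortexVelocity ξ i| ≤ 1 := by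
  have h1 : |perp ξ i| ≤ ‖ξ‖ := by
    fin_cases i
    · simpa [perp] using PiLp.norm_apply_le ξ 1
    · simpa [perp] using PiLp.norm_apply_le ξ 0
  rcases eq_or_ne ξ 0 with rfl | hξ
  · simp [vortexVelocity]
  have h : 0 < ‖ξ‖ := norm_pos_iff.2 hξ
  have h2 : (2 * Real.pi)⁻¹ ≤ 1 := inv_le_one_of_one_le₀ (by linarith [Real.pi_gt_three])
  have h3 : 0 < (2 * Real.pi)⁻¹ := by positivity
  have h4 : 1 - Real.exp (-‖ξ‖ ^ 2 / 4) ≤ ‖ξ‖ := by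
    by_cases hle : ‖ξ‖ ≤ 1
    · have := Real.add_one_le_exp (-‖ξ‖ ^ 2 / 4)
      nlinarith
    · have := Real.exp_pos (-‖ξ‖ ^ 2 / 4)
      linarith
  have h5 : 0 ≤ 1 - Real.exp (-‖ξ‖ ^ 2 / 4) := by
    have := Real.exp_le_one_iff.2 (by nlinarith [sq_nonneg ‖ξ‖] : -‖ξ‖ ^ 2 / 4 ≤ 0)
    linarith
  simp only [vortexVelocity, PiLp.smul_apply, smul_eq_mul]
  rw [abs_mul, abs_of_nonneg (by positivity)]
  calc _ ≤ 1 * (‖ξ‖ ^ 2)⁻¹ * ‖ξ‖ * ‖ξ‖ := by gcongr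
    _ = 1 := by field_simp

/-- Multiplication by a bounded continuous function in `X`. -/
theorem exists_mulOp {g : Plane → ℝ} (hg : Continuous g) {C : ℝ} (hC : ∀ ξ, |g ξ| ≤ C) :
    ∃ M : X →L[ℂ] X, ‖M‖ ≤ C ∧ ∀ w : X, ∀ᵐ ξ, M w ξ = (g ξ : ℂ) * w ξ := by
  have hC0 : 0 ≤ C := (abs_nonneg _).trans (hC 0)
  have hm : ∀ w : X, MemLp (fun ξ => (g ξ : ℂ) * w ξ) 2 weightedMeasure := fun w => by
    refine ((Lp.memLp w).const_mul (C : ℂ)).mono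
      ((Continuous.aestronglyMeasurable (by fun_prop)).mul (Lp.aestronglyMeasurable w))
      (Filter.Eventually.of_forall fun ξ => ?_)
    rw [norm_mul, norm_mul, Complex.norm_real, Complex.norm_real, Real.norm_of_nonneg hC0]
    gcongr
    exact hC ξ
  let L : X →ₗ[ℂ] X :=
    { toFun := fun w => (hm w).toLp _
      map_add' := fun u v => by
        rw [← MemLp.toLp_add, MemLp.toLp_eq_toLp_iff]
        filter_upwards [Lp.coeFn_add u v] with ξ h
        rw [Pi.add_apply, h, Pi.add_apply, mul_add]
      map_smul' := fun c u => by
        rw [RingHom.id_apply, ← MemLp.toLp_const_smul, MemLp.toLp_eq_toLp_iff]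
        filter_upwards [Lp.coeFn_smul c u] with ξ h
        rw [Pi.smul_apply, h, Pi.smul_apply, smul_eq_mul, smul_eq_mul]
        ring }
  refine ⟨L.mkContinuous C fun w => ?_, L.mkContinuous_norm_le hC0 _, fun w => ?_⟩
  · refine Lp.norm_le_mul_norm_of_ae_le_mul ?_
    filter_upwards [(hm w).coeFn_toLp] with ξ h
    change ‖(hm w).toLp _ ξ‖ ≤ _
    rw [h, norm_mul, Complex.norm_real]
    gcongr
    exact hC ξ
  · exact volume_ac.ae_le (hm w).coeFn_toLp

end Oseen

namespace Oseen

open scoped InnerProductSpace ComplexConjugate ENNReal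

/-! ### The kernel of the nonlocal operator -/

/-- The kernel `ξ · K(ξ - η)`, which is antisymmetric. -/
def radialKernel (ξ η : Plane) : ℝ := (2 * Real.pi)⁻¹ * (‖ξ - η‖ ^ 2)⁻¹ * ⟪perp ξ, η⟫_ℝ

theorem inner_perp (ξ η : Plane) : ⟪perp ξ, η⟫_ℝ = ξ 0 * η 1 - ξ 1 * η 0 := by
  simp [PiLp.inner_apply, Fin.sum_univ_two, perp]
  ring

/-- Because `ξ^⊥ · ξ = 0`, the numerator `(ξ - η)^⊥ · ξ` reduces to `ξ^⊥ · η`, an alternating form.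
All the antisymmetry of the nonlocal operator comes from this. -/
theorem sum_coord_mul_biotSavartKernel (ξ η : Plane) :
    ∑ i, ξ i * biotSavartKernel (ξ - η) i = radialKernel ξ η := by
  rw [radialKernel, inner_perp]
  simp only [biotSavartKernel, Fin.sum_univ_two, PiLp.smul_apply, smul_eq_mul, perp]
  simp
  ring

theorem radialKernel_antisymm (ξ η : Plane) : radialKernel η ξ = -radialKernel ξ η := by
  simp only [radialKernel, inner_perp, norm_sub_rev η ξ]
  ring

theorem measurable_radialKernel : Measurable fun p : Plane × Plane => radialKernel p.1 p.2 := by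
  simp only [← sum_coord_mul_biotSavartKernel, Fin.sum_univ_two]
  have h : ∀ i, Measurable fun p : Plane × Plane => biotSavartKernel (p.1 - p.2) i := fun i =>
    (measurable_biotSavartKernel i).comp (measurable_fst.sub measurable_snd)
  have h' : ∀ i : Fin 2, Measurable fun p : Plane × Plane => p.1 i := fun i =>
    Continuous.measurable (by fun_prop)
  exact ((h' 0).mul (h 0)).add ((h' 1).mul (h 1))

theorem abs_radialKernel_le (ξ η : Plane) : |radialKernel ξ η| ≤ 2 * ‖ξ‖ * ‖ξ - η‖⁻¹ := by
  rw [← sum_coord_mul_biotSavartKernel]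
  refine (Finset.abs_sum_le_sum_abs _ _).trans ?_
  have h : ∀ i, |ξ i * biotSavartKernel (ξ - η) i| ≤ ‖ξ‖ * ‖ξ - η‖⁻¹ := fun i => by
    rw [abs_mul]
    gcongr
    · simpa using PiLp.norm_apply_le ξ i
    · exact norm_biotSavartKernel_le _ i
  rw [Fin.sum_univ_two]
  linarith [h 0, h 1]

theorem nonlocalTerm_eq (w : X) : ∀ᵐ ξ, nonlocalTerm w ξ =
    -(gaussian ξ / 2 : ℝ) * ∫ η, (radialKernel ξ η : ℂ) * w η := by
  filter_upwards [ae_integrable_biotSavart w 0, ae_integrable_biotSavart w 1] with ξ h0 h1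
  have e : ∀ η, (radialKernel ξ η : ℂ) * w η = (ξ 0 : ℂ) * ((biotSavartKernel (ξ - η) 0 : ℂ) * w η) +
      (ξ 1 : ℂ) * ((biotSavartKernel (ξ - η) 1 : ℂ) * w η) := fun η => by
    rw [← sum_coord_mul_biotSavartKernel, Fin.sum_univ_two]
    push_cast
    ring
  simp only [e]
  rw [integral_add (h0.const_mul _) (h1.const_mul _), integral_const_mul, integral_const_mul]
  simp only [nonlocalTerm, Fin.sum_univ_two, velocity, gradient_gaussian, PiLp.smul_apply,
    smul_eq_mul]
  push_cast
  ring

theorem integrable_radialKernel_mul (w : X) :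
    ∀ᵐ ξ, Integrable fun η => (radialKernel ξ η : ℂ) * w η := by
  filter_upwards [ae_integrable_biotSavart w 0, ae_integrable_biotSavart w 1] with ξ h0 h1
  refine ((h0.const_mul (ξ 0 : ℂ)).add (h1.const_mul (ξ 1 : ℂ))).congr
    (Filter.Eventually.of_forall fun η => ?_)
  simp only [Pi.add_apply]
  rw [← sum_coord_mul_biotSavartKernel, Fin.sum_univ_two]
  push_cast
  ring

/-! ### Boundedness of the nonlocal operator -/

/-- The kernel `|x|⁻¹` as an extended nonnegative function. -/
def invNorm (x : Plane) : ℝ≥0∞ := ENNReal.ofReal ‖x‖⁻¹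

theorem measurable_invNorm : Measurable invNorm :=
  ENNReal.measurable_ofReal.comp measurable_norm.inv

/-- Split `‖x‖⁻¹` at `‖x‖ = 1`: the inner part is integrable in the plane and is paired with the
upper bound of `g`, while the outer part is at most `1` and is paired with the integral of `g`. -/
theorem lintegral_invNorm_mul_le {g : Plane → ℝ} (hg : Integrable g) {M : ℝ}
    (hM : ∀ ξ, g ξ ≤ M) :
    ∃ C : ℝ≥0∞, C ≠ ⊤ ∧ ∀ ξ, ∫⁻ η, invNorm (ξ - η) * ENNReal.ofReal (g η) ≤ C := by
  set nr : Plane → ℝ := fun x => (Iio (1 : ℝ)).indicator (fun r => r⁻¹) ‖x‖ with hnr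
  have mnr : Measurable fun x => ENNReal.ofReal (nr x) := by
    refine ENNReal.measurable_ofReal.comp ?_
    exact ((measurable_inv).indicator measurableSet_Iio).comp measurable_norm
  have h1 : ∫⁻ x, ENNReal.ofReal (nr x) ≠ ⊤ := by
    refine ne_of_lt ?_
    have := integrable_near.lintegral_lt_top
    exact this
  have h2 : ∫⁻ x, ENNReal.ofReal (g x) ≠ ⊤ := ne_of_lt hg.lintegral_lt_top
  refine ⟨(∫⁻ x, ENNReal.ofReal (nr x)) * ENNReal.ofReal M + ∫⁻ x, ENNReal.ofReal (g x),
    ENNReal.add_ne_top.2 ⟨ENNReal.mul_ne_top h1 ENNReal.ofReal_ne_top, h2⟩, fun ξ => ?_⟩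
  have hb : ∀ x : Plane, ‖x‖⁻¹ ≤ nr x + 1 := fun x => by
    by_cases hx : ‖x‖ < 1
    · simp [hnr, hx]
    · have : ‖x‖⁻¹ ≤ 1 := inv_le_one_of_one_le₀ (not_lt.1 hx)
      simpa [hnr, hx] using this
  have hnr0 : ∀ x : Plane, 0 ≤ nr x := fun x =>
    by
      by_cases hx : ‖x‖ < 1 <;> simp [hnr, hx]
  calc ∫⁻ η, invNorm (ξ - η) * ENNReal.ofReal (g η)
      ≤ ∫⁻ η, (ENNReal.ofReal (nr (ξ - η)) * ENNReal.ofReal M + ENNReal.ofReal (g η)) := by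
        refine lintegral_mono fun η => ?_
        have a1 : invNorm (ξ - η) ≤ ENNReal.ofReal (nr (ξ - η)) + 1 := by
          rw [← ENNReal.ofReal_one, ← ENNReal.ofReal_add (hnr0 _) zero_le_one]
          exact ENNReal.ofReal_le_ofReal (hb _)
        calc _ ≤ (ENNReal.ofReal (nr (ξ - η)) + 1) * ENNReal.ofReal (g η) := by gcongr
          _ = ENNReal.ofReal (nr (ξ - η)) * ENNReal.ofReal (g η) + ENNReal.ofReal (g η) := by ring
          _ ≤ _ := by gcongr; exact hM η
    _ = _ := by
        rw [lintegral_add_left, lintegral_mul_const]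
        · rw [lintegral_sub_left_eq_self (fun x => ENNReal.ofReal (nr x)) ξ]
        · exact mnr.comp (measurable_const.sub measurable_id)
        · exact (mnr.comp (measurable_const.sub measurable_id)).mul_const _

theorem sq_lintegral_mul_le {α : Type*} [MeasurableSpace α] {μ : Measure α} {f g : α → ℝ≥0∞}
    (hf : AEMeasurable f μ) (hg : AEMeasurable g μ) :
    (∫⁻ x, f x * g x ∂μ) ^ 2 ≤ (∫⁻ x, f x ^ 2 ∂μ) * ∫⁻ x, g x ^ 2 ∂μ := by
  have h := ENNReal.lintegral_mul_le_Lp_mul_Lq μ Real.HolderConjugate.two_two hf hg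
  have h2 := pow_le_pow_left' h 2
  rw [mul_pow, ← ENNReal.rpow_mul_natCast, ← ENNReal.rpow_mul_natCast] at h2
  simpa using h2

/-- Schur's test for the kernel `|ξ - η|⁻¹` in weighted spaces. -/
theorem exists_schur_bound : ∃ C : ℝ≥0∞, C ≠ ⊤ ∧ ∀ u : Plane → ℝ≥0∞, AEMeasurable u volume →
    ∫⁻ ξ, ENNReal.ofReal (‖ξ‖ ^ 2 * gaussian ξ) * (∫⁻ η, invNorm (ξ - η) * u η) ^ 2 ≤
      C * ∫⁻ η, ENNReal.ofReal (gaussian η)⁻¹ * u η ^ 2 := by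
  have hG := gaussian_pos
  have hG1 : ∀ ξ, gaussian ξ ≤ 1 := fun ξ => by
    unfold gaussian
    have h1 : (4 * Real.pi)⁻¹ ≤ 1 := inv_le_one_of_one_le₀ (by linarith [Real.pi_gt_three])
    have h2 : Real.exp (-‖ξ‖ ^ 2 / 4) ≤ 1 := Real.exp_le_one_iff.2 (by nlinarith [sq_nonneg ‖ξ‖])
    exact mul_le_one₀ h1 (Real.exp_pos _).le h2
  obtain ⟨A, hA, hA'⟩ := lintegral_invNorm_mul_le integrable_gaussian hG1
  have hI : Integrable fun ξ : Plane => ‖ξ‖ ^ 2 * gaussian ξ :=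
    (Function.hasTemperateGrowth_norm_sq Plane).integrable_mul_gaussian
  have hM : ∀ ξ : Plane, ‖ξ‖ ^ 2 * gaussian ξ ≤ 4 := fun ξ => by
    unfold gaussian
    have h1 : (4 * Real.pi)⁻¹ ≤ 1 := inv_le_one_of_one_le₀ (by linarith [Real.pi_gt_three])
    have h0 : 0 ≤ (4 * Real.pi)⁻¹ := by positivity
    have h2 := Real.add_one_le_exp (‖ξ‖ ^ 2 / 4)
    have h3 : Real.exp (‖ξ‖ ^ 2 / 4) * Real.exp (-‖ξ‖ ^ 2 / 4) = 1 := by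
      rw [← Real.exp_add]; simp; ring
    have h4 := Real.exp_pos (-‖ξ‖ ^ 2 / 4)
    have h5 : ‖ξ‖ ^ 2 * Real.exp (-‖ξ‖ ^ 2 / 4) ≤ 4 := by nlinarith
    have h6 : 0 ≤ ‖ξ‖ ^ 2 * Real.exp (-‖ξ‖ ^ 2 / 4) := by positivity
    nlinarith
  obtain ⟨B, hB, hB'⟩ := lintegral_invNorm_mul_le hI hM
  refine ⟨A * B, ENNReal.mul_ne_top hA hB, fun u hu => ?_⟩
  have mG : Measurable gaussian := continuous_gaussian.measurable
  have mk : Measurable fun p : Plane × Plane => invNorm (p.1 - p.2) :=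
    measurable_invNorm.comp (measurable_fst.sub measurable_snd)
  -- Cauchy-Schwarz after writing `k u = (k G)^(1/2) · (k G⁻¹)^(1/2) u` with `k = ‖ξ - η‖⁻¹`; the
  -- first factor is controlled uniformly in `ξ` by `A`.
  have key : ∀ ξ, (∫⁻ η, invNorm (ξ - η) * u η) ^ 2 ≤
      A * ∫⁻ η, invNorm (ξ - η) * (ENNReal.ofReal (gaussian η)⁻¹ * u η ^ 2) := by
    intro ξ
    have mξ : Measurable fun η : Plane => ‖ξ - η‖⁻¹ := by fun_prop
    have h := sq_lintegral_mul_le (μ := volume)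
      (f := fun η => ENNReal.ofReal (Real.sqrt (‖ξ - η‖⁻¹ * gaussian η)))
      (g := fun η => ENNReal.ofReal (Real.sqrt (‖ξ - η‖⁻¹ * (gaussian η)⁻¹)) * u η)
      (ENNReal.measurable_ofReal.comp (mξ.mul mG).sqrt).aemeasurable
      ((ENNReal.measurable_ofReal.comp (mξ.mul mG.inv).sqrt).aemeasurable.mul hu)
    have e1 : ∀ η, ENNReal.ofReal (Real.sqrt (‖ξ - η‖⁻¹ * gaussian η)) *
        (ENNReal.ofReal (Real.sqrt (‖ξ - η‖⁻¹ * (gaussian η)⁻¹)) * u η) = invNorm (ξ - η) * u η := by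
      intro η
      have := hG η
      rw [← mul_assoc, ← ENNReal.ofReal_mul (Real.sqrt_nonneg _), ← Real.sqrt_mul (by positivity)]
      congr 2
      rw [show ‖ξ - η‖⁻¹ * gaussian η * (‖ξ - η‖⁻¹ * (gaussian η)⁻¹) = ‖ξ - η‖⁻¹ * ‖ξ - η‖⁻¹ by
        field_simp]
      exact Real.sqrt_mul_self (by positivity)
    have e2 : ∀ η, ENNReal.ofReal (Real.sqrt (‖ξ - η‖⁻¹ * gaussian η)) ^ 2 =
        invNorm (ξ - η) * ENNReal.ofReal (gaussian η) := by
      intro η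
      have := hG η
      rw [← ENNReal.ofReal_pow (Real.sqrt_nonneg _), Real.sq_sqrt (by positivity),
        ENNReal.ofReal_mul (by positivity)]
      rfl
    have e3 : ∀ η, (ENNReal.ofReal (Real.sqrt (‖ξ - η‖⁻¹ * (gaussian η)⁻¹)) * u η) ^ 2 =
        invNorm (ξ - η) * (ENNReal.ofReal (gaussian η)⁻¹ * u η ^ 2) := by
      intro η
      have := hG η
      rw [mul_pow, ← ENNReal.ofReal_pow (Real.sqrt_nonneg _), Real.sq_sqrt (by positivity),
        ENNReal.ofReal_mul (by positivity), mul_assoc]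
      rfl
    simp only [e1, e2, e3] at h
    exact h.trans (by gcongr; exact hA' ξ)
  calc ∫⁻ ξ, ENNReal.ofReal (‖ξ‖ ^ 2 * gaussian ξ) * (∫⁻ η, invNorm (ξ - η) * u η) ^ 2
      ≤ ∫⁻ ξ, ENNReal.ofReal (‖ξ‖ ^ 2 * gaussian ξ) *
          (A * ∫⁻ η, invNorm (ξ - η) * (ENNReal.ofReal (gaussian η)⁻¹ * u η ^ 2)) :=
        lintegral_mono fun ξ => by gcongr; exact key ξ
    _ = A * ∫⁻ ξ, ∫⁻ η, ENNReal.ofReal (‖ξ‖ ^ 2 * gaussian ξ) * (invNorm (ξ - η) *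
          (ENNReal.ofReal (gaussian η)⁻¹ * u η ^ 2)) := by
        rw [← lintegral_const_mul' _ _ hA]
        refine lintegral_congr fun ξ => ?_
        rw [lintegral_const_mul' _ _ ENNReal.ofReal_ne_top]
        ring
    -- After Tonelli the integral in `ξ` meets only `‖ξ‖² G(ξ)`, which is integrable and bounded,
    -- and is controlled uniformly in `η` by `B`.
    _ = A * ∫⁻ η, ∫⁻ ξ, ENNReal.ofReal (‖ξ‖ ^ 2 * gaussian ξ) * (invNorm (ξ - η) *
          (ENNReal.ofReal (gaussian η)⁻¹ * u η ^ 2)) := by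
        congr 1
        refine lintegral_lintegral_swap ?_
        have m1 : Measurable fun p : Plane × Plane => ENNReal.ofReal (‖p.1‖ ^ 2 * gaussian p.1) :=
          ENNReal.measurable_ofReal.comp
            ((measurable_fst.norm.pow_const 2).mul (mG.comp measurable_fst))
        have m2 : AEMeasurable (fun p : Plane × Plane => ENNReal.ofReal (gaussian p.2)⁻¹ * u p.2 ^ 2)
            (volume.prod volume) :=
          (ENNReal.measurable_ofReal.comp (mG.comp measurable_snd).inv).aemeasurable.mul
            ((hu.comp_snd).pow_const 2)
        exact m1.aemeasurable.mul (mk.aemeasurable.mul m2)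
    _ ≤ A * ∫⁻ η, B * (ENNReal.ofReal (gaussian η)⁻¹ * u η ^ 2) := by
        gcongr with η
        have h := hB' η
        calc ∫⁻ ξ, ENNReal.ofReal (‖ξ‖ ^ 2 * gaussian ξ) * (invNorm (ξ - η) *
              (ENNReal.ofReal (gaussian η)⁻¹ * u η ^ 2))
            = (∫⁻ ξ, invNorm (η - ξ) * ENNReal.ofReal (‖ξ‖ ^ 2 * gaussian ξ)) *
              (ENNReal.ofReal (gaussian η)⁻¹ * u η ^ 2) := by
              rw [← lintegral_mul_const]
              · refine lintegral_congr fun ξ => ?_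
                have : invNorm (ξ - η) = invNorm (η - ξ) := by
                  unfold invNorm; rw [norm_sub_rev]
                rw [this]
                ring
              · exact (measurable_invNorm.comp (measurable_const.sub measurable_id)).mul
                  (ENNReal.measurable_ofReal.comp ((measurable_norm.pow_const 2).mul mG))
          _ ≤ _ := by gcongr
    _ = _ := by
        rw [lintegral_const_mul' _ _ hB, mul_assoc]

theorem lintegral_weighted {f : Plane → ℝ≥0∞} (hf : AEMeasurable f volume) :
    ∫⁻ ξ, f ξ ∂weightedMeasure = ∫⁻ ξ, ENNReal.ofReal (gaussian ξ)⁻¹ * f ξ := by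
  have hG : AEMeasurable (fun ξ => ENNReal.ofReal (gaussian ξ)⁻¹) volume :=
    (ENNReal.measurable_ofReal.comp continuous_gaussian.measurable.inv).aemeasurable
  unfold weightedMeasure
  rw [lintegral_withDensity_eq_lintegral_mul₀ hG hf]
  rfl

theorem lintegral_sq_X (w : X) :
    ∫⁻ η, ENNReal.ofReal (gaussian η)⁻¹ * ‖w η‖ₑ ^ 2 = ‖w‖ₑ ^ 2 := by
  rw [← lintegral_weighted ((integrable_X w).aestronglyMeasurable.enorm.pow_const 2), Lp.enorm_def,
    eLpNorm_eq_lintegral_rpow_enorm_toReal (by norm_num) (by norm_num), ← ENNReal.rpow_mul_natCast]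
  simp

theorem enorm_nonlocalTerm_le (w : X) (ξ : Plane) :
    ‖nonlocalTerm w ξ‖ₑ ≤ ENNReal.ofReal (‖ξ‖ * gaussian ξ) * ∫⁻ η, invNorm (ξ - η) * ‖w η‖ₑ := by
  have h0 := gaussian_pos ξ
  have hv : ∀ i, ‖velocity w i ξ‖ₑ ≤ ∫⁻ η, invNorm (ξ - η) * ‖w η‖ₑ := fun i => by
    refine (enorm_integral_le_lintegral_enorm _).trans (lintegral_mono fun η => ?_)
    rw [enorm_mul]
    gcongr
    rw [← ofReal_norm, Complex.norm_real]
    exact ENNReal.ofReal_le_ofReal (norm_biotSavartKernel_le _ i)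
  have hg : ∀ i, ‖((gradient gaussian ξ i : ℝ) : ℂ)‖ₑ ≤ ENNReal.ofReal (‖ξ‖ * gaussian ξ / 2) := by
    intro i
    rw [← ofReal_norm, Complex.norm_real, gradient_gaussian]
    refine ENNReal.ofReal_le_ofReal ?_
    rw [PiLp.smul_apply, smul_eq_mul, norm_mul, norm_neg, Real.norm_of_nonneg (by positivity)]
    have := PiLp.norm_apply_le ξ i
    nlinarith
  rw [nonlocalTerm, Fin.sum_univ_two]
  refine (enorm_add_le _ _).trans ?_
  rw [enorm_mul, enorm_mul]
  calc _ ≤ (∫⁻ η, invNorm (ξ - η) * ‖w η‖ₑ) * ENNReal.ofReal (‖ξ‖ * gaussian ξ / 2) +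
        (∫⁻ η, invNorm (ξ - η) * ‖w η‖ₑ) * ENNReal.ofReal (‖ξ‖ * gaussian ξ / 2) := by
        gcongr
        · exact hv 0
        · exact hg 0
        · exact hv 1
        · exact hg 1
    _ = _ := by
        rw [← mul_add, ← ENNReal.ofReal_add (by positivity) (by positivity), add_halves, mul_comm]

theorem aestronglyMeasurable_nonlocalTerm (w : X) :
    AEStronglyMeasurable (nonlocalTerm w) volume := by
  have h : ∀ i, AEStronglyMeasurable (velocity w i) volume := fun i => by
    have m : AEStronglyMeasurable (fun p : Plane × Plane =>
        (biotSavartKernel (p.1 - p.2) i : ℂ) * w p.2) (volume.prod volume) :=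
      (Complex.measurable_ofReal.comp ((measurable_biotSavartKernel i).comp
        (measurable_fst.sub measurable_snd))).aestronglyMeasurable.mul
        (integrable_X w).aestronglyMeasurable.comp_snd
    exact m.integral_prod_right'
  have hg : ∀ i, AEStronglyMeasurable (fun ξ => ((gradient gaussian ξ i : ℝ) : ℂ)) volume :=
    fun i => by
      simp only [gradient_gaussian, PiLp.smul_apply]
      have := continuous_gaussian
      exact Continuous.aestronglyMeasurable (by fun_prop)
  have e : nonlocalTerm w = fun ξ => velocity w 0 ξ * ((gradient gaussian ξ 0 : ℝ) : ℂ) +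
      velocity w 1 ξ * ((gradient gaussian ξ 1 : ℝ) : ℂ) := by
    funext ξ
    rw [nonlocalTerm, Fin.sum_univ_two]
  rw [e]
  exact ((h 0).mul (hg 0)).add ((h 1).mul (hg 1))

/-- The bound `|∇G| ≤ ‖ξ‖ G / 2` turns the weight `G⁻¹` into `‖ξ‖² G`, exactly the weight in Schur's
test. The nonlocal part of `Λ` is therefore bounded and defined on all of `X`. -/
theorem exists_nonlocal_clm : ∃ N : X →L[ℂ] X, ∀ w, (w, N w) ∈ nonlocalGraph := by
  obtain ⟨C, hC, h⟩ := exists_schur_bound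
  have hm := aestronglyMeasurable_nonlocalTerm
  have hsq : ∀ w : X, ∫⁻ ξ, ‖nonlocalTerm w ξ‖ₑ ^ 2 ∂weightedMeasure ≤ C * ‖w‖ₑ ^ 2 := by
    intro w
    rw [lintegral_weighted ((hm w).enorm.pow_const 2), ← lintegral_sq_X]
    refine le_trans (lintegral_mono fun ξ => ?_) (h _ (integrable_X w).aestronglyMeasurable.enorm)
    have h0 := gaussian_pos ξ
    calc _ ≤ ENNReal.ofReal (gaussian ξ)⁻¹ * (ENNReal.ofReal (‖ξ‖ * gaussian ξ) *
          ∫⁻ η, invNorm (ξ - η) * ‖w η‖ₑ) ^ 2 := by gcongr; exact enorm_nonlocalTerm_le w ξ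
      _ = _ := by
        rw [mul_pow, ← ENNReal.ofReal_pow (by positivity), ← mul_assoc,
          ← ENNReal.ofReal_mul (by positivity)]
        congr 2
        field_simp
  have hn : ∀ w : X, eLpNorm (nonlocalTerm w) 2 weightedMeasure ≤ C ^ (1 / 2 : ℝ) * ‖w‖ₑ := by
    intro w
    rw [eLpNorm_eq_lintegral_rpow_enorm_toReal (by norm_num) (by norm_num)]
    have := ENNReal.rpow_le_rpow (hsq w) (by norm_num : (0 : ℝ) ≤ 1 / 2)
    rw [ENNReal.mul_rpow_of_nonneg _ _ (by norm_num), ← ENNReal.rpow_natCast_mul] at this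
    simpa using this
  have hC' : C ^ (1 / 2 : ℝ) ≠ ⊤ := ENNReal.rpow_ne_top_of_nonneg (by norm_num) hC
  have hL : ∀ w : X, MemLp (nonlocalTerm w) 2 weightedMeasure := fun w =>
    ⟨(hm w).mono_ac ac_volume, (hn w).trans_lt (ENNReal.mul_lt_top hC'.lt_top (by simp))⟩
  let L : X →ₗ[ℂ] X :=
    { toFun := fun w => (hL w).toLp _
      map_add' := fun u v => by
        rw [← MemLp.toLp_add, MemLp.toLp_eq_toLp_iff]
        exact ac_volume.ae_le (nonlocalTerm_add u v)
      map_smul' := fun c u => by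
        rw [RingHom.id_apply, ← MemLp.toLp_const_smul, MemLp.toLp_eq_toLp_iff]
        exact Filter.Eventually.of_forall fun ξ => nonlocalTerm_smul c u ξ }
  refine ⟨L.mkContinuous (C ^ (1 / 2 : ℝ)).toReal fun w => ?_, fun w => ?_⟩
  · change ‖(hL w).toLp _‖ ≤ _
    rw [Lp.norm_toLp]
    have := ENNReal.toReal_mono (ENNReal.mul_ne_top hC' (by simp)) (hn w)
    rwa [ENNReal.toReal_mul, toReal_enorm] at this
  · exact volume_ac.ae_le (hL w).coeFn_toLp

/-! ### Skew-adjointness of the nonlocal operator -/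

/-- Justifies Fubini in the proof of skew-symmetry. Writing `‖ξ‖ = G^(-1/2) · (‖ξ‖² G)^(1/2)`,
Cauchy-Schwarz in `ξ` leaves the norm of `u` and the quantity bounded by Schur's test for `w`. -/
theorem integrable_radialKernel_prod (u w : X) :
    Integrable (fun p : Plane × Plane => -(1 / 2 : ℂ) * conj (u p.1) *
      ((radialKernel p.1 p.2 : ℂ) * w p.2)) (volume.prod volume) := by
  obtain ⟨C, hC, h⟩ := exists_schur_bound
  have mu := (integrable_X u).aestronglyMeasurable
  have mw := (integrable_X w).aestronglyMeasurable
  have m : AEStronglyMeasurable (fun p : Plane × Plane => -(1 / 2 : ℂ) * conj (u p.1) *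
      ((radialKernel p.1 p.2 : ℂ) * w p.2)) (volume.prod volume) :=
    (aestronglyMeasurable_const.mul
      (Complex.continuous_conj.comp_aestronglyMeasurable mu.comp_fst)).mul
      ((Complex.measurable_ofReal.comp measurable_radialKernel).aestronglyMeasurable.mul
        mw.comp_snd)
  refine ⟨m, ?_⟩
  rw [hasFiniteIntegral_iff_enorm, lintegral_prod _ m.enorm]
  have mG : Measurable gaussian := continuous_gaussian.measurable
  have mI : AEMeasurable (fun ξ => ∫⁻ η, invNorm (ξ - η) * ‖w η‖ₑ) volume := by
    refine AEMeasurable.lintegral_prod_right'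
      (f := fun p : Plane × Plane => invNorm (p.1 - p.2) * ‖w p.2‖ₑ) ?_
    exact (measurable_invNorm.comp (measurable_fst.sub measurable_snd)).aemeasurable.mul
      mw.enorm.comp_snd
  have b1 : ∀ ξ, ∫⁻ η, ‖-(1 / 2 : ℂ) * conj (u ξ) * ((radialKernel ξ η : ℂ) * w η)‖ₑ ≤
      (ENNReal.ofReal (Real.sqrt (gaussian ξ)⁻¹) * ‖u ξ‖ₑ) *
        (ENNReal.ofReal (Real.sqrt (‖ξ‖ ^ 2 * gaussian ξ)) *
          ∫⁻ η, invNorm (ξ - η) * ‖w η‖ₑ) := by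
    intro ξ
    have h0 := gaussian_pos ξ
    have e1 : ENNReal.ofReal (Real.sqrt (gaussian ξ)⁻¹) *
        ENNReal.ofReal (Real.sqrt (‖ξ‖ ^ 2 * gaussian ξ)) = ENNReal.ofReal ‖ξ‖ := by
      rw [← ENNReal.ofReal_mul (Real.sqrt_nonneg _), ← Real.sqrt_mul (by positivity)]
      congr 1
      rw [show (gaussian ξ)⁻¹ * (‖ξ‖ ^ 2 * gaussian ξ) = ‖ξ‖ ^ 2 by field_simp]
      exact Real.sqrt_sq (norm_nonneg _)
    rw [show ∀ a b c d : ℝ≥0∞, a * b * (c * d) = (a * c) * (b * d) by intros; ring, e1,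
      ← mul_assoc, ← lintegral_const_mul' _ _ (ENNReal.mul_ne_top ENNReal.ofReal_ne_top (by simp))]
    refine lintegral_mono fun η => ?_
    rw [enorm_mul, enorm_mul, enorm_mul]
    have e2 : ‖(radialKernel ξ η : ℂ)‖ₑ ≤ 2 * (ENNReal.ofReal ‖ξ‖ * invNorm (ξ - η)) := by
      rw [← ofReal_norm, Complex.norm_real]
      refine (ENNReal.ofReal_le_ofReal (abs_radialKernel_le ξ η)).trans_eq ?_
      rw [ENNReal.ofReal_mul (by positivity), ENNReal.ofReal_mul zero_le_two,
        ENNReal.ofReal_ofNat, mul_assoc, invNorm]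
    have e3 : ‖-(1 / 2 : ℂ)‖ₑ * 2 = 1 := by
      rw [← ofReal_norm, ← ENNReal.ofReal_ofNat, ← ENNReal.ofReal_mul (norm_nonneg _)]
      simp
    have e4 : ‖conj (u ξ)‖ₑ = ‖u ξ‖ₑ := by
      rw [← ofReal_norm, RCLike.norm_conj, ofReal_norm]
    calc _ ≤ ‖-(1 / 2 : ℂ)‖ₑ * ‖conj (u ξ)‖ₑ *
          (2 * (ENNReal.ofReal ‖ξ‖ * invNorm (ξ - η)) * ‖w η‖ₑ) := by gcongr
      _ = (‖-(1 / 2 : ℂ)‖ₑ * 2) *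
          (ENNReal.ofReal ‖ξ‖ * ‖u ξ‖ₑ * (invNorm (ξ - η) * ‖w η‖ₑ)) := by rw [e4]; ring
      _ = _ := by rw [e3, one_mul]
  refine (lintegral_mono b1).trans_lt ?_
  have mm : Measurable fun ξ : Plane => Real.sqrt (‖ξ‖ ^ 2 * gaussian ξ) :=
    ((measurable_norm.pow_const 2).mul mG).sqrt
  have hcs := sq_lintegral_mul_le (μ := volume)
    (f := fun ξ => ENNReal.ofReal (Real.sqrt (gaussian ξ)⁻¹) * ‖u ξ‖ₑ)
    (g := fun ξ => ENNReal.ofReal (Real.sqrt (‖ξ‖ ^ 2 * gaussian ξ)) *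
          ∫⁻ η, invNorm (ξ - η) * ‖w η‖ₑ)
    ((ENNReal.measurable_ofReal.comp mG.inv.sqrt).aemeasurable.mul mu.enorm)
    ((ENNReal.measurable_ofReal.comp mm).aemeasurable.mul mI)
  have a1 : ∀ ξ, (ENNReal.ofReal (Real.sqrt (gaussian ξ)⁻¹) * ‖u ξ‖ₑ) ^ 2 =
      ENNReal.ofReal (gaussian ξ)⁻¹ * ‖u ξ‖ₑ ^ 2 := fun ξ => by
    have h0 := gaussian_pos ξ
    rw [mul_pow, ← ENNReal.ofReal_pow (Real.sqrt_nonneg _), Real.sq_sqrt (by positivity)]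
  have a2 : ∀ ξ, (ENNReal.ofReal (Real.sqrt (‖ξ‖ ^ 2 * gaussian ξ)) *
      ∫⁻ η, invNorm (ξ - η) * ‖w η‖ₑ) ^ 2 =
      ENNReal.ofReal (‖ξ‖ ^ 2 * gaussian ξ) * (∫⁻ η, invNorm (ξ - η) * ‖w η‖ₑ) ^ 2 := fun ξ => by
    have h0 := gaussian_pos ξ
    rw [mul_pow, ← ENNReal.ofReal_pow (Real.sqrt_nonneg _), Real.sq_sqrt (by positivity)]
  simp only [a1, a2] at hcs
  have h2 := h _ mw.enorm
  rw [lintegral_sq_X] at hcs h2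
  have h3 := hcs.trans (mul_le_mul_right h2 _)
  have h4 : ‖u‖ₑ ^ 2 * (C * ‖w‖ₑ ^ 2) < ⊤ :=
    ENNReal.mul_lt_top (by simp) (ENNReal.mul_lt_top hC.lt_top (by simp))
  exact (ENNReal.pow_lt_top_iff.1 (h3.trans_lt h4)).resolve_right (by norm_num)

theorem inner_eq_integral_radialKernel {u w f : X} (h : (w, f) ∈ nonlocalGraph) :
    ⟪u, f⟫_ℂ = ∫ ξ, ∫ η, -(1 / 2 : ℂ) * conj (u ξ) * ((radialKernel ξ η : ℂ) * w η) := by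
  rw [inner_X]
  refine integral_congr_ae ?_
  filter_upwards [h, nonlocalTerm_eq w] with ξ h1 h2
  have : (gaussian ξ : ℂ) ≠ 0 := by exact_mod_cast (gaussian_pos ξ).ne'
  rw [integral_const_mul]
  change f ξ = nonlocalTerm w ξ at h1
  rw [h1, h2]
  push_cast
  field_simp

/-- In `⟨u, f⟩` the weight cancels the factor `G` of `∇G`, leaving a double integral of `conj u(ξ)`
and `w(η)` against the real antisymmetric kernel; exchanging the variables gives the sign. -/
theorem inner_nonlocal_skew {u w f g : X} (hw : (w, f) ∈ nonlocalGraph)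
    (hu : (u, g) ∈ nonlocalGraph) : ⟪u, f⟫_ℂ = -⟪g, w⟫_ℂ := by
  rw [← inner_conj_symm g w, inner_eq_integral_radialKernel hw, inner_eq_integral_radialKernel hu]
  rw [integral_integral_swap (integrable_radialKernel_prod u w), ← integral_conj, ← integral_neg]
  refine integral_congr_ae (Filter.Eventually.of_forall fun ξ => ?_)
  simp only
  rw [← integral_conj, ← integral_neg]
  refine integral_congr_ae (Filter.Eventually.of_forall fun η => ?_)
  simp only [map_mul, map_neg, Complex.conj_conj, Complex.conj_ofReal, radialKernel_antisymm ξ η,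
    map_div₀, map_one, map_ofNat]
  push_cast
  ring

/-! ### The nonlocal operator on the first Hermite functions -/

/-- Convolution of two Gaussians. It serves to evaluate Biot-Savart integrals through `‖x‖⁻² = ∫₀^∞
exp (-s ‖x‖²) ds`. -/
theorem integral_exp_mul_gaussian {s : ℝ} (hs : 0 < s) (ξ : Plane) :
    ∫ η, Real.exp (-s * ‖ξ - η‖ ^ 2) * gaussian η =
      (4 * s + 1)⁻¹ * Real.exp (-‖ξ‖ ^ 2 * (s / (4 * s + 1))) := by
  have hb : 0 < s + 1 / 4 := by positivity
  have h := GaussianFourier.integral_cexp_neg_mul_sq_norm_add (V := Plane)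
    (b := ((s + 1 / 4 : ℝ) : ℂ)) (by simpa using hb) ((2 * s : ℝ) : ℂ) ξ
  have e : ∀ η : Plane, ((Real.exp (-s * ‖ξ - η‖ ^ 2) * gaussian η : ℝ) : ℂ) =
      (((4 * Real.pi)⁻¹ * Real.exp (-s * ‖ξ‖ ^ 2) : ℝ) : ℂ) *
        Complex.exp (-((s + 1 / 4 : ℝ) : ℂ) * ‖η‖ ^ 2 + ((2 * s : ℝ) : ℂ) * ⟪ξ, η⟫_ℝ) := by
    intro η
    have : Real.exp (-s * ‖ξ - η‖ ^ 2) * gaussian η = ((4 * Real.pi)⁻¹ * Real.exp (-s * ‖ξ‖ ^ 2)) *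
        Real.exp (-(s + 1 / 4) * ‖η‖ ^ 2 + (2 * s) * ⟪ξ, η⟫_ℝ) := by
      rw [gaussian, @norm_sub_sq_real, mul_left_comm, ← Real.exp_add, mul_assoc, ← Real.exp_add]
      ring_nf
    rw [this]
    push_cast
    ring_nf
  have h2 : ((∫ η, Real.exp (-s * ‖ξ - η‖ ^ 2) * gaussian η : ℝ) : ℂ) =
      (((4 * s + 1)⁻¹ * Real.exp (-‖ξ‖ ^ 2 * (s / (4 * s + 1))) : ℝ) : ℂ) := by
    rw [← integral_complex_ofReal]
    simp only [e]
    rw [integral_const_mul, h]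
    have e2 : ((Module.finrank ℝ Plane : ℂ) / 2) = 1 := by simp
    rw [e2, Complex.cpow_one]
    have e3 : Real.exp (-‖ξ‖ ^ 2 * (s / (4 * s + 1))) = Real.exp (-s * ‖ξ‖ ^ 2) *
        Real.exp ((2 * s) ^ 2 * ‖ξ‖ ^ 2 / (4 * (s + 1 / 4))) := by
      rw [← Real.exp_add]
      congr 1
      field_simp
      ring
    rw [e3]
    have e4 : (4 * s + 1)⁻¹ = (4 * Real.pi)⁻¹ * (Real.pi / (s + 1 / 4)) := by
      have := Real.pi_ne_zero
      field_simp
    rw [e4]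
    push_cast
    ring
  exact_mod_cast h2

theorem inner_perp_self (ξ : Plane) : ⟪ξ, perp ξ⟫_ℝ = 0 := by
  rw [real_inner_comm, inner_perp]; ring

/-- Since `ξ · ξ^⊥ = 0`, differentiating `exp (-s ‖ξ - η‖²) G(η)` in `η` along `ξ^⊥` just multiplies
it by `-(2s + ½) ξ^⊥ · η`. Integration by parts removes the factor `ξ^⊥ · η` and puts the derivative
on `q`, where it is the constant `c`; dividing by `(4s + 1)/2` gives the second power of `(4s +
1)⁻¹`. -/
theorem integral_angular_mul_exp {q : Plane → ℝ} (hq : q.HasTemperateGrowth) {s : ℝ} (hs : 0 < s)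
    {ξ : Plane} {c : ℝ} (hc : ∀ η, fderiv ℝ q η (perp ξ) = c) :
    ∫ η, ⟪perp ξ, η⟫_ℝ * Real.exp (-s * ‖ξ - η‖ ^ 2) * (q η * gaussian η) =
      2 * c * ((4 * s + 1)⁻¹ ^ 2 * Real.exp (-‖ξ‖ ^ 2 * (s / (4 * s + 1)))) := by
  set E : Plane → ℝ := fun η => Real.exp (-s * ‖ξ - η‖ ^ 2) with hE
  have hEs : ContDiff ℝ ∞ E := by
    have : ContDiff ℝ ∞ fun η : Plane => ‖ξ - η‖ ^ 2 :=
      (contDiff_norm_sq ℝ).comp (contDiff_const.sub contDiff_id)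
    exact (contDiff_const.mul this).exp
  have hE1 : ∀ η, |E η| ≤ 1 := fun η => by
    rw [Real.abs_exp]
    exact Real.exp_le_one_iff.2 (by nlinarith [sq_nonneg ‖ξ - η‖])
  have hEg : Differentiable ℝ fun η => E η * gaussian η :=
    (hEs.mul contDiff_gaussian).differentiable (by simp)
  have hd : ∀ η, fderiv ℝ (fun η => E η * gaussian η) η (perp ξ) =
      -((2 * s + 1 / 2) * (⟪perp ξ, η⟫_ℝ * E η * gaussian η)) := by
    intro η
    have h1 : HasFDerivAt (fun η : Plane => ‖ξ - η‖ ^ 2)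
        ((2 • innerSL ℝ (ξ - η)).comp (-ContinuousLinearMap.id ℝ Plane)) η :=
      ((hasStrictFDerivAt_norm_sq (ξ - η)).hasFDerivAt).comp η ((hasFDerivAt_id η).const_sub ξ)
    have h2 : HasFDerivAt E _ η := (h1.const_mul (-s)).exp
    have h3 : HasFDerivAt (fun η => E η * gaussian η) _ η := h2.mul (hasFDerivAt_gaussian η)
    have h4 : Real.exp (-s * ‖ξ - η‖ ^ 2) = E η := rfl
    rw [h3.fderiv, h4]
    have p1 := inner_perp_self ξ
    have p2 : ⟪η, perp ξ⟫_ℝ = ⟪perp ξ, η⟫_ℝ := real_inner_comm _ _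
    simp [p1, p2, two_smul]
    ring
  have hint : ∀ p : Plane → ℝ, p.HasTemperateGrowth → Integrable fun η => p η * (E η * gaussian η) := by
    intro p hp
    refine hp.integrable_mul_gaussian.norm.mono' (Continuous.aestronglyMeasurable (by
      have := hp.1.continuous
      have := hEs.continuous
      have := continuous_gaussian
      fun_prop)) (Filter.Eventually.of_forall fun η => ?_)
    rw [norm_mul, norm_mul, norm_mul]
    gcongr
    exact mul_le_of_le_one_left (norm_nonneg _) (hE1 η)
  have hperp : Function.HasTemperateGrowth fun η : Plane => ⟪perp ξ, η⟫_ℝ :=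
    Function.hasTemperateGrowth_inner_right _
  have h := integral_mul_fderiv_eq_neg_fderiv_mul_of_integrable (μ := (volume : Measure Plane))
    (f := q) (g := fun η => E η * gaussian η) (v := perp ξ) ?_ ?_ (hint q hq)
    (fun x _ => hq.differentiable x) (fun x _ => hEg x)
  · simp only [hd, hc] at h
    rw [integral_const_mul] at h
    have h5 := integral_exp_mul_gaussian hs ξ
    change ∫ η, E η * gaussian η = _ at h5
    rw [h5] at h
    have e : ∀ η, q η * -((2 * s + 1 / 2) * (⟪perp ξ, η⟫_ℝ * E η * gaussian η)) =
        -(2 * s + 1 / 2) * (⟪perp ξ, η⟫_ℝ * E η * (q η * gaussian η)) := fun η => by ring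
    simp only [e] at h
    rw [integral_const_mul] at h
    have h6 : (4 * s + 1) ≠ 0 := by positivity
    have h7 : (2 * s + 1 / 2) = (4 * s + 1) / 2 := by ring
    rw [h7] at h
    change ∫ η, ⟪perp ξ, η⟫_ℝ * E η * (q η * gaussian η) = _
    field_simp at h ⊢
    linarith
  · simp only [hc]
    exact hint _ (Function.HasTemperateGrowth.const c)
  · simp only [hd]
    refine ((hint _ (hq.mul hperp)).const_mul (-(2 * s + 1 / 2))).congr
      (Filter.Eventually.of_forall fun η => ?_)
    simp only [Pi.mul_apply]
    ring

/-- Write `‖ξ - η‖⁻²` as an integral of Gaussians over `s`, exchange the integrals, and apply the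
angular identity. The remaining integral is elementary because `(4s + 1)⁻²` is the derivative of `s
/ (4s + 1)`. -/
theorem integral_radialKernel_mul {q : Plane → ℝ} (hq : q.HasTemperateGrowth) {ξ : Plane}
    (hξ : ξ ≠ 0) {c : ℝ} (hc : ∀ η, fderiv ℝ q η (perp ξ) = c)
    (hi : Integrable fun η => radialKernel ξ η * (q η * gaussian η)) :
    ∫ η, radialKernel ξ η * (q η * gaussian η) =
      c * (Real.pi⁻¹ * (‖ξ‖ ^ 2)⁻¹ * (1 - Real.exp (-‖ξ‖ ^ 2 / 4))) := by
  have hn : 0 < ‖ξ‖ ^ 2 := by have := norm_pos_iff.2 hξ; positivity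
  have hne : ∀ᵐ η : Plane, ξ ≠ η := by
    have : ∀ᵐ η : Plane, η ≠ ξ := by simp [ae_iff, measure_singleton]
    filter_upwards [this] with η h using h.symm
  have hpi := Real.pi_pos
  set F : Plane → ℝ → ℝ := fun η s =>
    ⟪perp ξ, η⟫_ℝ * Real.exp (-s * ‖ξ - η‖ ^ 2) * (q η * gaussian η) with hF
  have hexp : ∀ η : Plane, ξ ≠ η → IntegrableOn (fun s => Real.exp (-s * ‖ξ - η‖ ^ 2)) (Ioi 0) ∧
      ∫ s in Ioi (0 : ℝ), Real.exp (-s * ‖ξ - η‖ ^ 2) = (‖ξ - η‖ ^ 2)⁻¹ := by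
    intro η h
    have h0 : 0 < ‖ξ - η‖ ^ 2 := by
      have := norm_pos_iff.2 (sub_ne_zero.2 h)
      positivity
    have e : ∀ s : ℝ, -s * ‖ξ - η‖ ^ 2 = (-‖ξ - η‖ ^ 2) * s := fun s => by ring
    simp only [e]
    refine ⟨integrableOn_exp_mul_Ioi (neg_lt_zero.2 h0) 0, ?_⟩
    rw [integral_exp_mul_Ioi (neg_lt_zero.2 h0)]
    simp
  have hFint : Integrable (Function.uncurry F) (volume.prod (volume.restrict (Ioi 0))) := by
    have hcont : Continuous (Function.uncurry F) := by
      have := hq.1.continuous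
      have := continuous_gaussian
      simp only [hF]
      fun_prop
    rw [integrable_prod_iff hcont.aestronglyMeasurable]
    constructor
    · filter_upwards [hne] with η h
      exact ((hexp η h).1.integrable.const_mul ⟪perp ξ, η⟫_ℝ).mul_const (q η * gaussian η)
    · refine (hi.norm.const_mul (2 * Real.pi)).congr ?_
      filter_upwards [hne] with η h
      have e : ∀ s, ‖Function.uncurry F (η, s)‖ = (|⟪perp ξ, η⟫_ℝ| * |q η * gaussian η|) *
          Real.exp (-s * ‖ξ - η‖ ^ 2) := fun s => by
        simp only [hF, Function.uncurry_apply_pair, norm_mul, Real.norm_eq_abs, Real.abs_exp, abs_mul]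
        ring
      simp only [e]
      rw [integral_const_mul, (hexp η h).2]
      simp only [radialKernel, norm_mul, Real.norm_eq_abs, abs_mul, abs_inv, abs_pow, abs_norm,
        abs_two, abs_of_pos hpi]
      field_simp
  have hswap := integral_integral_swap hFint
  have hleft : ∫ η, radialKernel ξ η * (q η * gaussian η) =
      (2 * Real.pi)⁻¹ * ∫ η, ∫ s in Ioi (0 : ℝ), F η s := by
    rw [← integral_const_mul]
    refine integral_congr_ae ?_
    filter_upwards [hne] with η h
    simp only [hF]
    rw [integral_mul_const, integral_const_mul, (hexp η h).2, radialKernel]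
    ring
  rw [hleft, hswap]
  have hright : ∫ s in Ioi (0 : ℝ), ∫ η, F η s = ∫ s in Ioi (0 : ℝ),
      2 * c * ((4 * s + 1)⁻¹ ^ 2 * Real.exp (-‖ξ‖ ^ 2 * (s / (4 * s + 1)))) :=
    setIntegral_congr_fun measurableSet_Ioi fun s hs => integral_angular_mul_exp hq hs hc
  rw [hright, integral_const_mul]
  have hder : ∀ s ∈ Ici (0 : ℝ), HasDerivAt
      (fun s => -(‖ξ‖ ^ 2)⁻¹ * Real.exp (-‖ξ‖ ^ 2 * (s / (4 * s + 1))))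
      ((4 * s + 1)⁻¹ ^ 2 * Real.exp (-‖ξ‖ ^ 2 * (s / (4 * s + 1)))) s := by
    intro s hs
    have hs0 : (0 : ℝ) ≤ s := hs
    have h4 : 4 * s + 1 ≠ 0 := by positivity
    have d1 : HasDerivAt (fun s : ℝ => 4 * s + 1) 4 s := by
      simpa using ((hasDerivAt_id s).const_mul 4).add_const 1
    have d2 := ((((hasDerivAt_id s).div d1 h4).const_mul (-‖ξ‖ ^ 2)).exp).const_mul (-(‖ξ‖ ^ 2)⁻¹)
    refine d2.congr_deriv ?_
    simp only [id, Pi.div_apply]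
    field_simp
    ring
  have hlim : Filter.Tendsto (fun s : ℝ => -(‖ξ‖ ^ 2)⁻¹ * Real.exp (-‖ξ‖ ^ 2 * (s / (4 * s + 1))))
      Filter.atTop (𝓝 (-(‖ξ‖ ^ 2)⁻¹ * Real.exp (-‖ξ‖ ^ 2 * (1 / 4)))) := by
    have t : Filter.Tendsto (fun s : ℝ => s / (4 * s + 1)) Filter.atTop (𝓝 (1 / 4)) := by
      have t1 : Filter.Tendsto (fun s : ℝ => (4 + s⁻¹)⁻¹) Filter.atTop (𝓝 (4 + 0)⁻¹) :=
        (tendsto_const_nhds.add tendsto_inv_atTop_zero).inv₀ (by norm_num)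
      have e : (4 + 0 : ℝ)⁻¹ = 1 / 4 := by norm_num
      rw [e] at t1
      refine t1.congr' ?_
      filter_upwards [Filter.eventually_gt_atTop 0] with s hs
      field_simp
    exact ((Real.continuous_exp.tendsto _).comp (t.const_mul _)).const_mul _
  -- The value at `s = 0` gives the `1`, and the limit `s / (4s + 1) → 1/4` gives `exp (-‖ξ‖²/4)`.
  rw [integral_Ioi_of_hasDerivAt_of_nonneg' hder (fun s _ => by positivity) hlim]
  simp only [zero_div, mul_zero, Real.exp_zero]
  rw [show -‖ξ‖ ^ 2 * (1 / 4) = -‖ξ‖ ^ 2 / 4 by ring]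
  field_simp
  ring

/-- The derivative of `H_k` along `ξ^⊥` may depend on `ξ` but not on the point `η`. This is applied
to the modes of degree at most one, where `H_k` is affine. -/
theorem nonlocalTerm_hermiteFun (k : Fin 2 → ℕ) {c : Plane → ℝ}
    (hc : ∀ ξ η, fderiv ℝ (hermite k) η (perp ξ) = c ξ) :
    ∀ᵐ ξ, nonlocalTerm (hermiteFun k) ξ = ((-(c ξ * ((2 * Real.pi)⁻¹ * (‖ξ‖ ^ 2)⁻¹ *
      (1 - Real.exp (-‖ξ‖ ^ 2 / 4)))) * gaussian ξ : ℝ) : ℂ) := by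
  have hne : ∀ᵐ ξ : Plane, ξ ≠ 0 := by simp [ae_iff, measure_singleton]
  have hH := coeFn_mulGaussian (hasTemperateGrowth_hermite k)
  filter_upwards [nonlocalTerm_eq (hermiteFun k), integrable_radialKernel_mul (hermiteFun k), hne]
    with ξ h1 h2 h3
  have e : (fun η => (radialKernel ξ η : ℂ) * hermiteFun k η) =ᵐ[volume]
      fun η => ((radialKernel ξ η * (hermite k η * gaussian η) : ℝ) : ℂ) := by
    filter_upwards [hH] with η h
    rw [hermiteFun, h]
    push_cast
    ring
  have hi : Integrable fun η => radialKernel ξ η * (hermite k η * gaussian η) := by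
    have := (h2.congr e).re
    simpa using this
  rw [h1, integral_congr_ae e, integral_complex_ofReal,
    integral_radialKernel_mul (hasTemperateGrowth_hermite k) h3 (hc ξ) hi]
  push_cast
  have : (Real.pi : ℂ) ≠ 0 := by exact_mod_cast Real.pi_ne_zero
  field_simp

theorem nonlocalTerm_hermiteFun_zero : ∀ᵐ ξ, nonlocalTerm (hermiteFun 0) ξ = 0 := by
  have h := nonlocalTerm_hermiteFun 0 (c := fun _ => 0) (fun ξ η => by
    rw [hermite_zero]; simp)
  filter_upwards [h] with ξ hξ
  rw [hξ]
  simp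

/-- The derivative of `ξᵢ / 2` along `ξ^⊥` is half the `i`-th component of `ξ^⊥`, which rebuilds
`v^G`. The result is opposite to the transport term `v^G · ∇(½ ξᵢ G) = ½ v^G_i G`; this reflects the
translation invariance of the vortex equation. -/
theorem nonlocalTerm_hermiteFun_single (i : Fin 2) :
    ∀ᵐ ξ, nonlocalTerm (hermiteFun (Pi.single i 1)) ξ =
      ((-(vortexVelocity ξ i) * gaussian ξ : ℝ) : ℂ) / 2 := by
  have h := nonlocalTerm_hermiteFun (Pi.single i 1) (c := fun ξ => perp ξ i / 2) (fun ξ η => by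
    rw [hermite_single]
    have h1 : HasFDerivAt (fun ξ : Plane => ξ i / 2)
        ((2 : ℝ)⁻¹ • (EuclideanSpace.proj (𝕜 := ℝ) i : Plane →L[ℝ] ℝ)) η := by
      have := ((EuclideanSpace.proj (𝕜 := ℝ) i : Plane →L[ℝ] ℝ).hasFDerivAt (x := η)).const_smul
        (2 : ℝ)⁻¹
      refine this.congr_of_eventuallyEq (Filter.Eventually.of_forall fun x => ?_)
      simp
      ring
    rw [h1.fderiv]
    simp
    ring)
  filter_upwards [h] with ξ hξ
  rw [hξ]
  simp only [vortexVelocity, PiLp.smul_apply, smul_eq_mul]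
  push_cast
  ring

/-! ### Graphs of sums of partially defined operators -/

section Graph

variable {E : Type*} [AddCommGroup E] [Module ℂ E]

theorem mem_graph_add {A B : E →ₗ.[ℂ] E} {p : E × E} :
    p ∈ (A + B).graph ↔ ∃ y z, (p.1, y) ∈ A.graph ∧ (p.1, z) ∈ B.graph ∧ p.2 = y + z := by
  simp only [LinearPMap.mem_graph_iff]
  constructor
  · rintro ⟨w, h1, h2⟩
    refine ⟨A ⟨w, w.2.1⟩, B ⟨w, w.2.2⟩, ⟨_, h1, rfl⟩, ⟨_, h1, rfl⟩, ?_⟩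
    rw [← h2]
    rfl
  · rintro ⟨y, z, ⟨u, hu, rfl⟩, ⟨v, hv, rfl⟩, h⟩
    refine ⟨⟨p.1, ⟨hu ▸ u.2, hv ▸ v.2⟩⟩, rfl, ?_⟩
    rw [h, LinearPMap.add_apply]
    congr 1
    · congr 1; exact Subtype.ext hu.symm
    · congr 1; exact Subtype.ext hv.symm

theorem mem_graph_sub {A B : E →ₗ.[ℂ] E} {p : E × E} :
    p ∈ (A - B).graph ↔ ∃ y z, (p.1, y) ∈ A.graph ∧ (p.1, z) ∈ B.graph ∧ p.2 = y - z := by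
  simp only [LinearPMap.mem_graph_iff]
  constructor
  · rintro ⟨w, h1, h2⟩
    refine ⟨A ⟨w, w.2.1⟩, B ⟨w, w.2.2⟩, ⟨_, h1, rfl⟩, ⟨_, h1, rfl⟩, ?_⟩
    rw [← h2]
    rfl
  · rintro ⟨y, z, ⟨u, hu, rfl⟩, ⟨v, hv, rfl⟩, h⟩
    refine ⟨⟨p.1, ⟨hu ▸ u.2, hv ▸ v.2⟩⟩, rfl, ?_⟩
    rw [h, LinearPMap.sub_apply]
    congr 1
    · congr 1; exact Subtype.ext hu.symm
    · congr 1; exact Subtype.ext hv.symm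

theorem mem_graph_smul {A : E →ₗ.[ℂ] E} {c : ℂ} {p : E × E} :
    p ∈ (c • A).graph ↔ ∃ y, (p.1, y) ∈ A.graph ∧ p.2 = c • y := by
  simp only [LinearPMap.mem_graph_iff]
  constructor
  · rintro ⟨w, h1, h2⟩
    exact ⟨A w, ⟨w, h1, rfl⟩, h2.symm⟩
  · rintro ⟨y, ⟨u, hu, rfl⟩, h⟩
    exact ⟨u, hu, h.symm⟩

end Graph

theorem mem_graph_diffusionOp {p : X × X} :
    p ∈ diffusionOp.graph ↔ ∃ g r, (p.1, g) ∈ weakGraph Laplacian.laplacian laplacian_test ∧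
      (p.1, r) ∈ weakGraph (fun φ ξ => -divergence (fun η => φ η • η) ξ)
        (divergence_test contDiff_id) ∧ p.2 = g + (1 / 2 : ℂ) • r + p.1 := by
  rw [diffusionOp, mem_graph_add]
  simp only [mem_graph_add, mem_graph_smul, graph_laplacianOp, graph_advectionOp]
  constructor
  · rintro ⟨y, z, ⟨g, _, hg, ⟨r, hr, rfl⟩, rfl⟩, hz, h⟩
    refine ⟨g, r, hg, hr, ?_⟩
    obtain ⟨u, hu, rfl⟩ := (LinearPMap.mem_graph_iff _).1 hz
    rw [h, ← hu]
    rfl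
  · rintro ⟨g, r, hg, hr, h⟩
    refine ⟨_, p.1, ⟨g, _, hg, ⟨r, hr, rfl⟩, rfl⟩, ?_, h⟩
    exact (LinearPMap.mem_graph_iff _).2 ⟨⟨p.1, trivial⟩, rfl, rfl⟩

/-- The graph of the transport operator `v^G · ∇` in `X`. -/
def transportGraph : Submodule ℂ (X × X) :=
  weakGraph (fun φ ξ => -divergence (fun η => φ η • vortexVelocity η) ξ)
    (divergence_test contDiff_vortexVelocity)

theorem mem_graph_linearizedOp {α : ℝ} {p : X × X} :
    p ∈ (linearizedOp α).graph ↔ ∃ d t n, (p.1, d) ∈ diffusionOp.graph ∧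
      (p.1, t) ∈ transportGraph ∧ (p.1, n) ∈ nonlocalGraph ∧ p.2 = d - (α : ℂ) • (t + n) := by
  rw [linearizedOp, mem_graph_sub]
  simp only [mem_graph_smul, advectionLambda, mem_graph_add, graph_nonlocalOp, graph_advectionOp]
  constructor
  · rintro ⟨d, _, hd, ⟨_, ⟨t, n, ht, hn, rfl⟩, rfl⟩, h⟩
    exact ⟨d, t, n, hd, ht, hn, h⟩
  · rintro ⟨d, t, n, hd, ht, hn, h⟩
    exact ⟨d, _, hd, ⟨_, ⟨t, n, ht, hn, rfl⟩, rfl⟩, h⟩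

/-! ### Hermite coefficients and the diffusion operator -/

/-- Minus the eigenvalue of `𝓛` on the Hermite function of index `k`. -/
def decayRate (k : Fin 2 → ℕ) : ℝ := ((k 0 : ℝ) + k 1) / 2

theorem decayRate_nonneg (k : Fin 2 → ℕ) : 0 ≤ decayRate k := by
  unfold decayRate; positivity

/-- Lowering followed by raising is the number operator in direction `i`, with eigenvalue `kᵢ / 2`.
-/
theorem raising_pderiv_hermite (k : Fin 2 → ℕ) (i : Fin 2) (ξ : Plane) :
    ξ i / 2 * pderiv i (hermite k) ξ - pderiv i (pderiv i (hermite k)) ξ =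
      (k i : ℝ) / 2 * hermite k ξ := by
  by_cases h : k i = 0
  · rw [pderiv_hermite_of_eq_zero h, h]
    simp [pderiv]
  · obtain ⟨l, rfl⟩ := index_pred k i h
    have e := congrFun (raising_hermite l i) ξ
    rw [raising] at e
    have e2 : pderiv i (fun η => ((l i : ℝ) + 1) / 2 * hermite l η) ξ =
        ((l i : ℝ) + 1) / 2 * pderiv i (hermite l) ξ := by
      rw [pderiv_mul (differentiable_const _) (hasTemperateGrowth_hermite l).differentiable]
      simp [pderiv]
    rw [pderiv_hermite_succ, e2, ← e]
    simp
    ring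

theorem inner_hermiteFun (k : Fin 2 → ℕ) (w : X) :
    ⟪hermiteFun k, w⟫_ℂ = ∫ ξ, w ξ * (hermite k ξ : ℂ) :=
  inner_mulGaussian _ w

/-- The formal transpose of `𝓛` is `Δ - ½ ξ · ∇`: the divergence `2` of the field `ξ`, halved,
cancels the zero-order term. Hermite polynomials are its eigenfunctions. The identity covers the
whole maximal domain, without any regularity of `w`. -/
theorem inner_hermiteFun_diffusion {w d : X} (h : (w, d) ∈ diffusionOp.graph) (k : Fin 2 → ℕ) :
    ⟪hermiteFun k, d⟫_ℂ = -(decayRate k : ℂ) * ⟪hermiteFun k, w⟫_ℂ := by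
  obtain ⟨g, r, hg, hr, e⟩ := mem_graph_diffusionOp.1 h
  simp only at hg hr e
  have hH := hasTemperateGrowth_hermite k
  have h1 := integral_laplacian_mul hg hH
  have h2 := integral_advection_mul (b := fun η => η) (hb := contDiff_id) hr (K := 1) (d := 2)
    (fun i ξ => by
      have : |ξ i| ≤ ‖ξ‖ := by simpa using PiLp.norm_apply_le ξ i
      linarith)
    (fun ξ => by simp [pderiv_coord]) hH
  rw [e, inner_add_right, inner_add_right, inner_smul_right]
  simp only [inner_hermiteFun]
  rw [h1, h2, ← integral_const_mul, ← integral_const_mul]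
  have hc := hasTemperateGrowth_coord
  have i1 : Integrable fun ξ => w ξ * ((∑ i, pderiv i (pderiv i (hermite k)) ξ : ℝ) : ℂ) :=
    (Function.HasTemperateGrowth.sum fun i _ => (hH.pderiv i).pderiv i).integrable_X_mul w
  have i2 : Integrable fun ξ => w ξ *
      ((-(∑ i, ξ i * pderiv i (hermite k) ξ + 2 * hermite k ξ) : ℝ) : ℂ) := by
    refine Function.HasTemperateGrowth.integrable_X_mul ?_ w
    exact ((Function.HasTemperateGrowth.sum fun i _ => (hc i).mul (hH.pderiv i)).add
      ((Function.HasTemperateGrowth.const 2).mul hH)).neg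
  have i3 := hH.integrable_X_mul w
  have i12 : Integrable fun ξ => w ξ * ((∑ i, pderiv i (pderiv i (hermite k)) ξ : ℝ) : ℂ) +
      (1 / 2 : ℂ) * (w ξ * ((-(∑ i, ξ i * pderiv i (hermite k) ξ + 2 * hermite k ξ) : ℝ) : ℂ)) :=
    i1.add (i2.const_mul _)
  rw [← integral_add i1 (i2.const_mul _), ← integral_add i12 i3]
  refine integral_congr_ae (Filter.Eventually.of_forall fun ξ => ?_)
  have e0 := raising_pderiv_hermite k 0 ξ
  have e1 := raising_pderiv_hermite k 1 ξ
  have e2 : (∑ i, pderiv i (pderiv i (hermite k)) ξ) +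
      (1 / 2) * (-(∑ i, ξ i * pderiv i (hermite k) ξ + 2 * hermite k ξ)) + hermite k ξ =
      -decayRate k * hermite k ξ := by
    rw [Fin.sum_univ_two, Fin.sum_univ_two, decayRate]
    linear_combination -e0 - e1
  have e3 := congrArg (fun x : ℝ => w ξ * (x : ℂ)) e2
  simp only at e3 ⊢
  push_cast at e3 ⊢
  linear_combination e3

/-- The resolvent `R` of `𝓛` at a real point `l ≥ 1`, with the composed derivatives `∂ᵢ R`. -/
theorem exists_diffusion_resolvent {l : ℝ} (hl : 1 ≤ l) :
    ∃ (R : X →L[ℂ] X) (D : Fin 2 → X →L[ℂ] X), ‖R‖ ≤ (Real.sqrt l)⁻¹ ∧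
      (∀ i, ‖D i‖ ≤ (Real.sqrt l)⁻¹) ∧
      (∀ k, R (hermiteFun k) = (((l + decayRate k)⁻¹ : ℝ) : ℂ) • hermiteFun k) ∧
      (∀ i k, D i (hermiteFun k) =
        ((-(l + decayRate k)⁻¹ : ℝ) : ℂ) • hermiteFun (k + Pi.single i 1)) ∧
      (∀ i f, (R f, D i f) ∈ pderivGraph i) ∧
      ∀ f, (R f, (l : ℂ) • R f - f) ∈ diffusionOp.graph := by
  have hpos : ∀ k, 0 < l + decayRate k := fun k => by linarith [decayRate_nonneg k]
  have hki : ∀ (k : Fin 2 → ℕ) i, (k i : ℝ) / 2 ≤ decayRate k := fun k i => by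
    have h0 : (0 : ℝ) ≤ k 0 := Nat.cast_nonneg _
    have h1 : (0 : ℝ) ≤ k 1 := Nat.cast_nonneg _
    unfold decayRate
    fin_cases i <;> simp <;> linarith
  have hl0 : 0 < l := by linarith
  have hsq : (Real.sqrt l)⁻¹ ^ 2 = l⁻¹ := by rw [inv_pow, Real.sq_sqrt hl0.le]
  -- Common form of the shift condition for `R` and `∂ᵢ R`, with `x` the ratio of squared norms of
  -- the target and source Hermite functions: `1` for `R` and `(kᵢ + 1)/2` for `∂ᵢ R`.
  have bound : ∀ (k : Fin 2 → ℕ) (x : ℝ), x ≤ (l + decayRate k) ^ 2 / l →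
      (l + decayRate k)⁻¹ ^ 2 * (x * hermiteNormSq k) ≤ (Real.sqrt l)⁻¹ ^ 2 * hermiteNormSq k := by
    intro k x hx
    rw [hsq, ← mul_assoc]
    have h1 := hpos k
    refine mul_le_mul_of_nonneg_right ?_ (hermiteNormSq_pos k).le
    calc (l + decayRate k)⁻¹ ^ 2 * x ≤ (l + decayRate k)⁻¹ ^ 2 * ((l + decayRate k) ^ 2 / l) := by
          gcongr
      _ = l⁻¹ := by field_simp
  obtain ⟨R, hR, hR'⟩ := exists_hermite_shift 0 (fun k => (l + decayRate k)⁻¹)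
    (C := (Real.sqrt l)⁻¹) (by positivity) (fun k => by
      have := bound k 1 (by
        rw [le_div_iff₀ hl0]
        nlinarith [decayRate_nonneg k])
      simpa using this)
  choose D hD hD' using fun i : Fin 2 => exists_hermite_shift (Pi.single i 1)
    (fun k => -(l + decayRate k)⁻¹) (C := (Real.sqrt l)⁻¹) (by positivity) (fun k => by
      rw [hermiteNormSq_succ, neg_sq]
      refine bound k _ ?_
      rw [le_div_iff₀ hl0]
      nlinarith [decayRate_nonneg k, hki k i])
  -- Second derivatives need only boundedness: the ratio `(kᵢ + 1)(kᵢ + 2)/4` is at most `(1 +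
  -- kᵢ/2)² ≤ (l + decayRate k)²`.
  choose D2 hD2 hD2' using fun i : Fin 2 => exists_hermite_shift (Pi.single i 1 + Pi.single i 1)
    (fun k => (l + decayRate k)⁻¹) (C := 1) zero_le_one (fun k => by
      rw [← add_assoc, hermiteNormSq_succ, hermiteNormSq_succ, one_pow, one_mul, ← mul_assoc,
        ← mul_assoc]
      refine mul_le_of_le_one_left (hermiteNormSq_pos k).le ?_
      rw [inv_pow, mul_assoc, inv_mul_le_one₀ (by have := hpos k; positivity)]
      have := hki k i
      have h2 : (0 : ℝ) ≤ k i := Nat.cast_nonneg _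
      simp
      nlinarith)
  have g1 : ∀ i f, (R f, D i f) ∈ pderivGraph i := fun i f => by
    refine mem_of_hermiteFun_mem (isClosed_weakGraph _ _) R (D i) (fun k => ?_) f
    rw [hR', hD', add_zero]
    have := (pderivGraph i).smul_mem (((l + decayRate k)⁻¹ : ℝ) : ℂ) (hermiteFun_mem_pderivGraph k i)
    rw [Prod.smul_mk, smul_neg] at this
    rw [Complex.ofReal_neg, neg_smul]
    exact this
  have g2 : ∀ i f, (D i f, D2 i f) ∈ pderivGraph i := fun i f => by
    refine mem_of_hermiteFun_mem (isClosed_weakGraph _ _) (D i) (D2 i) (fun k => ?_) f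
    rw [hD2', hD', ← add_assoc]
    have := (pderivGraph i).smul_mem (((-(l + decayRate k)⁻¹ : ℝ)) : ℂ)
      (hermiteFun_mem_pderivGraph (k + Pi.single i 1) i)
    rw [Prod.smul_mk, smul_neg, Complex.ofReal_neg, neg_smul, neg_smul, neg_neg] at this
    rw [Complex.ofReal_neg, neg_smul]
    exact this
  -- The formula for `ξ · ∇ R f` is forced by solving `Δ R f + ½ ξ · ∇ R f + R f = l R f - f` for
  -- the drift term.
  let V : X →L[ℂ] X := (2 : ℂ) • ((l : ℂ) • R - 1 - ∑ i, D2 i - R)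
  have g3 : ∀ f, (R f, V f) ∈ weakGraph (fun φ ξ => -divergence (fun η => φ η • η) ξ)
      (divergence_test contDiff_id) := fun f => by
    refine mem_of_hermiteFun_mem (isClosed_weakGraph _ _) R V (fun k => ?_) f
    have := (weakGraph (fun φ ξ => -divergence (fun η => φ η • η) ξ)
      (divergence_test contDiff_id)).smul_mem (((l + decayRate k)⁻¹ : ℝ) : ℂ)
      (hermiteFun_mem_weakGraph_radial k)
    rw [Prod.smul_mk] at this
    rw [hR', add_zero]
    convert this using 2
    have hc : (l : ℂ) * (((l + decayRate k)⁻¹ : ℝ) : ℂ) =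
        1 - (decayRate k : ℂ) * (((l + decayRate k)⁻¹ : ℝ) : ℂ) := by
      have := (hpos k).ne'
      have h3 : l * (l + decayRate k)⁻¹ = 1 - decayRate k * (l + decayRate k)⁻¹ := by
        field_simp
        ring
      exact_mod_cast h3
    have hq : (decayRate k : ℂ) = ((k 0 : ℂ) + k 1) / 2 := by
      rw [decayRate]; push_cast; rfl
    have hV : V (hermiteFun k) =
        (2 : ℂ) • ((l : ℂ) • R (hermiteFun k) - hermiteFun k -
          (D2 0 (hermiteFun k) + D2 1 (hermiteFun k)) - R (hermiteFun k)) := by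
      simp only [V, Fin.sum_univ_two]
      rfl
    rw [hV, hR', hD2', hD2', add_zero, Fin.sum_univ_two, Fin.sum_univ_two, smul_smul, hc, hq,
      add_assoc, add_assoc]
    generalize (((l + decayRate k)⁻¹ : ℝ) : ℂ) = x
    module
  refine ⟨R, D, hR, hD, fun k => by rw [hR', add_zero], hD', g1, fun f => ?_⟩
  refine mem_graph_diffusionOp.2 ⟨∑ i, D2 i f, V f,
    mem_weakGraph_laplacian (fun i => g1 i f) (fun i => g2 i f), g3 f, ?_⟩
  simp only [V, FunLike.coe_smul, FunLike.coe_sub, FunLike.coe_sum, Pi.smul_apply, Pi.sub_apply,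
      Finset.sum_apply, one_apply_eq_self]
  module

theorem eq_of_inner_hermiteFun {u w : X} (h : ∀ k, ⟪hermiteFun k, u⟫_ℂ = ⟪hermiteFun k, w⟫_ℂ) :
    u = w := by
  rw [← sub_eq_zero]
  refine eq_zero_of_integral_hermite fun k => ?_
  rw [← inner_hermiteFun, inner_sub_right, h k, sub_self]

/-- Both sides have the same Hermite coefficients. So the maximal distributional domain of `𝓛` is
contained in the range of `R`, and its elements inherit the derivatives that `R f` has. -/
theorem eq_resolvent_of_mem_diffusion {l : ℝ} (hl : 1 ≤ l) {R : X →L[ℂ] X}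
    (hR : ∀ f, (R f, (l : ℂ) • R f - f) ∈ diffusionOp.graph) {w d : X}
    (h : (w, d) ∈ diffusionOp.graph) : R ((l : ℂ) • w - d) = w := by
  refine eq_of_inner_hermiteFun fun k => ?_
  have h1 := inner_hermiteFun_diffusion h k
  have h2 := inner_hermiteFun_diffusion (hR ((l : ℂ) • w - d)) k
  have h3 : (l : ℂ) + decayRate k ≠ 0 := by
    have : l + decayRate k ≠ 0 := by linarith [decayRate_nonneg k]
    exact_mod_cast this
  simp only [inner_sub_right, inner_smul_right] at h2
  refine mul_left_cancel₀ h3 ?_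
  linear_combination h2 - h1

/-! ### The transport operator -/

/-- Here `T f = ∑ v^G_i ∂ᵢ R f`, bounded because `|v^G_i| ≤ 1`. The weak identity follows by testing
`∂ᵢ R f` on `v^G_i φ`. Thus the domain of `𝓛` lies in that of `v^G · ∇`, with the decay `l^(-1/2)`
retained. -/
theorem exists_transport {l : ℝ} {R : X →L[ℂ] X} {D : Fin 2 → X →L[ℂ] X}
    (hD : ∀ i, ‖D i‖ ≤ (Real.sqrt l)⁻¹) (hRD : ∀ i f, (R f, D i f) ∈ pderivGraph i) :
    ∃ T : X →L[ℂ] X, ‖T‖ ≤ 2 * (Real.sqrt l)⁻¹ ∧ (∀ f, (R f, T f) ∈ transportGraph) ∧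
      ∀ f, ∀ᵐ ξ, T f ξ = ∑ i, (vortexVelocity ξ i : ℂ) * D i f ξ := by
  have hv := fun i => contDiff_apply_coord contDiff_vortexVelocity i
  choose M hM hM' using fun i : Fin 2 => exists_mulOp (hv i).continuous (abs_vortexVelocity_le i)
  have hT : ∀ f, ∀ᵐ ξ, (∑ i, (M i).comp (D i)) f ξ =
      ∑ i, (vortexVelocity ξ i : ℂ) * D i f ξ := by
    intro f
    simp only [Fin.sum_univ_two]
    filter_upwards [hM' 0 (D 0 f), hM' 1 (D 1 f), coeFn_add_ae (M 0 (D 0 f)) (M 1 (D 1 f))]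
      with ξ h0 h1 h2
    rw [← h0, ← h1, ← h2]
    rfl
  refine ⟨∑ i, (M i).comp (D i), ?_, fun f => ?_, hT⟩
  · refine (norm_sum_le _ _).trans ?_
    have hb : ∀ i, ‖(M i).comp (D i)‖ ≤ (Real.sqrt l)⁻¹ := fun i => by
      refine (ContinuousLinearMap.opNorm_comp_le _ _).trans ?_
      calc ‖M i‖ * ‖D i‖ ≤ 1 * (Real.sqrt l)⁻¹ := by
            gcongr
            · exact hM i
            · exact hD i
        _ = _ := one_mul _
    rw [Fin.sum_univ_two, two_mul]
    exact add_le_add (hb 0) (hb 1)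
  · intro φ h1 h2
    have hs : ∀ i, ContDiff ℝ ∞ fun ξ => vortexVelocity ξ i * φ ξ := fun i => (hv i).mul h1
    have hc : ∀ i, HasCompactSupport fun ξ => vortexVelocity ξ i * φ ξ := fun i => h2.mul_left
    have h3 : ∀ i, ∫ ξ, D i f ξ * ((vortexVelocity ξ i * φ ξ : ℝ) : ℂ) =
        -∫ ξ, R f ξ * (pderiv i (fun η => vortexVelocity η i * φ η) ξ : ℂ) := fun i => by
      have := hRD i f _ (hs i) (hc i)
      simpa only [Complex.ofReal_neg, mul_neg, integral_neg] using this
    have i1 : ∀ i, Integrable fun ξ => D i f ξ * ((vortexVelocity ξ i * φ ξ : ℝ) : ℂ) := fun i =>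
      integrable_X_mul _ (hs i).continuous (hc i)
    have i2 : ∀ i, Integrable fun ξ =>
        R f ξ * (pderiv i (fun η => vortexVelocity η i * φ η) ξ : ℂ) := fun i =>
      integrable_X_mul _ ((hs i).pderiv i).continuous ((hc i).pderiv i)
    simp only [divergence_smul (h1.differentiable (by simp))
      (contDiff_vortexVelocity.differentiable (by simp)), Fin.sum_univ_two, Complex.ofReal_neg,
      mul_neg, integral_neg, Complex.ofReal_add, mul_add]
    rw [integral_add (i2 0) (i2 1), neg_add, ← h3, ← h3, ← integral_add (i1 0) (i1 1)]
    refine integral_congr_ae ?_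
    filter_upwards [hT f] with ξ h
    simp only [Fin.sum_univ_two] at h
    rw [h]
    push_cast
    ring

/-- The part `½ ξᵢ H_k` of the raising operator drops out because `ξ · v^G = 0`; equivalently, `v^G
· ∇G = 0`. -/
theorem sum_vortexVelocity_mul_hermite_succ (k : Fin 2 → ℕ) (ξ : Plane) :
    ∑ i, vortexVelocity ξ i * hermite (k + Pi.single i 1) ξ =
      -∑ i, vortexVelocity ξ i * pderiv i (hermite k) ξ := by
  have h := sum_coord_mul_vortexVelocity ξ
  simp only [← raising_hermite, raising, Fin.sum_univ_two] at h ⊢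
  linear_combination hermite k ξ / 2 * h

/-- Since `v^G` is tangent to the level sets of `G`, only the polynomial factor is differentiated.
The weak value `s` is identified with the explicit one because the transport graph is single-valued.
-/
theorem transport_hermiteFun {k : Fin 2 → ℕ} {s : X} (hs : (hermiteFun k, s) ∈ transportGraph) :
    ∀ᵐ ξ, s ξ = (((∑ i, vortexVelocity ξ i * pderiv i (hermite k) ξ) * gaussian ξ : ℝ) : ℂ) := by
  obtain ⟨R, D, -, hD, hR', hD', hRD, -⟩ := exists_diffusion_resolvent le_rfl
  obtain ⟨T, -, hT, hT'⟩ := exists_transport hD hRD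
  have hpos : 1 + decayRate k ≠ 0 := by linarith [decayRate_nonneg k]
  have hne : (((1 + decayRate k : ℝ)) : ℂ) ≠ 0 := by exact_mod_cast hpos
  -- The preimage of `H_k G` under `R` at `l = 1`.
  set f : X := ((1 + decayRate k : ℝ) : ℂ) • hermiteFun k with hf
  have hRf : R f = hermiteFun k := by
    rw [hf, map_smul, hR', smul_smul, Complex.ofReal_inv, mul_inv_cancel₀ hne, one_smul]
  have hDf : ∀ i, D i f = -hermiteFun (k + Pi.single i 1) := fun i => by
    rw [hf, map_smul, hD', smul_smul, Complex.ofReal_neg, Complex.ofReal_inv, mul_neg,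
      mul_inv_cancel₀ hne, neg_one_smul]
  have hsT : s = T f := by
    have h1 := hT f
    rw [hRf] at h1
    have h2 := transportGraph.sub_mem hs h1
    rw [Prod.mk_sub_mk, sub_self] at h2
    exact sub_eq_zero.1 (weakGraph_single_valued _ _ _ h2 rfl)
  have hneg : ∀ i, ∀ᵐ ξ, D i f ξ = -((hermite (k + Pi.single i 1) ξ * gaussian ξ : ℝ) : ℂ) := by
    intro i
    rw [hDf]
    filter_upwards [coeFn_smul_ae (-1) (hermiteFun (k + Pi.single i 1)),
      coeFn_mulGaussian (hasTemperateGrowth_hermite (k + Pi.single i 1))] with ξ h1 h2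
    rw [neg_one_smul] at h1
    rw [h1, hermiteFun, h2]
    ring
  filter_upwards [hT' f, hneg 0, hneg 1] with ξ h1 h2 h3
  have h4 := sum_vortexVelocity_mul_hermite_succ k ξ
  rw [hsT, h1, ← neg_eq_iff_eq_neg.2 h4]
  rw [Fin.sum_univ_two, Fin.sum_univ_two, h2, h3]
  push_cast
  ring

/-- Test the weak equation for `t` on the polynomial `H_k`. As `v^G` is divergence free, this gives
`-∫ w v^G · ∇H_k`, and `G v^G · ∇H_k` is exactly `s`. -/
theorem inner_hermiteFun_transport {k : Fin 2 → ℕ} {s w t : X}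
    (hs : (hermiteFun k, s) ∈ transportGraph) (hw : (w, t) ∈ transportGraph) :
    ⟪hermiteFun k, t⟫_ℂ = -⟪s, w⟫_ℂ := by
  have h := integral_advection_mul (hb := contDiff_vortexVelocity) hw (K := 1) (d := 0)
    (fun i ξ => (abs_vortexVelocity_le i ξ).trans (by linarith [norm_nonneg ξ]))
    sum_pderiv_vortexVelocity (hasTemperateGrowth_hermite k)
  rw [inner_hermiteFun, h, inner_X, ← integral_neg]
  refine integral_congr_ae ?_
  filter_upwards [transport_hermiteFun hs] with ξ h1
  have : (gaussian ξ : ℂ) ≠ 0 := by exact_mod_cast (gaussian_pos ξ).ne'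
  rw [h1, Complex.conj_ofReal]
  push_cast
  field_simp
  ring

/-- For `u = R f` and `s = T f` the identity is continuous in `f`, so it follows by density from
Hermite functions. This is why `u` is taken in the domain of `𝓛`, whereas `w` may be anything in the
maximal domain of the transport operator. -/
theorem inner_transport_skew {u d s w t : X} (hu : (u, d) ∈ diffusionOp.graph)
    (hs : (u, s) ∈ transportGraph) (hw : (w, t) ∈ transportGraph) :
    ⟪u, t⟫_ℂ = -⟪s, w⟫_ℂ := by
  obtain ⟨R, D, -, hD, hR', hD', hRD, hR⟩ := exists_diffusion_resolvent le_rfl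
  obtain ⟨T, -, hT, hT'⟩ := exists_transport hD hRD
  have key : ∀ f, ⟪R f, t⟫_ℂ + ⟪T f, w⟫_ℂ = 0 := by
    let V : Submodule ℂ X :=
      { carrier := {f | ⟪R f, t⟫_ℂ + ⟪T f, w⟫_ℂ = 0}
        add_mem' := fun {f g} hf hg => by
          simp only [mem_ofPred_eq, map_add, inner_add_left] at hf hg ⊢
          linear_combination hf + hg
        zero_mem' := by simp
        smul_mem' := fun c f hf => by
          simp only [mem_ofPred_eq, map_smul, inner_smul_left] at hf ⊢
          linear_combination conj c * hf }
    have hV : V = ⊤ := by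
      refine eq_top_of_hermiteFun_mem ?_ fun k => ?_
      · exact isClosed_eq (by fun_prop) continuous_const
      · have hpos : 1 + decayRate k ≠ 0 := by linarith [decayRate_nonneg k]
        have hne : (((1 + decayRate k : ℝ)) : ℂ) ≠ 0 := by exact_mod_cast hpos
        have h1 := hT (hermiteFun k)
        rw [hR'] at h1
        have h2 := transportGraph.smul_mem ((1 + decayRate k : ℝ) : ℂ) h1
        rw [Prod.smul_mk, smul_smul, Complex.ofReal_inv, mul_inv_cancel₀ hne, one_smul] at h2
        have h3 := inner_hermiteFun_transport h2 hw
        rw [inner_smul_left, Complex.conj_ofReal] at h3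
        change ⟪R (hermiteFun k), t⟫_ℂ + ⟪T (hermiteFun k), w⟫_ℂ = 0
        rw [hR', inner_smul_left, Complex.conj_ofReal, h3, Complex.ofReal_inv]
        field_simp
        ring
    intro f
    have : f ∈ V := by rw [hV]; trivial
    exact this
  have hRu := eq_resolvent_of_mem_diffusion le_rfl hR hu
  have h1 := hT (((1 : ℝ) : ℂ) • u - d)
  rw [hRu] at h1
  have h2 := transportGraph.sub_mem hs h1
  rw [Prod.mk_sub_mk, sub_self] at h2
  have h3 := sub_eq_zero.1 (weakGraph_single_valued _ _ _ h2 rfl)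
  have h4 := key (((1 : ℝ) : ℂ) • u - d)
  rw [hRu] at h4
  rw [h3]
  exact eq_neg_of_add_eq_zero_left h4

end Oseen

namespace Oseen

open scoped InnerProductSpace ComplexConjugate

/-! ### Spectra of dissipative operators -/

section Dissipative

variable {E : Type*} [NormedAddCommGroup E] [InnerProductSpace ℂ E]

/-- Cauchy-Schwarz applied to `Re ⟨w, (z - B) w⟩ ≥ (Re z + m) ‖w‖²`. -/
theorem mul_norm_le_of_dissipative {B : E →ₗ.[ℂ] E} {m : ℝ}
    (hd : ∀ w : B.domain, (⟪(w : E), B w⟫_ℂ).re ≤ -m * ‖(w : E)‖ ^ 2) (z : ℂ) (w : B.domain) :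
    (z.re + m) * ‖(w : E)‖ ≤ ‖z • (w : E) - B w‖ := by
  rcases (norm_nonneg (w : E)).eq_or_lt with h | h
  · rw [← h, mul_zero]
    exact norm_nonneg _
  · have h1 : (⟪(w : E), z • (w : E) - B w⟫_ℂ).re ≤ ‖(w : E)‖ * ‖z • (w : E) - B w‖ :=
      (Complex.re_le_norm _).trans (norm_inner_le_norm _ _)
    have h2 : (⟪(w : E), z • (w : E)⟫_ℂ).re = z.re * ‖(w : E)‖ ^ 2 := by
      rw [inner_smul_right, inner_self_eq_norm_sq_to_K]
      have : ((‖(w : E)‖ : ℂ)) ^ 2 = ((‖(w : E)‖ ^ 2 : ℝ) : ℂ) := by push_cast; rfl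
      simp only [Complex.coe_algebraMap, this, Complex.re_mul_ofReal]
    rw [inner_sub_right, Complex.sub_re, h2] at h1
    have h3 := hd w
    refine le_of_mul_le_mul_left ?_ h
    linarith

variable [CompleteSpace E]

/-- An operator `B` with `B + m` dissipative and `l - B` onto for large real `l` has its spectrum
in the half-plane `Re z ≤ -m`. -/
theorem spectrum_subset_of_dissipative {B : E →ₗ.[ℂ] E} {m l₀ : ℝ}
    (hd : ∀ w : B.domain, (⟪(w : E), B w⟫_ℂ).re ≤ -m * ‖(w : E)‖ ^ 2)
    (hs : ∀ l : ℝ, l₀ ≤ l → ∀ f : E, ∃ w : B.domain, (l : ℂ) • (w : E) - B w = f) :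
    spectrum B ⊆ {z : ℂ | z.re ≤ -m} := by
  intro z hz
  by_contra hzm
  have hzm' : 0 < z.re + m := by
    have : ¬ z.re ≤ -m := hzm
    linarith
  have hinj : ∀ y : ℂ, 0 < y.re + m → ∀ u v : B.domain,
      y • (u : E) - B u = y • (v : E) - B v → u = v := by
    intro y hy u v huv
    have h := mul_norm_le_of_dissipative hd y (u - v)
    have h0 : y • ((u - v : B.domain) : E) - B (u - v) = 0 := by
      rw [B.map_sub, Submodule.coe_sub, smul_sub, sub_sub_sub_comm, huv, sub_self]
    rw [h0, norm_zero] at h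
    have h1 : ‖((u - v : B.domain) : E)‖ = 0 :=
      le_antisymm (nonpos_of_mul_nonpos_right h hy) (norm_nonneg _)
    exact sub_eq_zero.1 (Subtype.ext (norm_eq_zero.1 h1))
  -- The discs `|z - l| < l + m` exhaust the half-plane `Re z > -m` as `l` grows: squaring, the
  -- condition is `|z|² - m² < 2 l (Re z + m)`.
  obtain ⟨l, hl0, hlm, hl⟩ : ∃ l : ℝ, l₀ ≤ l ∧ 0 < l + m ∧ ‖z - l‖ < l + m := by
    refine ⟨max l₀ (max (-m + 1) ((z.re ^ 2 + z.im ^ 2 - m ^ 2) / (2 * (z.re + m)) + 1)),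
      le_max_left _ _, ?_, ?_⟩
    · have := (le_max_left (-m + 1) ((z.re ^ 2 + z.im ^ 2 - m ^ 2) / (2 * (z.re + m)) + 1)).trans
        (le_max_right l₀ _)
      linarith
    · set l := max l₀ (max (-m + 1) ((z.re ^ 2 + z.im ^ 2 - m ^ 2) / (2 * (z.re + m)) + 1))
      have h1 : -m + 1 ≤ l := (le_max_left _ _).trans (le_max_right _ _)
      have h2 : (z.re ^ 2 + z.im ^ 2 - m ^ 2) / (2 * (z.re + m)) < l :=
        (lt_add_one _).trans_le ((le_max_right _ _).trans (le_max_right _ _))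
      rw [div_lt_iff₀ (by positivity)] at h2
      refine lt_of_pow_lt_pow_left₀ 2 (by linarith) ?_
      rw [Complex.sq_norm, Complex.normSq_apply]
      simp only [Complex.sub_re, Complex.ofReal_re, Complex.sub_im, Complex.ofReal_im]
      nlinarith
  choose W hW using hs l hl0
  have hl' : 0 < (l : ℂ).re + m := by simpa using hlm
  -- The inverse of `l - B`, linear by injectivity and of norm at most `(l + m)⁻¹` by dissipativity.
  let S : E →ₗ[ℂ] E :=
    { toFun := fun f => W f
      map_add' := fun f g => by
        rw [← Submodule.coe_add]
        refine congrArg _ (hinj l hl' _ _ ?_)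
        rw [hW, B.map_add, Submodule.coe_add, smul_add, add_sub_add_comm, hW, hW]
      map_smul' := fun c f => by
        rw [RingHom.id_apply, ← Submodule.coe_smul]
        refine congrArg _ (hinj l hl' _ _ ?_)
        rw [hW, B.map_smul, Submodule.coe_smul, smul_comm, ← smul_sub, hW] }
  have hS : ∀ f, ‖S f‖ ≤ (l + m)⁻¹ * ‖f‖ := fun f => by
    have h := mul_norm_le_of_dissipative hd l (W f)
    rw [hW, Complex.ofReal_re] at h
    rw [inv_mul_eq_div, le_div_iff₀ hlm, mul_comm]
    exact h
  let Rl : E →L[ℂ] E := S.mkContinuous _ hS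
  have hn : ‖-((z - l) • Rl)‖ < 1 := by
    rw [norm_neg, norm_smul]
    calc ‖z - l‖ * ‖Rl‖ ≤ ‖z - l‖ * (l + m)⁻¹ := by
          gcongr
          exact S.mkContinuous_norm_le (by positivity) hS
      _ < 1 := by rwa [← div_eq_mul_inv, div_lt_one hlm]
  -- Factor `z - B = (1 + (z - l) Rl)(l - B)`; the choice of `l` makes the first factor invertible
  -- by a Neumann series.
  obtain ⟨U, hU⟩ : IsUnit (1 + (z - l) • Rl) := by
    have := isUnit_one_sub_of_norm_lt_one hn
    rwa [sub_neg_eq_add] at this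
  have hQ : ∀ f, z • (W ((↑U⁻¹ : E →L[ℂ] E) f) : E) - B (W ((↑U⁻¹ : E →L[ℂ] E) f)) = f := by
    intro f
    have h1 : ((U : E →L[ℂ] E) * (↑U⁻¹ : E →L[ℂ] E)) f = f := by rw [U.mul_inv]; rfl
    rw [hU] at h1
    have h2 := hW ((↑U⁻¹ : E →L[ℂ] E) f)
    have h3 : (↑U⁻¹ : E →L[ℂ] E) f + (z - l) • (W ((↑U⁻¹ : E →L[ℂ] E) f) : E) = f := h1
    calc z • (W ((↑U⁻¹ : E →L[ℂ] E) f) : E) - B (W ((↑U⁻¹ : E →L[ℂ] E) f))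
        = ((l : ℂ) • (W ((↑U⁻¹ : E →L[ℂ] E) f) : E) - B (W ((↑U⁻¹ : E →L[ℂ] E) f))) +
            (z - l) • (W ((↑U⁻¹ : E →L[ℂ] E) f) : E) := by module
      _ = f := by rw [h2, h3]
  refine hz ⟨Rl.comp (↑U⁻¹ : E →L[ℂ] E), fun f => ⟨(W _).2, hQ f⟩, fun w => ?_⟩
  exact congrArg Subtype.val (hinj z hzm' _ _ (hQ _))

end Dissipative

/-! ### The linearized operator on low Hermite modes -/

theorem eq_zero_or_single_of_decayRate_lt {k : Fin 2 → ℕ} (h : decayRate k < 1) :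
    k = 0 ∨ ∃ i, k = Pi.single i 1 := by
  have h1 : k 0 + k 1 < 2 := by
    unfold decayRate at h
    have : ((k 0 + k 1 : ℕ) : ℝ) < (2 : ℕ) := by push_cast; linarith
    exact_mod_cast this
  have h2 : (k 0 = 0 ∧ k 1 = 0) ∨ (k 0 = 1 ∧ k 1 = 0) ∨ (k 0 = 0 ∧ k 1 = 1) := by omega
  rcases h2 with ⟨h2, h3⟩ | ⟨h2, h3⟩ | ⟨h2, h3⟩
  · left; funext j; fin_cases j <;> simp [h2, h3]
  · right; refine ⟨0, ?_⟩; funext j; fin_cases j <;> simp [h2, h3]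
  · right; refine ⟨1, ?_⟩; funext j; fin_cases j <;> simp [h2, h3]

/-- `Λ` vanishes on the Hermite functions of degree at most one. -/
theorem transport_add_nonlocal_eq_zero {k : Fin 2 → ℕ} (hk : decayRate k < 1) {s n : X}
    (hs : (hermiteFun k, s) ∈ transportGraph) (hn : (hermiteFun k, n) ∈ nonlocalGraph) :
    s + n = 0 := by
  refine X_ext ?_
  have hn' : ∀ᵐ ξ, n ξ = nonlocalTerm (hermiteFun k) ξ := hn
  rcases eq_zero_or_single_of_decayRate_lt hk with rfl | ⟨i, rfl⟩
  · filter_upwards [transport_hermiteFun hs, hn', nonlocalTerm_hermiteFun_zero,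
      coeFn_add_ae s n, coeFn_zero_ae] with ξ h1 h2 h3 h4 h5
    rw [h4, h5, h1, h2, h3]
    simp [pderiv_hermite_of_eq_zero]
  · have hp : ∀ (j : Fin 2) ξ, pderiv j (hermite (Pi.single i 1)) ξ =
        if j = i then 1 / 2 else 0 := by
      intro j ξ
      by_cases h : j = i
      · subst h
        have := congrFun (pderiv_hermite_succ 0 j) ξ
        rw [zero_add] at this
        rw [this, hermite_zero]
        simp
      · rw [pderiv_hermite_of_eq_zero (by simp [h])]
        simp [h]
    filter_upwards [transport_hermiteFun hs, hn', nonlocalTerm_hermiteFun_single i,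
      coeFn_add_ae s n, coeFn_zero_ae] with ξ h1 h2 h3 h4 h5
    rw [h4, h5, h1, h2, h3]
    simp only [hp, mul_ite, mul_zero, Finset.sum_ite_eq', Finset.mem_univ, if_true]
    push_cast
    ring

theorem hermiteFun_mem_diffusion (k : Fin 2 → ℕ) :
    ∃ d s, (hermiteFun k, d) ∈ diffusionOp.graph ∧ (hermiteFun k, s) ∈ transportGraph := by
  obtain ⟨R, D, -, hD, hR', -, hRD, hR⟩ := exists_diffusion_resolvent le_rfl
  obtain ⟨T, -, hT, -⟩ := exists_transport hD hRD
  have hpos : 1 + decayRate k ≠ 0 := by linarith [decayRate_nonneg k]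
  have hne : (((1 + decayRate k : ℝ)) : ℂ) ≠ 0 := by exact_mod_cast hpos
  have hRf : R (((1 + decayRate k : ℝ) : ℂ) • hermiteFun k) = hermiteFun k := by
    rw [map_smul, hR', smul_smul, Complex.ofReal_inv, mul_inv_cancel₀ hne, one_smul]
  have h1 := hR (((1 + decayRate k : ℝ) : ℂ) • hermiteFun k)
  have h2 := hT (((1 + decayRate k : ℝ) : ℂ) • hermiteFun k)
  rw [hRf] at h1 h2
  exact ⟨_, _, h1, h2⟩

/-- `Λ` is skew and annihilates these modes, so its contribution to the pairing vanishes: a mode of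
degree at most one is a left eigenvector of `𝓛 - αΛ`. -/
theorem inner_hermiteFun_linearizedOp {α : ℝ} {w f : X} (h : (w, f) ∈ (linearizedOp α).graph)
    {k : Fin 2 → ℕ} (hk : decayRate k < 1) :
    ⟪hermiteFun k, f⟫_ℂ = -(decayRate k : ℂ) * ⟪hermiteFun k, w⟫_ℂ := by
  obtain ⟨d, t, n, hd, ht, hn, e⟩ := mem_graph_linearizedOp.1 h
  obtain ⟨N, hN⟩ := exists_nonlocal_clm
  obtain ⟨-, s, -, hs⟩ := hermiteFun_mem_diffusion k
  have h0 : ⟪s + N (hermiteFun k), w⟫_ℂ = 0 := by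
    rw [transport_add_nonlocal_eq_zero hk hs (hN _), inner_zero_left]
  rw [inner_add_left] at h0
  simp only at hd ht hn e
  rw [e, inner_sub_right, inner_smul_right, inner_add_right, inner_hermiteFun_diffusion hd,
    inner_hermiteFun_transport hs ht, inner_nonlocal_skew hn (hN _)]
  linear_combination (α : ℂ) * h0

/-! ### Subspaces of functions without low Hermite modes -/

/-- The functions orthogonal to all Hermite functions with decay rate less than `m`. -/
def highModes (m : ℝ) : Submodule ℂ X where
  carrier := {w | ∀ k, decayRate k < m → ⟪hermiteFun k, w⟫_ℂ = 0}
  add_mem' := fun hu hv k hk => by rw [inner_add_right, hu k hk, hv k hk, add_zero]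
  zero_mem' := fun k _ => inner_zero_right _
  smul_mem' := fun c u hu k hk => by rw [inner_smul_right, hu k hk, mul_zero]

theorem mem_highModes {m : ℝ} {w : X} :
    w ∈ highModes m ↔ ∀ k, decayRate k < m → ⟪hermiteFun k, w⟫_ℂ = 0 := Iff.rfl

theorem isClosed_highModes (m : ℝ) : IsClosed (highModes m : Set X) := by
  have : (highModes m : Set X) =
      ⋂ k, ⋂ (_ : decayRate k < m), {w : X | ⟪hermiteFun k, w⟫_ℂ = 0} := by
    ext w
    simp [mem_highModes]
  rw [this]
  exact isClosed_iInter fun k => isClosed_iInter fun _ =>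
    isClosed_eq (by fun_prop) continuous_const

instance (m : ℝ) : CompleteSpace (highModes m) := (isClosed_highModes m).completeSpace_coe

theorem highModes_zero : highModes 0 = ⊤ :=
  eq_top_iff.2 fun _ _ k hk => absurd hk (decayRate_nonneg k).not_gt

theorem inner_hermiteFun_zero (w : X) : ⟪hermiteFun 0, w⟫_ℂ = ∫ ξ, w ξ := by
  rw [inner_hermiteFun, hermite_zero]
  simp

theorem inner_hermiteFun_single (i : Fin 2) (w : X) :
    ⟪hermiteFun (Pi.single i 1), w⟫_ℂ = (∫ ξ : Plane, w ξ * ((ξ i : ℝ) : ℂ)) / 2 := by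
  rw [inner_hermiteFun, hermite_single, ← integral_div]
  refine integral_congr_ae (Filter.Eventually.of_forall fun ξ => ?_)
  push_cast
  ring

theorem decayRate_zero : decayRate 0 = 0 := by simp [decayRate]

theorem decayRate_single (i : Fin 2) : decayRate (Pi.single i 1) = 1 / 2 := by
  fin_cases i <;> simp [decayRate]

/-- The strict inequality in `highModes` matters: the modes of degree one decay at rate exactly
`1/2`, so only the constant polynomial `H_0` gives a constraint. -/
theorem highModes_half : highModes (1 / 2) = X₀ := by
  ext w
  rw [mem_highModes]
  change _ ↔ ∫ ξ, w ξ = 0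
  rw [← inner_hermiteFun_zero]
  constructor
  · exact fun h => h 0 (by rw [decayRate_zero]; norm_num)
  · intro h k hk
    rcases eq_zero_or_single_of_decayRate_lt (hk.trans (by norm_num)) with rfl | ⟨i, rfl⟩
    · exact h
    · rw [decayRate_single] at hk
      exact absurd hk (lt_irrefl _)

/-- The constraints come from `H_0 = 1` and `H_(eᵢ) = ξᵢ / 2`, that is, from the total mass and the
first moments. -/
theorem highModes_one : highModes 1 = X₁ := by
  ext w
  rw [mem_highModes]
  change _ ↔ ∫ ξ, w ξ = 0 ∧ ∀ i : Fin 2, ∫ ξ : Plane, w ξ * ((ξ i : ℝ) : ℂ) = 0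
  rw [← inner_hermiteFun_zero]
  constructor
  · refine fun h => ⟨h 0 (by rw [decayRate_zero]; norm_num), fun i => ?_⟩
    have := h (Pi.single i 1) (by rw [decayRate_single]; norm_num)
    rw [inner_hermiteFun_single] at this
    simpa using this
  · rintro ⟨h0, h1⟩ k hk
    rcases eq_zero_or_single_of_decayRate_lt hk with rfl | ⟨i, rfl⟩
    · exact h0
    · rw [inner_hermiteFun_single, h1, zero_div]

/-- Low coefficients are only multiplied by `-decayRate k`. The restriction `m ≤ 1` keeps the
constraints among modes annihilated by `Λ`. -/
theorem linearizedOp_mem_highModes {α m : ℝ} (hm : m ≤ 1) {w f : X}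
    (h : (w, f) ∈ (linearizedOp α).graph) (hw : w ∈ highModes m) : f ∈ highModes m := by
  intro k hk
  rw [inner_hermiteFun_linearizedOp h (hk.trans_le hm), hw k hk, mul_zero]

/-! ### Dissipativity and surjectivity -/

theorem re_inner_eq_zero_of_skew {u v : X} (h : ⟪u, v⟫_ℂ = -⟪v, u⟫_ℂ) : (⟪u, v⟫_ℂ).re = 0 := by
  have h1 : (⟪u, v⟫_ℂ).re = (⟪v, u⟫_ℂ).re := inner_re_symm (𝕜 := ℂ) u v
  have h2 := congrArg Complex.re h
  rw [Complex.neg_re] at h2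
  linarith

/-- Parseval: `Re ⟨w, 𝓛 w⟩` is the sum of `-decayRate k` times the squared coefficients, and the
coefficients with rate below `m` vanish. -/
theorem re_inner_diffusion_le {m : ℝ} {w d : X} (h : (w, d) ∈ diffusionOp.graph)
    (hw : w ∈ highModes m) : (⟪w, d⟫_ℂ).re ≤ -m * ‖w‖ ^ 2 := by
  have h1 := Complex.hasSum_re (hermiteBasis.hasSum_inner_mul_inner w d)
  have h2 := (Complex.hasSum_re (hermiteBasis.hasSum_inner_mul_inner w w)).mul_left (-m)
  have h3 : (⟪w, w⟫_ℂ).re = ‖w‖ ^ 2 := by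
    simpa using inner_self_eq_norm_sq (𝕜 := ℂ) w
  rw [h3] at h2
  refine hasSum_le (fun k => ?_) h1 h2
  have e1 : ⟪hermiteBasis k, d⟫_ℂ = -(decayRate k : ℂ) * ⟪hermiteBasis k, w⟫_ℂ := by
    rw [hermiteBasis_eq, inner_smul_left, inner_smul_left, inner_hermiteFun_diffusion h]
    ring
  have e2 : ⟪w, hermiteBasis k⟫_ℂ * ⟪hermiteBasis k, w⟫_ℂ =
      ((‖⟪hermiteBasis k, w⟫_ℂ‖ ^ 2 : ℝ) : ℂ) := by
    rw [← inner_conj_symm, Complex.conj_mul']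
    push_cast
    rfl
  rw [e1, mul_left_comm, e2, ← Complex.ofReal_neg, ← Complex.ofReal_mul, Complex.ofReal_re,
    Complex.ofReal_re]
  rcases lt_or_ge (decayRate k) m with hk | hk
  · have : ⟪hermiteBasis k, w⟫_ℂ = 0 := by
      rw [hermiteBasis_eq, inner_smul_left, hw k hk, mul_zero]
    simp [this]
  · gcongr

theorem re_inner_linearizedOp_le {α m : ℝ} {w f : X} (h : (w, f) ∈ (linearizedOp α).graph)
    (hw : w ∈ highModes m) : (⟪w, f⟫_ℂ).re ≤ -m * ‖w‖ ^ 2 := by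
  obtain ⟨d, t, n, hd, ht, hn, e⟩ := mem_graph_linearizedOp.1 h
  simp only at hd ht hn e
  have h1 := re_inner_eq_zero_of_skew (inner_transport_skew hd ht ht)
  have h2 := re_inner_eq_zero_of_skew (inner_nonlocal_skew hn hn)
  rw [e, inner_sub_right, inner_smul_right, inner_add_right, Complex.sub_re,
    Complex.re_ofReal_mul, Complex.add_re, h1, h2, add_zero, mul_zero, sub_zero]
  exact re_inner_diffusion_le hd hw

/-- On the range of `R`, `l - 𝓛 + αΛ` is `(1 + αΛR)(l - 𝓛)`, and `ΛR = T + N R` has norm at most `(2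
+ ‖N‖) l^(-1/2)`. For large `l` the first factor is inverted by a Neumann series. -/
theorem exists_linearizedOp_eq (α : ℝ) : ∃ l₀ : ℝ, 0 < l₀ ∧ ∀ l : ℝ, l₀ ≤ l → ∀ f : X,
    ∃ w g : X, (w, g) ∈ (linearizedOp α).graph ∧ (l : ℂ) • w - g = f := by
  obtain ⟨N, hN⟩ := exists_nonlocal_clm
  -- Chosen so that `√l ≥ c` makes the perturbation at most `(c - 1)/√l < 1`; the added `1` also
  -- ensures `l ≥ 1`.
  set c : ℝ := |α| * (2 + ‖N‖) + 1 with hc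
  have hc1 : 1 ≤ c := by
    have : 0 ≤ |α| * (2 + ‖N‖) := by positivity
    linarith
  refine ⟨c ^ 2, by positivity, fun l hl f => ?_⟩
  have hl1 : 1 ≤ l := (one_le_pow₀ hc1).trans hl
  have hsq : c ≤ Real.sqrt l := Real.le_sqrt_of_sq_le hl
  have hsq0 : 0 < Real.sqrt l := by linarith
  obtain ⟨R, D, hRn, hD, -, -, hRD, hR⟩ := exists_diffusion_resolvent hl1
  obtain ⟨T, hTn, hT, -⟩ := exists_transport hD hRD
  have hB : ‖-((α : ℂ) • (T + N.comp R))‖ < 1 := by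
    rw [norm_neg, norm_smul, Complex.norm_real, Real.norm_eq_abs]
    have h1 : ‖T + N.comp R‖ ≤ (2 + ‖N‖) * (Real.sqrt l)⁻¹ := by
      refine (norm_add_le _ _).trans ?_
      rw [add_mul]
      refine add_le_add hTn ((ContinuousLinearMap.opNorm_comp_le _ _).trans ?_)
      gcongr
    calc |α| * ‖T + N.comp R‖ ≤ |α| * ((2 + ‖N‖) * (Real.sqrt l)⁻¹) := by gcongr
      _ = (c - 1) / Real.sqrt l := by rw [hc, div_eq_mul_inv]; ring
      _ < 1 := by rw [div_lt_one hsq0]; linarith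
  obtain ⟨U, hU⟩ : IsUnit (1 + (α : ℂ) • (T + N.comp R)) := by
    have := isUnit_one_sub_of_norm_lt_one hB
    rwa [sub_neg_eq_add] at this
  set h : X := (↑U⁻¹ : X →L[ℂ] X) f with hh
  have h1 : ((U : X →L[ℂ] X) * (↑U⁻¹ : X →L[ℂ] X)) f = f := by rw [U.mul_inv]; rfl
  rw [hU] at h1
  have h2 : h + (α : ℂ) • (T h + N (R h)) = f := h1
  refine ⟨R h, ((l : ℂ) • R h - h) - (α : ℂ) • (T h + N (R h)),
    mem_graph_linearizedOp.2 ⟨_, _, _, hR h, hT h, hN _, rfl⟩, ?_⟩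
  rw [← h2]
  module

/-! ### Spectral inclusions in `X` and in its invariant subspaces. -/

theorem spectrum_linearizedOp_subset (α : ℝ) :
    spectrum (linearizedOp α) ⊆ {z : ℂ | z.re ≤ 0} := by
  obtain ⟨l₀, -, hl⟩ := exists_linearizedOp_eq α
  have h := spectrum_subset_of_dissipative (B := linearizedOp α) (m := 0) (l₀ := l₀)
    (fun w => re_inner_linearizedOp_le ((linearizedOp α).mem_graph w)
      (by rw [highModes_zero]; trivial))
    (fun l h f => by
      obtain ⟨w, g, hg, e⟩ := hl l h f
      obtain ⟨u, rfl, rfl⟩ := (LinearPMap.mem_graph_iff _).1 hg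
      exact ⟨u, e⟩)
  simpa using h

/-- Dissipativity with constant `m` holds on `highModes m`, and solvability for large `l` is
inherited from `X`: a right-hand side without low modes has a solution without low modes. -/
theorem spectrum_induced_linearizedOp_subset (α : ℝ) {m : ℝ} (hm : m ≤ 1) :
    spectrum (induced (linearizedOp α) (highModes m)) ⊆ {z : ℂ | z.re ≤ -m} := by
  obtain ⟨l₀, hl₀, hl⟩ := exists_linearizedOp_eq α
  have hg : ∀ u v : highModes m, (u, v) ∈ (induced (linearizedOp α) (highModes m)).graph ↔
      ((u : X), (v : X)) ∈ (linearizedOp α).graph := fun u v => by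
    rw [graph_induced]
    rfl
  refine spectrum_subset_of_dissipative (l₀ := l₀) (fun w => ?_) (fun l h f => ?_)
  · exact re_inner_linearizedOp_le ((hg _ _).1 (LinearPMap.mem_graph _ w)) (w : highModes m).2
  · obtain ⟨w, g, hwg, e⟩ := hl l h f
    -- Pairing the equation with a low mode gives `(l + decayRate k) ⟨H_k G, w⟩ = 0`, and `l > 0`.
    have hw : w ∈ highModes m := fun k hk => by
      have h1 := f.2 k hk
      have h2 := inner_hermiteFun_linearizedOp hwg (hk.trans_le hm)
      rw [← e, inner_sub_right, inner_smul_right, h2] at h1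
      have h3 : (l : ℂ) + decayRate k ≠ 0 := by
        have : l + decayRate k ≠ 0 := by linarith [decayRate_nonneg k]
        exact_mod_cast this
      refine (mul_eq_zero.1 ?_).resolve_left h3
      linear_combination h1
    have hgm := linearizedOp_mem_highModes hm hwg hw
    obtain ⟨u, hu, hv⟩ := (LinearPMap.mem_graph_iff _).1
      ((hg ⟨w, hw⟩ ⟨g, hgm⟩).2 hwg)
    refine ⟨u, ?_⟩
    simp only at hu hv
    rw [hu, hv]
    exact Subtype.ext e

end Oseen

end

theorem mainTheorem9 (α : ℝ) :
    Oseen.spectrum (Oseen.linearizedOp α) ⊆ {z : ℂ | z.re ≤ 0} ∧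
    ((∀ w : (Oseen.linearizedOp α).domain,
        (w : Oseen.X) ∈ Oseen.X₀ → Oseen.linearizedOp α w ∈ Oseen.X₀) ∧
      Oseen.spectrum (Oseen.induced (Oseen.linearizedOp α) Oseen.X₀) ⊆
        {z : ℂ | z.re ≤ -(1 / 2)}) ∧
    ((∀ w : (Oseen.linearizedOp α).domain,
        (w : Oseen.X) ∈ Oseen.X₁ → Oseen.linearizedOp α w ∈ Oseen.X₁) ∧
      Oseen.spectrum (Oseen.induced (Oseen.linearizedOp α) Oseen.X₁) ⊆
        {z : ℂ | z.re ≤ -1}) := by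
  rw [← Oseen.highModes_half, ← Oseen.highModes_one]
  exact ⟨Oseen.spectrum_linearizedOp_subset α,
    ⟨fun w => Oseen.linearizedOp_mem_highModes (by norm_num) ((Oseen.linearizedOp α).mem_graph w),
      Oseen.spectrum_induced_linearizedOp_subset α (by norm_num)⟩,
    ⟨fun w => Oseen.linearizedOp_mem_highModes le_rfl ((Oseen.linearizedOp α).mem_graph w),
      Oseen.spectrum_induced_linearizedOp_subset α le_rfl⟩⟩
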